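/- Theorem (PLQ Kalman smoother theorem). Consider the linear state space model $x_1=x_0+w_1$, $x_k=G_kx_{k-1}+w_k$ for $2\le k\le N$, with measurements $z_k$ of $H_kx_k$ for $1\le k\le N$, where $x_k\in\mathbb R^n$, $z_k\in\mathbb R^m$, $x_0$ and the $z_k$, $G_k$, $H_k$ are known, and the noises are independent. Let $Q_k$ and $R_k$ be symmetric positive definite, and put $x=\mathrm{vec}(x_k)$, $z=\mathrm{vec}(z_k)$, $Q=\mathrm{diag}(Q_k)$, $R=\mathrm{diag}(R_k)$, $H=\mathrm{diag}(H_k)$, $\mu=\mathrm{vec}(x_0,0,\dots,0)$, and let $G$ be the block bidiagonal matrix with $I$ on the diagonal and $-G_k$ below it, so that $Gx-\mu$ is the process residual and $Hx-z$ the measurement residual. For $U=\{u: A^{T}u\le a\}$ let $\rho(U,M,b,B;y)=\sup_{u\in U}\{\langle u,b+By\rangle-\tfrac12\langle u,Mu\rangle\}\in(-\infty,\infty]$. It specifies a PLQ density, proportional to $e^{-\rho}$ (with respect to Lebesgue measure on the affine hull of $\{\rho<\infty\}$), if $M$ is symmetric positive semidefinite, $B$ is injective, $0\in U$, and $\rho(y)\to\infty$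 as $\|y\|\to\infty$. Suppose that the $k$-th process and measurement residuals have densities proportional to $\exp(-\rho(U^w_k,M^w_k,b^w_k,B^w_k;Q_k^{-1/2}\,\cdot))$ and $\exp(-\rho(U^v_k,M^v_k,b^v_k,B^v_k;R_k^{-1/2}\,\cdot))$, where these data specify PLQ densities that satisfy $$\mathrm{null}(M_k^w)\cap\mathrm{null}((A_k^w)^T)=\{0\},\qquad \mathrm{null}(M_k^v)\cap\mathrm{null}((A_k^v)^T)=\{0\}\qquad\text{for all }k .$$ Stacking the data ($U_w=\prod_k U_k^w$, $M_w=\mathrm{diag}(M_k^w)$, and so on), the MAP smoothing problem is $$\min_{x}\ \ \rho(U_w,M_w,b_w,B_w;Q^{-1/2}(Gx-\mu))+\rho(U_v,M_v,b_v,B_v;R^{-1/2}(Hx-z)),$$ which is $\min_x\rho(U,M,b,B;x)$ with $U=U_v\times U_w=\{u:A^Tu\le a\}$, $A=\mathrm{diag}(A_v,A_w)$, $M=\mathrm{diag}(M_v,M_w)$, $$b=\begin{pmatrix}b_v-B_vR^{-1/2}z\\ b_w-B_wQ^{-1/2}\mu\end{pmatrix},\qquad B=\begin{bmatrix}B_vR^{-1/2}H\\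 B_wQ^{-1/2}G\end{bmatrix}.$$ Let $$F_\gamma(s,q,u,x)=\big(s+A^Tu-a,\ (q_is_i-\gamma)_i,\ Bx-Mu-Aq+b,\ B^Tu\big)$$ be its relaxed KKT function, and let $\mathcal F_+$ be the set of all $(s,q,u,x)$ with $s>0$ and $q>0$ for which the first, third and fourth components of $F_\gamma$ vanish. Suppose that $\mathcal F_+\neq\emptyset$. Then the following hold. (1) The problem has a minimizer, with finite minimum, and is solved by an interior point method. Precisely: given $p_0\in\mathcal F_+$ and $\sigma\in(0,1)$, there is $t_0\in(0,1]$ such that for every $t\in(0,t_0]$ the damped Newton iteration $p_{j+1}=p_j+t\,\Delta_j$, where $F_{\gamma_j}^{(1)}(p_j)\Delta_j=-F_{\gamma_j}(p_j)$ and $\gamma_j=\sigma\, s_j^Tq_j/\ell$ with $\ell$ the number of columns of $A$ ($\gamma_j=0$ if $\ell=0$), stays in $\mathcal F_+$ and is bounded, $s_j^Tq_j\to0$, and the objective values at $x_j$ converge to the minimum. The sequence has a cluster point, and each cluster point satisfies the KKT system ($F_0=0$, $s,q\ge0$), and its $x$-component is a minimizer of the problem with finite objective value and a maximizer of the posterior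 density. (2) For every $p\in\mathcal F_+$ and $\gamma\in\mathbb R$ the derivative $F_\gamma^{(1)}(p)$ is invertible. The matrix $T=M+AD(s)^{-1}D(q)A^T$ is invertible, and the Newton system $F_\gamma^{(1)}(p)\Delta=-F_\gamma(p)=:(r_1,r_2,r_3,r_4)$ reduces to $\Omega\,\Delta x=r_4+B^TT^{-1}\big(r_3+AD(s)^{-1}(r_2-D(q)r_1)\big)$, where $\Omega=B^TT^{-1}B$ is symmetric positive definite and block tridiagonal with blocks of size $n\times n$. (3) Each Newton step costs $O(N(n^3+m^3+l))$ arithmetic operations, where $l$ bounds the number of columns of all $A_k^w$, $A_k^v$; the constant depends only on a bound for the number of nonzero entries in a column of $A^w_k$, $A^v_k$ and on a bound for the ratios of the dual dimensions to $n$ and $m$. Precisely: there is an absolute constant $C$ such that, whenever $U_k^w$ and $U_k^v$ lie in spaces of dimensions at most $\delta n$ and $\delta m$ and each column of each $A_k^w$, $A_k^v$ has at most $\kappa$ nonzero entries, at prescribed positions ($\delta,\kappa\ge1$), a straight-line program, the same for all models of the given dimensions and positions, computes from the model data ($x_0$, $z_k$, $G_k$, $H_k$, $Q_k^{-1/2}$,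 $R_k^{-1/2}$ and the noise specifications), any $(s,q,u,x)$ with $s,q>0$, $\gamma$ and $t$ the Newton direction $\Delta$ for $F_\gamma$ and the next point $(s,q,u,x)+t\Delta$, without ever dividing by zero, with at most $$C\,N\big(\delta^3(n^3+m^3)+\kappa^2\,l\big)$$ operations $+,-,\times,\div$ and rational constants. -/

import Mathlib

open Filter Topology Matrix MeasureTheory

noncomputable section

/-! ## Quadratic support functions with a polyhedral set `U` -/

/-- The data `U = {u | Aᵀ u ≤ a}`, `M`, `b`, `B` of a piecewise linear-quadratic function.
`ι` indexes the dual variable `u`, `κ` the primal variable `y`, and `c` the columns of `A`. -/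
structure PLQData (ι κ c : Type*) where
  M : Matrix ι ι ℝ
  b : ι → ℝ
  B : Matrix ι κ ℝ
  A : Matrix ι c ℝ
  a : c → ℝ

namespace PLQData

variable {ι κ c : Type*} [Fintype ι] [Fintype κ] [Fintype c]

/-- The polyhedron `U = {u | Aᵀ u ≤ a}`. -/
def U (P : PLQData ι κ c) : Set (ι → ℝ) := {u | P.Aᵀ *ᵥ u ≤ P.a}

/-- `ρ(U, M, b, B; y) = sup_{u ∈ U} { ⟨u, b + B y⟩ - ½ ⟨u, M u⟩ }`, with values in `[-∞, ∞]`. -/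
def rho (P : PLQData ι κ c) (y : κ → ℝ) : EReal :=
  ⨆ u ∈ P.U, ((u ⬝ᵥ (P.b + P.B *ᵥ y) - 1 / 2 * (u ⬝ᵥ (P.M *ᵥ u)) : ℝ) : EReal)

/-- `P` specifies a PLQ density: `M` is symmetric positive semidefinite, `B` is injective,
`0 ∈ U` (so that `ρ` is a penalty), and `ρ` is coercive. -/
structure IsPLQDensity (P : PLQData ι κ c) : Prop where
  posSemidef : P.M.PosSemidef
  injective : Function.Injective fun y => P.B *ᵥ y
  zero_mem : (0 : ι → ℝ) ∈ P.U
  coercive : Tendsto P.rho (Bornology.cobounded (κ → ℝ)) (𝓝 ⊤)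

/-- `null(M) ∩ null(Aᵀ) = {0}`. -/
def NullSpaceCondition (P : PLQData ι κ c) : Prop :=
  {u : ι → ℝ | P.M *ᵥ u = 0} ∩ {u | P.Aᵀ *ᵥ u = 0} = {0}

/-- The function `y ↦ ρ(S y)`: the matrix `B` is replaced by `B S`. -/
def compMatrix (P : PLQData ι κ c) (S : Matrix κ κ ℝ) : PLQData ι κ c :=
  { P with B := P.B * S }

/-- The domain `{y | ρ(y) < ∞}`, as a subset of Euclidean space. -/
def dom (P : PLQData ι κ c) : Set (EuclideanSpace ℝ κ) := {y | P.rho y.ofLp < ⊤}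

/-- The dimension of the affine hull of the domain of `ρ`. -/
def domDim (P : PLQData ι κ c) : ℕ := Module.finrank ℝ (affineSpan ℝ P.dom).direction

/-- The constant `∫_{dom ρ} exp(-ρ(y)) dy`, the integral being with respect to the
`dim (aff (dom ρ))`-dimensional Lebesgue measure. -/
def normalizer (P : PLQData ι κ c) : ℝ :=
  ∫ y in P.dom, Real.exp (-(P.rho y.ofLp).toReal)
    ∂(Measure.euclideanHausdorffMeasure P.domDim : Measure (EuclideanSpace ℝ κ))

open Classical in
/-- The density `exp(-ρ) / ∫ exp(-ρ)` on `dom ρ`, and `0` elsewhere. -/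
def density (P : PLQData ι κ c) (y : κ → ℝ) : ℝ :=
  if P.rho y = ⊤ then 0 else P.normalizer⁻¹ * Real.exp (-(P.rho y).toReal)

end PLQData

/-! ## The KKT system, its relaxation, and interior point iterations -/

/-- The points `(s, q, u, y)`. -/
abbrev IPPoint (ι κ c : Type*) := (c → ℝ) × (c → ℝ) × (ι → ℝ) × (κ → ℝ)

namespace PLQData

variable {ι κ c : Type*} [Fintype ι] [Fintype κ] [Fintype c]

/-- The relaxed KKT function `F_γ`. -/
def relaxedKKT (P : PLQData ι κ c) (γ : ℝ) (p : IPPoint ι κ c) : IPPoint ι κ c :=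
  match p with
  | (s, q, u, y) =>
    (s + P.Aᵀ *ᵥ u - P.a,
      (fun i => q i * s i - γ),
      P.B *ᵥ y - P.M *ᵥ u - P.A *ᵥ q + P.b,
      P.Bᵀ *ᵥ u)

/-- The KKT system for the minimization of `ρ`. -/
def IsKKT (P : PLQData ι κ c) (p : IPPoint ι κ c) : Prop :=
  match p with
  | (s, q, u, y) =>
    0 = P.Bᵀ *ᵥ u ∧
    0 = P.b + P.B *ᵥ y - P.M *ᵥ u - P.A *ᵥ q ∧
    0 = P.Aᵀ *ᵥ u + s - P.a ∧
    (∀ i, 0 = q i * s i) ∧ (∀ i, 0 ≤ q i) ∧ (∀ i, 0 ≤ s i)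

/-- The strict feasibility region `F₊` of the KKT system. -/
def strictlyFeasible (P : PLQData ι κ c) : Set (IPPoint ι κ c) :=
  {p | match p with
    | (s, q, u, y) =>
      (∀ i, 0 < s i) ∧ (∀ i, 0 < q i) ∧
      0 = P.Bᵀ *ᵥ u ∧
      0 = P.b + P.B *ᵥ y - P.M *ᵥ u - P.A *ᵥ q ∧
      0 = P.Aᵀ *ᵥ u + s - P.a}

/-- The derivative `F_γ⁽¹⁾(p)`. -/
def kktDeriv (P : PLQData ι κ c) (γ : ℝ) (p : IPPoint ι κ c) :
    IPPoint ι κ c →L[ℝ] IPPoint ι κ c :=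
  fderiv ℝ (P.relaxedKKT γ) p

/-- The Newton direction `Δ` at `p`, the solution of `F_γ⁽¹⁾(p) Δ = - F_γ(p)`
when `F_γ⁽¹⁾(p)` is invertible. -/
def newtonDir (P : PLQData ι κ c) (γ : ℝ) (p : IPPoint ι κ c) : IPPoint ι κ c :=
  (P.kktDeriv γ p).inverse (-(P.relaxedKKT γ p))

/-- The damped Newton step of length `t` for `F_γ = 0`. -/
def dampedNewton (P : PLQData ι κ c) (γ t : ℝ) (p : IPPoint ι κ c) : IPPoint ι κ c :=
  p + t • P.newtonDir γ p

/-- The complementarity gap `sᵀ q`. -/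
def gap (p : IPPoint ι κ c) : ℝ := p.1 ⬝ᵥ p.2.1

/-- One interior point iteration: a damped Newton step of length `t` towards the point of the
central path with parameter `γ = σ sᵀq / ℓ`, where `ℓ` is the number of constraints. -/
def ipIteration (P : PLQData ι κ c) (σ t : ℝ) (p : IPPoint ι κ c) : IPPoint ι κ c :=
  P.dampedNewton (σ * (gap p / Fintype.card c)) t p

variable [DecidableEq ι] [DecidableEq c]

/-- `T = M + A D(s)⁻¹ D(q) Aᵀ`. -/
def redT (P : PLQData ι κ c) (p : IPPoint ι κ c) : Matrix ι ι ℝ :=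
  P.M + P.A * diagonal (fun i => (p.1 i)⁻¹ * p.2.1 i) * P.Aᵀ

/-- The matrix `Ω = Bᵀ T⁻¹ B` of the reduced Newton system. -/
def redOmega (P : PLQData ι κ c) (p : IPPoint ι κ c) : Matrix κ κ ℝ :=
  P.Bᵀ * (P.redT p)⁻¹ * P.B

/-- The right-hand side of the reduced Newton system `Ω Δy = ϱ`: with `(r₁, r₂, r₃, r₄) = -F_γ(p)`,
`ϱ = r₄ + Bᵀ T⁻¹ (r₃ + A D(s)⁻¹ (r₂ - D(q) r₁))`. -/
def redRhs (P : PLQData ι κ c) (γ : ℝ) (p : IPPoint ι κ c) : κ → ℝ :=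
  match -(P.relaxedKKT γ p) with
  | (r₁, r₂, r₃, r₄) =>
    r₄ + P.Bᵀ *ᵥ ((P.redT p)⁻¹ *ᵥ
      (r₃ + P.A *ᵥ fun i => (p.1 i)⁻¹ * (r₂ i - p.2.1 i * r₁ i)))

end PLQData

/-! ## The Kalman smoothing model -/

/-- The index set of `vec(r₁, …, r_N)` with `r_k` of length `d k`. -/
abbrev Stack {N : ℕ} (d : Fin N → ℕ) := Σ k : Fin N, Fin (d k)

/-- The specification of `vec(y₁, …, y_N)` for independent `y_k` with specifications `P k`. -/
def PLQData.stack {N n : ℕ} {p l : Fin N → ℕ}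
    (P : (k : Fin N) → PLQData (Fin (p k)) (Fin n) (Fin (l k))) :
    PLQData (Stack p) (Stack fun _ : Fin N => n) (Stack l) where
  M := blockDiagonal' fun k => (P k).M
  b := fun i => (P i.1).b i.2
  B := blockDiagonal' fun k => (P k).B
  A := blockDiagonal' fun k => (P k).A
  a := fun i => (P i.1).a i.2

open scoped MatrixOrder in
/-- `Q^{-1/2}`, for a positive definite matrix `Q`. -/
def invSqrt {n : ℕ} (Q : Matrix (Fin n) (Fin n) ℝ) : Matrix (Fin n) (Fin n) ℝ :=
  (CFC.sqrt Q)⁻¹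

/-- The data of the linear model `x₁ = x₀ + w₁`, `x_k = G_k x_{k-1} + w_k` for `k ≥ 2`,
`z_k = H_k x_k + v_k`, with `N` time points, states in `ℝⁿ` and measurements in `ℝᵐ`.
The time index runs through `Fin N`, and the matrix `G 0` is not used. The noises of time `k`
have the specifications `w k` and `v k`, after whitening by `Q_k^{-1/2}` and `R_k^{-1/2}`;
their dual dimensions are `pw k`, `pv k`, and `lw k`, `lv k` are the column dimensions of
the matrices `A_k^w`, `A_k^v`. -/
structure KalmanModel (N n m : ℕ) (pw pv lw lv : Fin N → ℕ) where
  x₀ : Fin n → ℝ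
  z : Fin N → Fin m → ℝ
  G : Fin N → Matrix (Fin n) (Fin n) ℝ
  H : Fin N → Matrix (Fin m) (Fin n) ℝ
  Q : Fin N → Matrix (Fin n) (Fin n) ℝ
  R : Fin N → Matrix (Fin m) (Fin m) ℝ
  w : (k : Fin N) → PLQData (Fin (pw k)) (Fin n) (Fin (lw k))
  v : (k : Fin N) → PLQData (Fin (pv k)) (Fin m) (Fin (lv k))

namespace KalmanModel

variable {N n m : ℕ} {pw pv lw lv : Fin N → ℕ}

/-- All noises come from PLQ densities, with positive definite `Q_k` and `R_k`. -/
structure HasPLQNoise (K : KalmanModel N n m pw pv lw lv) : Prop where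
  posDef_Q : ∀ k, (K.Q k).PosDef
  posDef_R : ∀ k, (K.R k).PosDef
  process : ∀ k, (K.w k).IsPLQDensity
  measurement : ∀ k, (K.v k).IsPLQDensity

/-- The null-space condition for every `k`. -/
def NullSpaceCondition (K : KalmanModel N n m pw pv lw lv) : Prop :=
  ∀ k, (K.w k).NullSpaceCondition ∧ (K.v k).NullSpaceCondition

/-- The block bidiagonal matrix `G`, with `I` on the diagonal and `-G_k` below it. -/
def bigG (K : KalmanModel N n m pw pv lw lv) :
    Matrix (Stack fun _ : Fin N => n) (Stack fun _ : Fin N => n) ℝ :=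
  Matrix.of fun i j =>
    if i.1 = j.1 then (1 : Matrix (Fin n) (Fin n) ℝ) i.2 j.2
    else if (j.1 : ℕ) + 1 = i.1 then -(K.G i.1 i.2 j.2)
    else 0

/-- `H = diag(H_k)`. -/
def bigH (K : KalmanModel N n m pw pv lw lv) :
    Matrix (Stack fun _ : Fin N => m) (Stack fun _ : Fin N => n) ℝ :=
  blockDiagonal' K.H

/-- `Q^{-1/2}` for `Q = diag(Q_k)`. -/
def bigQ (K : KalmanModel N n m pw pv lw lv) :
    Matrix (Stack fun _ : Fin N => n) (Stack fun _ : Fin N => n) ℝ :=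
  blockDiagonal' fun k => invSqrt (K.Q k)

/-- `R^{-1/2}` for `R = diag(R_k)`. -/
def bigR (K : KalmanModel N n m pw pv lw lv) :
    Matrix (Stack fun _ : Fin N => m) (Stack fun _ : Fin N => m) ℝ :=
  blockDiagonal' fun k => invSqrt (K.R k)

/-- `μ = vec(x₀, 0, …, 0)`. -/
def bigMu (K : KalmanModel N n m pw pv lw lv) : (Stack fun _ : Fin N => n) → ℝ :=
  fun i => if (i.1 : ℕ) = 0 then K.x₀ i.2 else 0

/-- `z = vec(z_k)`. -/
def bigZ (K : KalmanModel N n m pw pv lw lv) : (Stack fun _ : Fin N => m) → ℝ :=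
  fun i => K.z i.1 i.2

/-- The objective
`ρ(U_w, M_w, b_w, B_w; Q^{-1/2}(G x - μ)) + ρ(U_v, M_v, b_v, B_v; R^{-1/2}(H x - z))`
of the smoothing problem. -/
def objective (K : KalmanModel N n m pw pv lw lv) (x : (Stack fun _ : Fin N => n) → ℝ) : EReal :=
  (PLQData.stack K.w).rho (K.bigQ *ᵥ (K.bigG *ᵥ x - K.bigMu)) +
    (PLQData.stack K.v).rho (K.bigR *ᵥ (K.bigH *ᵥ x - K.bigZ))

/-- The posterior density of the state sequence, up to a constant that does not depend on `x`:
the density `∝ exp(-ρ_w(Q^{-1/2} ·))` at the process residual `G x - μ`, times the density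
`∝ exp(-ρ_v(R^{-1/2} ·))` at the measurement residual `H x - z`. -/
def posterior (K : KalmanModel N n m pw pv lw lv) (x : (Stack fun _ : Fin N => n) → ℝ) : ℝ :=
  ((PLQData.stack K.w).compMatrix K.bigQ).density (K.bigG *ᵥ x - K.bigMu) *
    ((PLQData.stack K.v).compMatrix K.bigR).density (K.bigH *ᵥ x - K.bigZ)

/-- The objective written as a single PLQ function of `x`, with `U = U_v × U_w`. -/
def combined (K : KalmanModel N n m pw pv lw lv) :
    PLQData (Stack pv ⊕ Stack pw) (Stack fun _ : Fin N => n) (Stack lv ⊕ Stack lw) where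
  M := fromBlocks (PLQData.stack K.v).M 0 0 (PLQData.stack K.w).M
  b := Sum.elim
    ((PLQData.stack K.v).b - ((PLQData.stack K.v).B * K.bigR) *ᵥ K.bigZ)
    ((PLQData.stack K.w).b - ((PLQData.stack K.w).B * K.bigQ) *ᵥ K.bigMu)
  B := fromRows ((PLQData.stack K.v).B * K.bigR * K.bigH) ((PLQData.stack K.w).B * K.bigQ * K.bigG)
  A := fromBlocks (PLQData.stack K.v).A 0 0 (PLQData.stack K.w).A
  a := Sum.elim (PLQData.stack K.v).a (PLQData.stack K.w).a

end KalmanModel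

/-- Block tridiagonality of a matrix with blocks of size `n`. -/
def IsBlockTridiagonal {N n : ℕ}
    (W : Matrix (Stack fun _ : Fin N => n) (Stack fun _ : Fin N => n) ℝ) : Prop :=
  ∀ i j, (i.1 : ℕ) + 1 < j.1 ∨ (j.1 : ℕ) + 1 < i.1 → W i j = 0

/-! ## Counting arithmetic operations -/

/-- `Computes I t S`: a straight-line program for the inputs `I` (functions on the set `D` of all
problem instances) has produced, after `t` instructions, the values `S`. Every instruction is a
rational constant or one operation `+`, `-`, `*`, `/` on values that are already available; a
division is permitted only if the divisor vanishes at no instance. The program is the same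
for all instances in `D`. -/
inductive Computes {D : Type*} (I : Set (D → ℝ)) : ℕ → Set (D → ℝ) → Prop
  | start : Computes I 0 I
  | const {t : ℕ} {S : Set (D → ℝ)} (r : ℚ) (h : Computes I t S) :
      Computes I (t + 1) (insert (fun _ => (r : ℝ)) S)
  | add {t : ℕ} {S : Set (D → ℝ)} {f g : D → ℝ} (hf : f ∈ S) (hg : g ∈ S) (h : Computes I t S) :
      Computes I (t + 1) (insert (fun d => f d + g d) S)
  | sub {t : ℕ} {S : Set (D → ℝ)} {f g : D → ℝ} (hf : f ∈ S) (hg : g ∈ S) (h : Computes I t S) :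
      Computes I (t + 1) (insert (fun d => f d - g d) S)
  | mul {t : ℕ} {S : Set (D → ℝ)} {f g : D → ℝ} (hf : f ∈ S) (hg : g ∈ S) (h : Computes I t S) :
      Computes I (t + 1) (insert (fun d => f d * g d) S)
  | div {t : ℕ} {S : Set (D → ℝ)} {f g : D → ℝ} (hf : f ∈ S) (hg : g ∈ S) (h0 : ∀ d, g d ≠ 0)
      (h : Computes I t S) :
      Computes I (t + 1) (insert (fun d => f d / g d) S)

/-- The outputs `O` can be computed from the inputs `I` with at most `T` arithmetic operations. -/
def ComputableWithin {D : Type*} (I O : Set (D → ℝ)) (T : ℕ) : Prop :=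
  ∃ t ≤ T, ∃ S, Computes I t S ∧ O ⊆ S

/-- The coordinate functions of a vector that depends on the instance. -/
def coords {D ι : Type*} (f : D → ι → ℝ) : Set (D → ℝ) := Set.range fun i d => f d i

/-- The entry functions of a matrix that depends on the instance. -/
def entries {D ι κ : Type*} (f : D → Matrix ι κ ℝ) : Set (D → ℝ) :=
  Set.range fun ij : ι × κ => fun d => f d ij.1 ij.2

/-- The entries of a PLQ specification that depends on the instance. -/
def PLQData.entries {D ι κ c : Type*} (f : D → PLQData ι κ c) : Set (D → ℝ) :=
  _root_.entries (fun d => (f d).M) ∪ coords (fun d => (f d).b) ∪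
    _root_.entries (fun d => (f d).B) ∪ _root_.entries (fun d => (f d).A) ∪
    coords (fun d => (f d).a)

/-- The coordinates of a point `(s, q, u, y)` that depends on the instance. -/
def pointCoords {D ι κ c : Type*} (f : D → IPPoint ι κ c) : Set (D → ℝ) :=
  coords (fun d => (f d).1) ∪ coords (fun d => (f d).2.1) ∪
    coords (fun d => (f d).2.2.1) ∪ coords (fun d => (f d).2.2.2)

/-- The instances of the computation of a Newton step, for given dimensions and for given sets
`Sw k j`, `Sv k j` that contain the positions of the nonzero entries of the `j`-th column
of `A_k^w`, `A_k^v`. An instance consists of a smoothing model with PLQ noises that satisfy the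
null-space condition, a point `(s, q, u, x)` with `s, q > 0`, the parameter `γ`, and the
step length `t`. -/
structure NewtonInstance (N n m : ℕ) (pw pv lw lv : Fin N → ℕ)
    (Sw : (k : Fin N) → Fin (lw k) → Finset (Fin (pw k)))
    (Sv : (k : Fin N) → Fin (lv k) → Finset (Fin (pv k))) where
  K : KalmanModel N n m pw pv lw lv
  plq : K.HasPLQNoise
  null : K.NullSpaceCondition
  pattern_w : ∀ k i j, (K.w k).A i j ≠ 0 → i ∈ Sw k j
  pattern_v : ∀ k i j, (K.v k).A i j ≠ 0 → i ∈ Sv k j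
  p : IPPoint (Stack pv ⊕ Stack pw) (Stack fun _ : Fin N => n) (Stack lv ⊕ Stack lw)
  s_pos : ∀ i, 0 < p.1 i
  q_pos : ∀ i, 0 < p.2.1 i
  γ : ℝ
  t : ℝ

namespace NewtonInstance

variable {N n m : ℕ} {pw pv lw lv : Fin N → ℕ}
  {Sw : (k : Fin N) → Fin (lw k) → Finset (Fin (pw k))}
  {Sv : (k : Fin N) → Fin (lv k) → Finset (Fin (pv k))}

/-- The numbers given to the program that computes a Newton step: the entries of `x₀`, `z_k`,
`G_k`, `H_k`, of the whitening matrices `Q_k^{-1/2}`, `R_k^{-1/2}`, of the noise specifications,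
and of the current point, and the numbers `γ` and `t`. -/
def inputs : Set (NewtonInstance N n m pw pv lw lv Sw Sv → ℝ) :=
  coords (fun d => d.K.x₀) ∪ (⋃ k, coords fun d => d.K.z k) ∪
    (⋃ k, entries fun d => d.K.G k) ∪ (⋃ k, entries fun d => d.K.H k) ∪
    (⋃ k, entries fun d => invSqrt (d.K.Q k)) ∪ (⋃ k, entries fun d => invSqrt (d.K.R k)) ∪
    (⋃ k, PLQData.entries fun d => d.K.w k) ∪ (⋃ k, PLQData.entries fun d => d.K.v k) ∪
    pointCoords (fun d => d.p) ∪ {fun d => d.γ, fun d => d.t}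

/-- The results: the Newton direction for `F_γ` at the current point, and the next point. -/
def outputs : Set (NewtonInstance N n m pw pv lw lv Sw Sv → ℝ) :=
  pointCoords (fun d => d.K.combined.newtonDir d.γ d.p) ∪
    pointCoords (fun d => d.K.combined.dampedNewton d.γ d.t d.p)

end NewtonInstance

end

set_option linter.unusedSectionVars false

noncomputable section

/-! ## Quadratic support functions satisfying the null-space condition -/

/-! The Newton systems are governed by three properties, collected in `PLQData.Regular`: M is
positive semidefinite, null(M) ∩ null(Aᵀ) = 0, and B is injective. They pass from the single noises
to the stacked problem (`HasPLQNoise.combined_regular`), where B is injective because its process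
rows contain the unit lower block triangular matrix G. If (ds, dq, du, dy) lies in the kernel of the
derivative, the linear rows give ds·dq = du·M du ≥ 0, while linearized complementarity gives ds·dq =
-Σ (qᵢ/sᵢ) dsᵢ² ≤ 0. So both vanish, and regularity kills the components one by one
(`Regular.kktLin_injective`). Positivity of T and Ω comes from the same null-space condition. T is
block diagonal in time and B couples only neighbouring times, so Ω is block tridiagonal.

The iteration is analysed in the wide neighbourhood qᵢsᵢ ≥ θμ of the central path, μ being the mean
of the products. There the second-order terms of a Newton step are O(μ) with a constant that depends
only on θ and ℓ. Hence one fixed small step length keeps all iterates in the neighbourhood and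
shrinks the gap by the factor 1 - t(1-σ)/2 (`Regular.ipIteration_mem_centralNhd`). The identity
ds·dq = du·M du, applied to differences of feasible points, bounds the feasible points with bounded
gap (`Regular.isBounded_strictlyFeasible_gap_le`), so cluster points exist. By weak duality the
objective at a feasible point exceeds the infimum by at most the gap (`rho_le_rho_add_gap`). This
gives convergence of the values and optimality of KKT points; since the posterior is a constant
times exp(-objective), KKT points also maximize it.

For the operation count, s, q and u are eliminated separately in each noise block, which leaves the
tridiagonal system for the states. Forward elimination is an information filter whose update
preserves positive definiteness (`Matrix.PosDef.schur_update`), so all pivots are invertible.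
Positive definite matrices are inverted by bordering with positive scalar pivots, so no divisor ever
vanishes. Each time point costs a bounded number of dense operations of size δ(n+m) and of sparse
operations with A; forming A D Aᵀ from the column patterns produces the term κ²l. -/

theorem Matrix.dotProduct_mulVec_eq_transpose_mulVec_dotProduct {ι c : Type*} [Fintype ι]
    [Fintype c] (A : Matrix ι c ℝ) (u : ι → ℝ) (q : c → ℝ) :
    u ⬝ᵥ (A *ᵥ q) = (Aᵀ *ᵥ u) ⬝ᵥ q := by
  rw [dotProduct_mulVec, mulVec_transpose]

theorem Matrix.PosSemidef.real_dotProduct_mulVec_nonneg {ι : Type*} [Fintype ι]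
    {M : Matrix ι ι ℝ} (hM : M.PosSemidef) (u : ι → ℝ) : 0 ≤ u ⬝ᵥ (M *ᵥ u) := by
  simpa using hM.dotProduct_mulVec_nonneg u

theorem Matrix.PosSemidef.transpose_eq {ι : Type*} {M : Matrix ι ι ℝ} (hM : M.PosSemidef) :
    Mᵀ = M := by
  simpa [IsHermitian, conjTranspose_eq_transpose_of_trivial] using hM.isHermitian

theorem Matrix.PosSemidef.mulVec_eq_zero {ι : Type*} [Fintype ι]
    {M : Matrix ι ι ℝ} (hM : M.PosSemidef) {u : ι → ℝ} (h : u ⬝ᵥ (M *ᵥ u) = 0) :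
    M *ᵥ u = 0 := by
  classical
  exact (hM.dotProduct_mulVec_zero_iff u).1 (by simpa using h)

namespace PLQData

variable {ι κ c : Type*} [Fintype ι] [Fintype κ] [Fintype c]

/-- The hypotheses under which the relaxed KKT systems are nonsingular. -/
structure Regular (P : PLQData ι κ c) : Prop where
  posSemidef : P.M.PosSemidef
  null : P.NullSpaceCondition
  injective : Function.Injective fun y => P.B *ᵥ y

namespace Regular

variable {P : PLQData ι κ c}

theorem eq_zero (hP : P.Regular) {u : ι → ℝ} (h₁ : P.M *ᵥ u = 0) (h₂ : P.Aᵀ *ᵥ u = 0) :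
    u = 0 := by
  have : u ∈ {u : ι → ℝ | P.M *ᵥ u = 0} ∩ {u | P.Aᵀ *ᵥ u = 0} := ⟨h₁, h₂⟩
  rw [hP.null] at this
  exact this

theorem eq_zero_of_mulVec_B (hP : P.Regular) {y : κ → ℝ} (h : P.B *ᵥ y = 0) : y = 0 :=
  hP.injective (by simpa using h)

end Regular

/-- The first row turns ds into -Aᵀdu, the third row rewrites A dq, and du is orthogonal to the
range of B. It applies to kernel vectors of the derivative, to Newton directions at feasible points,
and to differences of feasible points. -/
theorem dotProduct_eq_of_linear {P : PLQData ι κ c} {ds dq : c → ℝ} {du : ι → ℝ} {dy : κ → ℝ}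
    (h₁ : ds + P.Aᵀ *ᵥ du = 0) (h₃ : P.B *ᵥ dy - P.M *ᵥ du - P.A *ᵥ dq = 0)
    (h₄ : P.Bᵀ *ᵥ du = 0) : ds ⬝ᵥ dq = du ⬝ᵥ (P.M *ᵥ du) := by
  have e₁ : ds = -(P.Aᵀ *ᵥ du) := eq_neg_of_add_eq_zero_left h₁
  have e₃ : P.A *ᵥ dq = P.B *ᵥ dy - P.M *ᵥ du := (sub_eq_zero.1 h₃).symm
  have e₄ : du ⬝ᵥ (P.B *ᵥ dy) = 0 := by
    rw [dotProduct_mulVec_eq_transpose_mulVec_dotProduct, h₄, zero_dotProduct]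
  rw [e₁, neg_dotProduct, ← dotProduct_mulVec_eq_transpose_mulVec_dotProduct, e₃, dotProduct_sub,
    e₄]
  ring

/-! ### The derivative of the relaxed KKT function -/

/-- The derivative of the relaxed KKT function, as an explicit linear map. -/
def kktLin (P : PLQData ι κ c) (p : IPPoint ι κ c) : IPPoint ι κ c →ₗ[ℝ] IPPoint ι κ c where
  toFun d := (d.1 + P.Aᵀ *ᵥ d.2.2.1, (fun i => p.2.1 i * d.1 i + p.1 i * d.2.1 i),
    P.B *ᵥ d.2.2.2 - P.M *ᵥ d.2.2.1 - P.A *ᵥ d.2.1, P.Bᵀ *ᵥ d.2.2.1)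
  map_add' d e := by
    ext i <;> simp [mulVec_add] <;> ring
  map_smul' r d := by
    ext i <;> simp [mulVec_smul] <;> ring

theorem hasFDerivAt_relaxedKKT (P : PLQData ι κ c) (γ : ℝ) (p : IPPoint ι κ c) :
    HasFDerivAt (P.relaxedKKT γ) (LinearMap.toContinuousLinearMap (P.kktLin p)) p := by
  let S : IPPoint ι κ c →L[ℝ] (c → ℝ) := ContinuousLinearMap.fst ℝ _ _
  let Q : IPPoint ι κ c →L[ℝ] (c → ℝ) :=
    (ContinuousLinearMap.fst ℝ _ _).comp (ContinuousLinearMap.snd ℝ _ _)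
  -- The relaxed KKT function is this linear map, plus the bilinear products qᵢsᵢ in the second
  -- component, plus a constant.
  let E : IPPoint ι κ c →ₗ[ℝ] IPPoint ι κ c :=
    { toFun := fun d => (d.1 + P.Aᵀ *ᵥ d.2.2.1, 0,
        P.B *ᵥ d.2.2.2 - P.M *ᵥ d.2.2.1 - P.A *ᵥ d.2.1, P.Bᵀ *ᵥ d.2.2.1)
      map_add' := fun d e => by ext i <;> simp [mulVec_add] <;> ring
      map_smul' := fun r d => by ext i <;> simp [mulVec_smul]; ring }
  have hE : HasFDerivAt E (LinearMap.toContinuousLinearMap E) p :=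
    (LinearMap.toContinuousLinearMap E).hasFDerivAt
  have hq : HasFDerivAt (fun d : IPPoint ι κ c => fun i => d.2.1 i * d.1 i)
      (ContinuousLinearMap.pi fun i => p.2.1 i • (ContinuousLinearMap.proj i).comp S +
        p.1 i • (ContinuousLinearMap.proj i).comp Q) p := by
    rw [hasFDerivAt_pi]
    intro i
    exact ((ContinuousLinearMap.proj (R := ℝ) (φ := fun _ : c => ℝ) i).comp Q).hasFDerivAt.mul
      ((ContinuousLinearMap.proj (R := ℝ) (φ := fun _ : c => ℝ) i).comp S).hasFDerivAt
  have h0 : HasFDerivAt (fun _ : IPPoint ι κ c => (0 : c → ℝ))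
      (0 : IPPoint ι κ c →L[ℝ] (c → ℝ)) p := hasFDerivAt_const _ _
  have h00 : HasFDerivAt (fun _ : IPPoint ι κ c => (0 : (ι → ℝ) × (κ → ℝ)))
      (0 : IPPoint ι κ c →L[ℝ] ((ι → ℝ) × (κ → ℝ))) p := hasFDerivAt_const _ _
  have h := (hE.add (h0.prodMk (hq.prodMk h00))).add_const
    ((-P.a, (fun _ => -γ), P.b, 0) : IPPoint ι κ c)
  have e₁ : P.relaxedKKT γ = fun d => E d + ((0 : c → ℝ), (fun i => d.2.1 i * d.1 i),
      (0 : (ι → ℝ) × (κ → ℝ))) + ((-P.a, (fun _ => -γ), P.b, 0) : IPPoint ι κ c) := by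
    funext d
    ext i <;> simp [relaxedKKT, E] <;> ring
  rw [e₁]
  refine h.congr_fderiv ?_
  refine ContinuousLinearMap.ext fun d => ?_
  ext i <;> simp [kktLin, E, S, Q]

theorem kktDeriv_apply (P : PLQData ι κ c) (γ : ℝ) (p d : IPPoint ι κ c) :
    P.kktDeriv γ p d = P.kktLin p d := by
  rw [kktDeriv, (P.hasFDerivAt_relaxedKKT γ p).fderiv]
  rfl

/-- On the kernel, ds·dq is nonnegative by `dotProduct_eq_of_linear` and nonpositive by the
complementarity row. Hence ds = 0, then dq = 0 and M du = 0; with Aᵀdu = -ds = 0 the null-space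
condition gives du = 0, and injectivity of B gives dy = 0. -/
theorem Regular.kktLin_injective {P : PLQData ι κ c} (hP : P.Regular) {p : IPPoint ι κ c}
    (hs : ∀ i, 0 < p.1 i) (hq : ∀ i, 0 < p.2.1 i) : Function.Injective (P.kktLin p) := by
  rw [← LinearMap.ker_eq_bot, LinearMap.ker_eq_bot']
  rintro ⟨ds, dq, du, dy⟩ h
  simp only [kktLin, LinearMap.coe_mk, AddHom.coe_mk, Prod.mk_eq_zero] at h
  obtain ⟨h₁, h₂, h₃, h₄⟩ := h
  have key := dotProduct_eq_of_linear h₁ h₃ h₄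
  have hnn := hP.posSemidef.real_dotProduct_mulVec_nonneg du
  have hterm : ∀ i, ds i * dq i = -(p.2.1 i / p.1 i * ds i ^ 2) := by
    intro i
    have := congrFun h₂ i
    have hi := (hs i).ne'
    simp only [Pi.zero_apply] at this
    field_simp
    linear_combination ds i * this
  have hle : ds ⬝ᵥ dq = -∑ i, p.2.1 i / p.1 i * ds i ^ 2 := by
    rw [dotProduct, ← Finset.sum_neg_distrib]
    exact Finset.sum_congr rfl fun i _ => hterm i
  have hpos : ∀ i, 0 ≤ p.2.1 i / p.1 i * ds i ^ 2 := fun i =>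
    mul_nonneg (div_pos (hq i) (hs i)).le (sq_nonneg _)
  have hsum : ∑ i, p.2.1 i / p.1 i * ds i ^ 2 = 0 :=
    le_antisymm (by linarith) (Finset.sum_nonneg fun i _ => hpos i)
  have hds : ds = 0 := by
    funext i
    have := (Finset.sum_eq_zero_iff_of_nonneg fun i _ => hpos i).1 hsum i (Finset.mem_univ i)
    have h' := (div_pos (hq i) (hs i)).ne'
    simpa [h'] using (mul_eq_zero.1 this).resolve_left h'
  have hdq : dq = 0 := by
    funext i
    have := congrFun h₂ i
    simpa [hds, (hs i).ne'] using this
  have hM : P.M *ᵥ du = 0 := hP.posSemidef.mulVec_eq_zero (by rw [← key, hds, zero_dotProduct])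
  have hdu : du = 0 := hP.eq_zero hM (by simpa [hds] using h₁)
  have hdy : dy = 0 := hP.eq_zero_of_mulVec_B (by simpa [hdq, hdu] using h₃)
  simp [hds, hdq, hdu, hdy]

theorem Regular.kktDeriv_isInvertible {P : PLQData ι κ c} (hP : P.Regular) {p : IPPoint ι κ c}
    (hs : ∀ i, 0 < p.1 i) (hq : ∀ i, 0 < p.2.1 i) (γ : ℝ) : (P.kktDeriv γ p).IsInvertible := by
  let e := (LinearEquiv.ofInjectiveEndo _ (hP.kktLin_injective hs hq)).toContinuousLinearEquiv
  refine ⟨e, ContinuousLinearMap.ext fun d => ?_⟩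
  rw [kktDeriv_apply]
  rfl

/-- `newtonDir` uses the totalized inverse of a continuous linear map; invertibility turns it into a
genuine solution of the Newton system. -/
theorem Regular.kktLin_newtonDir {P : PLQData ι κ c} (hP : P.Regular) {p : IPPoint ι κ c}
    (hs : ∀ i, 0 < p.1 i) (hq : ∀ i, 0 < p.2.1 i) (γ : ℝ) :
    P.kktLin p (P.newtonDir γ p) = -(P.relaxedKKT γ p) := by
  rw [← P.kktDeriv_apply γ]
  obtain ⟨e, he⟩ := hP.kktDeriv_isInvertible hs hq γ
  rw [newtonDir, ← he]
  simp

/-- The linear equations for the Newton direction. -/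
theorem Regular.newtonDir_spec {P : PLQData ι κ c} (hP : P.Regular) {p : IPPoint ι κ c}
    (hs : ∀ i, 0 < p.1 i) (hq : ∀ i, 0 < p.2.1 i) (γ : ℝ) :
    (P.newtonDir γ p).1 + P.Aᵀ *ᵥ (P.newtonDir γ p).2.2.1 = -(p.1 + P.Aᵀ *ᵥ p.2.2.1 - P.a) ∧
    (∀ i, p.2.1 i * (P.newtonDir γ p).1 i + p.1 i * (P.newtonDir γ p).2.1 i =
      γ - p.2.1 i * p.1 i) ∧
    P.B *ᵥ (P.newtonDir γ p).2.2.2 - P.M *ᵥ (P.newtonDir γ p).2.2.1 -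
      P.A *ᵥ (P.newtonDir γ p).2.1 =
      -(P.B *ᵥ p.2.2.2 - P.M *ᵥ p.2.2.1 - P.A *ᵥ p.2.1 + P.b) ∧
    P.Bᵀ *ᵥ (P.newtonDir γ p).2.2.1 = -(P.Bᵀ *ᵥ p.2.2.1) := by
  have h := hP.kktLin_newtonDir hs hq γ
  simp only [kktLin, relaxedKKT, LinearMap.coe_mk, AddHom.coe_mk, Prod.neg_mk, Prod.mk.injEq] at h
  refine ⟨h.1, fun i => ?_, h.2.2.1, h.2.2.2⟩
  have := congrFun h.2.1 i
  simpa using this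

/-! ### The reduced Newton system -/

section Reduced

variable [DecidableEq ι] [DecidableEq c]

/-- The form u·Tu is u·Mu plus a positively weighted sum of squares of the entries of Aᵀu, so it
vanishes only on null(M) ∩ null(Aᵀ). -/
theorem Regular.redT_posDef {P : PLQData ι κ c} (hP : P.Regular) {p : IPPoint ι κ c}
    (hs : ∀ i, 0 < p.1 i) (hq : ∀ i, 0 < p.2.1 i) : (P.redT p).PosDef := by
  have hd : ∀ i, 0 < (p.1 i)⁻¹ * p.2.1 i := fun i => mul_pos (inv_pos.2 (hs i)) (hq i)
  have hD : (P.A * diagonal (fun i => (p.1 i)⁻¹ * p.2.1 i) * P.Aᵀ).PosSemidef := by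
    have := (PosSemidef.diagonal (n := c) (R := ℝ) (d := fun i => (p.1 i)⁻¹ * p.2.1 i)
      fun i => (hd i).le).mul_mul_conjTranspose_same P.A
    simpa [conjTranspose_eq_transpose_of_trivial] using this
  have hT : (P.redT p).PosSemidef := hP.posSemidef.add hD
  refine PosDef.of_dotProduct_mulVec_pos hT.isHermitian fun u hu => ?_
  refine lt_of_le_of_ne (hT.dotProduct_mulVec_nonneg u) fun h0 => hu ?_
  have e : star u ⬝ᵥ (P.redT p *ᵥ u) = u ⬝ᵥ (P.M *ᵥ u) +
      ∑ i, (p.1 i)⁻¹ * p.2.1 i * (P.Aᵀ *ᵥ u) i ^ 2 := by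
    rw [redT, add_mulVec, dotProduct_add, star_trivial, ← mulVec_mulVec, ← mulVec_mulVec,
      dotProduct_mulVec_eq_transpose_mulVec_dotProduct P.A]
    congr 1
    rw [dotProduct]
    refine Finset.sum_congr rfl fun i _ => ?_
    rw [mulVec_diagonal]
    ring
  have h1 := hP.posSemidef.real_dotProduct_mulVec_nonneg u
  have hpos : ∀ i, 0 ≤ (p.1 i)⁻¹ * p.2.1 i * (P.Aᵀ *ᵥ u) i ^ 2 := fun i =>
    mul_nonneg (hd i).le (sq_nonneg _)
  have h2 : 0 ≤ ∑ i, (p.1 i)⁻¹ * p.2.1 i * (P.Aᵀ *ᵥ u) i ^ 2 :=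
    Finset.sum_nonneg fun i _ => hpos i
  rw [e] at h0
  refine hP.eq_zero (hP.posSemidef.mulVec_eq_zero (by linarith)) ?_
  funext i
  have := (Finset.sum_eq_zero_iff_of_nonneg fun i _ => hpos i).1 (by linarith) i
    (Finset.mem_univ i)
  simpa using (mul_eq_zero.1 this).resolve_left (hd i).ne'

theorem Regular.redOmega_posDef {P : PLQData ι κ c} (hP : P.Regular) {p : IPPoint ι κ c}
    (hs : ∀ i, 0 < p.1 i) (hq : ∀ i, 0 < p.2.1 i) : (P.redOmega p).PosDef := by
  have := (hP.redT_posDef hs hq).inv.conjTranspose_mul_mul_same hP.injective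
  simpa [conjTranspose_eq_transpose_of_trivial, redOmega] using this

/-- Elimination of `s` and `q` from a linear system with the matrix of the Newton system. -/
theorem redT_mulVec_of_kkt {P : PLQData ι κ c} {p : IPPoint ι κ c} (hs : ∀ i, p.1 i ≠ 0)
    {ds dq r₁ r₂ : c → ℝ} {du r₃ β : ι → ℝ}
    (h₁ : ds + P.Aᵀ *ᵥ du = r₁) (h₂ : ∀ i, p.2.1 i * ds i + p.1 i * dq i = r₂ i)
    (h₃ : β - P.M *ᵥ du - P.A *ᵥ dq = r₃) :
    P.redT p *ᵥ du =
      β - (r₃ + P.A *ᵥ fun i => (p.1 i)⁻¹ * (r₂ i - p.2.1 i * r₁ i)) := by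
  -- The complementarity row is solved for dq, with ds = r₁ - Aᵀdu inserted.
  have e₂ : dq = (fun i => (p.1 i)⁻¹ * (r₂ i - p.2.1 i * r₁ i)) +
      diagonal (fun i => (p.1 i)⁻¹ * p.2.1 i) *ᵥ (P.Aᵀ *ᵥ du) := by
    funext i
    have hi := hs i
    have := h₂ i
    have h1 := congrFun h₁ i
    simp only [Pi.add_apply] at h1
    rw [Pi.add_apply, mulVec_diagonal, ← h1, ← this]
    field_simp
    ring
  rw [← h₃, e₂, redT, add_mulVec, mulVec_add, ← mulVec_mulVec, ← mulVec_mulVec]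
  abel

theorem Regular.redOmega_mulVec_newtonDir {P : PLQData ι κ c} (hP : P.Regular)
    {p : IPPoint ι κ c} (hs : ∀ i, 0 < p.1 i) (hq : ∀ i, 0 < p.2.1 i) (γ : ℝ) :
    P.redOmega p *ᵥ (P.newtonDir γ p).2.2.2 = P.redRhs γ p := by
  obtain ⟨h₁, h₂, h₃, h₄⟩ := hP.newtonDir_spec hs hq γ
  have hT : IsUnit (P.redT p).det :=
    (isUnit_iff_isUnit_det _).1 (hP.redT_posDef hs hq).isUnit
  have h := redT_mulVec_of_kkt (fun i => (hs i).ne') h₁ h₂ h₃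
  -- Applying BᵀT⁻¹ leaves Bᵀdu on the left, which the fourth Newton equation prescribes as r₄.
  have hu := congrArg (fun v => P.Bᵀ *ᵥ ((P.redT p)⁻¹ *ᵥ v)) h
  simp only [mulVec_mulVec _ (P.redT p)⁻¹ (P.redT p), nonsing_inv_mul _ hT, one_mulVec, h₄] at hu
  rw [mulVec_sub, mulVec_sub] at hu
  simp only [redOmega, redRhs, relaxedKKT, ← mulVec_mulVec]
  rw [hu]
  simp only [Pi.neg_apply, neg_sub]
  abel

end Reduced

end PLQData

namespace PLQData

variable {ι κ c : Type*} [Fintype ι] [Fintype κ] [Fintype c]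

/-! ### Duality -/

theorem le_rho (P : PLQData ι κ c) {u : ι → ℝ} (hu : u ∈ P.U) (y : κ → ℝ) :
    ((u ⬝ᵥ (P.b + P.B *ᵥ y) - 1 / 2 * (u ⬝ᵥ (P.M *ᵥ u)) : ℝ) : EReal) ≤ P.rho y :=
  le_iSup₂ (f := fun (u : ι → ℝ) (_ : u ∈ P.U) =>
    ((u ⬝ᵥ (P.b + P.B *ᵥ y) - 1 / 2 * (u ⬝ᵥ (P.M *ᵥ u)) : ℝ) : EReal)) u hu

theorem rho_nonneg {P : PLQData ι κ c} (h : (0 : ι → ℝ) ∈ P.U) (y : κ → ℝ) : 0 ≤ P.rho y := by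
  simpa using P.le_rho h y

/-- For v in U, the stationarity equation gives ⟨v, b + By⟩ = ⟨v, Mu⟩ + ⟨Aᵀv, q⟩, where the last
term is at most ⟨a, q⟩ because q ≥ 0. Nonnegativity of the quadratic form at v - u bounds ⟨v, Mu⟩ -
½⟨v, Mv⟩ by ½⟨u, Mu⟩. -/
theorem rho_le {P : PLQData ι κ c} (hM : P.M.PosSemidef) {q : c → ℝ} {u : ι → ℝ} {y : κ → ℝ}
    (hq : ∀ i, 0 ≤ q i) (h : 0 = P.b + P.B *ᵥ y - P.M *ᵥ u - P.A *ᵥ q) :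
    P.rho y ≤ ((P.a ⬝ᵥ q + 1 / 2 * (u ⬝ᵥ (P.M *ᵥ u)) : ℝ) : EReal) := by
  refine iSup₂_le fun v hv => EReal.coe_le_coe_iff.2 ?_
  have e : P.b + P.B *ᵥ y = P.M *ᵥ u + P.A *ᵥ q := by
    rw [← sub_eq_zero, h]
    abel
  have h1 : v ⬝ᵥ (P.A *ᵥ q) ≤ P.a ⬝ᵥ q := by
    rw [dotProduct_mulVec_eq_transpose_mulVec_dotProduct]
    exact Finset.sum_le_sum fun i _ => mul_le_mul_of_nonneg_right (hv i) (hq i)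
  have h2 := hM.real_dotProduct_mulVec_nonneg (v - u)
  have h3 : u ⬝ᵥ (P.M *ᵥ v) = v ⬝ᵥ (P.M *ᵥ u) := by
    rw [dotProduct_mulVec_eq_transpose_mulVec_dotProduct, hM.transpose_eq, dotProduct_comm]
  rw [mulVec_sub, sub_dotProduct, dotProduct_sub, dotProduct_sub, h3] at h2
  rw [e, dotProduct_add]
  linarith

/-- Weak duality, with the complementarity gap as the error. -/
theorem rho_le_rho_add_gap {P : PLQData ι κ c} (hM : P.M.PosSemidef) {p : IPPoint ι κ c}
    (hs : ∀ i, 0 ≤ p.1 i) (hq : ∀ i, 0 ≤ p.2.1 i) (h₄ : 0 = P.Bᵀ *ᵥ p.2.2.1)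
    (h₃ : 0 = P.b + P.B *ᵥ p.2.2.2 - P.M *ᵥ p.2.2.1 - P.A *ᵥ p.2.1)
    (h₁ : 0 = P.Aᵀ *ᵥ p.2.2.1 + p.1 - P.a) (y : κ → ℝ) :
    P.rho p.2.2.2 ≤ P.rho y + (gap p : EReal) := by
  have e₁ : P.a = P.Aᵀ *ᵥ p.2.2.1 + p.1 := (sub_eq_zero.1 h₁.symm).symm
  have hu : p.2.2.1 ∈ P.U := by
    intro i
    rw [e₁]
    simpa using hs i
  have hB : ∀ y, p.2.2.1 ⬝ᵥ (P.B *ᵥ y) = 0 := fun y => by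
    rw [dotProduct_mulVec_eq_transpose_mulVec_dotProduct, ← h₄, zero_dotProduct]
  have e₃ : p.2.2.1 ⬝ᵥ P.b =
      p.2.2.1 ⬝ᵥ (P.M *ᵥ p.2.2.1) + (P.Aᵀ *ᵥ p.2.2.1) ⬝ᵥ p.2.1 := by
    have := congrArg (fun v => p.2.2.1 ⬝ᵥ v) h₃
    simp only [dotProduct_sub, dotProduct_add, hB, dotProduct_zero,
      dotProduct_mulVec_eq_transpose_mulVec_dotProduct P.A] at this
    linarith
  -- Since Bᵀu = 0, the lower bound of `le_rho` at this u is the same for all y. The upper bound of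
  -- `rho_le` exceeds it by (a - Aᵀu)·q = s·q.
  refine (rho_le hM hq h₃).trans (le_trans (le_of_eq ?_) (add_le_add_left (P.le_rho hu y) _))
  rw [← EReal.coe_add, EReal.coe_eq_coe_iff, dotProduct_add, hB, e₃, e₁, add_dotProduct, gap]
  ring

/-! ### Bounded level sets of the complementarity gap -/

/-- For feasible p, (s - s₀)·(q - q₀) = (u - u₀)·M(u - u₀) ≥ 0. Expanding the left side shows that
s·q₀, s₀·q and the quadratic form are all at most R = r + s₀·q₀. As s₀ and q₀ are positive, this
bounds s, q and Mu; regularity then bounds u and y. -/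
theorem Regular.isBounded_strictlyFeasible_gap_le {P : PLQData ι κ c} (hP : P.Regular)
    {p₀ : IPPoint ι κ c} (hp₀ : p₀ ∈ P.strictlyFeasible) (r : ℝ) :
    Bornology.IsBounded {p | p ∈ P.strictlyFeasible ∧ gap p ≤ r} := by
  classical
  obtain ⟨s₀, q₀, u₀, y₀⟩ := p₀
  obtain ⟨hs₀, hq₀, h₄₀, h₃₀, h₁₀⟩ := hp₀
  set R := r + s₀ ⬝ᵥ q₀ with hR
  -- Regularity says exactly that this map has trivial kernel. In finite dimension it is then
  -- antilipschitz, so preimages of bounded sets are bounded.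
  let Ψ : IPPoint ι κ c →ₗ[ℝ] (c → ℝ) × (c → ℝ) × (ι → ℝ) × (c → ℝ) × (ι → ℝ) :=
    { toFun := fun p => (p.1, p.2.1, P.M *ᵥ p.2.2.1, P.Aᵀ *ᵥ p.2.2.1, P.B *ᵥ p.2.2.2)
      map_add' := fun d e => by ext i <;> simp [mulVec_add]
      map_smul' := fun r d => by ext i <;> simp [mulVec_smul] }
  have hΨ : LinearMap.ker Ψ = ⊥ := by
    rw [LinearMap.ker_eq_bot']
    rintro ⟨s, q, u, y⟩ h
    simp only [Ψ, LinearMap.coe_mk, AddHom.coe_mk, Prod.mk_eq_zero] at h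
    obtain ⟨rfl, rfl, hM, hA, hB⟩ := h
    rw [hP.eq_zero hM hA, hP.eq_zero_of_mulVec_B hB]
    rfl
  obtain ⟨k, -, hk⟩ := Ψ.exists_antilipschitzWith hΨ
  -- On feasible points Ψ depends continuously on (s, q, Mu) alone, because Aᵀu = a - s and By = Mu
  -- + Aq - b.
  let Θ : (c → ℝ) × (c → ℝ) × (ι → ℝ) → (c → ℝ) × (c → ℝ) × (ι → ℝ) × (c → ℝ) × (ι → ℝ) :=
    fun v => (v.1, v.2.1, v.2.2, P.a - v.1, v.2.2 + P.A *ᵥ v.2.1 - P.b)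
  have hΘ : Continuous Θ := by
    have h1 : Continuous fun v : (c → ℝ) × (c → ℝ) × (ι → ℝ) => P.A *ᵥ v.2.1 :=
      Continuous.matrix_mulVec continuous_const continuous_snd.fst
    fun_prop
  let m : ι → ℝ := fun i => (P.M i i + R) / 2
  have hcpt : IsCompact (Set.Icc (0 : c → ℝ) (fun i => R / q₀ i) ×ˢ
      (Set.Icc (0 : c → ℝ) (fun i => R / s₀ i) ×ˢ
        Set.Icc (P.M *ᵥ u₀ - m) (P.M *ᵥ u₀ + m))) :=
    isCompact_Icc.prod (isCompact_Icc.prod isCompact_Icc)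
  refine (hk.isBounded_preimage (hcpt.image hΘ).isBounded).subset ?_
  rintro ⟨s, q, u, y⟩ ⟨⟨hs, hq, h₄, h₃, h₁⟩, hgap⟩
  simp only [gap] at hgap
  have key := dotProduct_eq_of_linear (P := P) (ds := s - s₀) (dq := q - q₀) (du := u - u₀)
    (dy := y - y₀)
    (by rw [mulVec_sub]; linear_combination (exp := 1) h₁₀ - h₁)
    (by rw [mulVec_sub, mulVec_sub, mulVec_sub]; linear_combination (exp := 1) h₃₀ - h₃)
    (by rw [mulVec_sub, ← h₄, ← h₄₀, sub_zero])
  have hnn := hP.posSemidef.real_dotProduct_mulVec_nonneg (u - u₀)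
  have hex : (s - s₀) ⬝ᵥ (q - q₀) = s ⬝ᵥ q + s₀ ⬝ᵥ q₀ - s ⬝ᵥ q₀ - s₀ ⬝ᵥ q := by
    simp only [sub_dotProduct, dotProduct_sub]
    ring
  have hsq : 0 ≤ s ⬝ᵥ q₀ := Finset.sum_nonneg fun i _ => (mul_pos (hs i) (hq₀ i)).le
  have hsq' : 0 ≤ s₀ ⬝ᵥ q := Finset.sum_nonneg fun i _ => (mul_pos (hs₀ i) (hq i)).le
  have hsi : ∀ i, s i * q₀ i ≤ R := fun i => by
    have := Finset.single_le_sum (f := fun i => s i * q₀ i)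
      (fun i _ => (mul_pos (hs i) (hq₀ i)).le) (Finset.mem_univ i)
    change _ ≤ s ⬝ᵥ q₀ at this
    linarith
  have hqi : ∀ i, s₀ i * q i ≤ R := fun i => by
    have := Finset.single_le_sum (f := fun i => s₀ i * q i)
      (fun i _ => (mul_pos (hs₀ i) (hq i)).le) (Finset.mem_univ i)
    change _ ≤ s₀ ⬝ᵥ q at this
    linarith
  have hMb : ∀ i, |(P.M *ᵥ (u - u₀)) i| ≤ m i := by
    intro i
    -- The form is evaluated at σeᵢ + (u - u₀). The choices σ = ±1 bound the i-th entry of M(u - u₀)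
    -- by half the sum of Mᵢᵢ and the form at u - u₀.
    have hcs : ∀ σ : ℝ, 0 ≤ σ ^ 2 * P.M i i + 2 * σ * (P.M *ᵥ (u - u₀)) i +
        (u - u₀) ⬝ᵥ (P.M *ᵥ (u - u₀)) := by
      intro σ
      have h := hP.posSemidef.real_dotProduct_mulVec_nonneg (σ • Pi.single i 1 + (u - u₀))
      have e1 : (Pi.single i (1 : ℝ) : ι → ℝ) ⬝ᵥ (P.M *ᵥ (u - u₀)) = (P.M *ᵥ (u - u₀)) i := by
        simp
      have e2 : (u - u₀) ⬝ᵥ (P.M *ᵥ Pi.single i (1 : ℝ)) = (P.M *ᵥ (u - u₀)) i := by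
        rw [dotProduct_mulVec_eq_transpose_mulVec_dotProduct, hP.posSemidef.transpose_eq,
          dotProduct_comm, e1]
      have e3 : (Pi.single i (1 : ℝ) : ι → ℝ) ⬝ᵥ (P.M *ᵥ Pi.single i (1 : ℝ)) = P.M i i := by
        simp
      rw [mulVec_add, mulVec_smul, add_dotProduct, dotProduct_add, dotProduct_add,
        smul_dotProduct, smul_dotProduct, dotProduct_smul, dotProduct_smul, e1, e2, e3] at h
      simp only [smul_eq_mul] at h
      linarith
    have h1 := hcs 1
    have h2 := hcs (-1)
    rw [abs_le]
    constructor <;> simp only [m] <;> linarith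
  refine ⟨(s, q, P.M *ᵥ u), ⟨⟨fun i => (hs i).le, fun i => ?_⟩,
    ⟨fun i => (hq i).le, fun i => ?_⟩, fun i => ?_, fun i => ?_⟩, ?_⟩
  · exact (le_div_iff₀ (hq₀ i)).2 (hsi i)
  · exact (le_div_iff₀ (hs₀ i)).2 (by rw [mul_comm]; exact hqi i)
  · have := (abs_le.1 (hMb i)).1
    rw [mulVec_sub] at this
    simp only [Pi.sub_apply] at this ⊢
    linarith
  · have := (abs_le.1 (hMb i)).2
    rw [mulVec_sub] at this
    simp only [Pi.sub_apply, Pi.add_apply] at this ⊢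
    linarith
  · simp only [Θ, Ψ, LinearMap.coe_mk, AddHom.coe_mk, Prod.mk.injEq, true_and]
    constructor
    · linear_combination (exp := 1) h₁
    · linear_combination (exp := 1) h₃

end PLQData

/-! ### Convergence of the interior point iteration -/

section Newton

variable {c : Type*} [Fintype c]

/-- Bounds for the second-order terms of a Newton step in a wide neighbourhood of the central
path. -/
theorem abs_mul_le_of_complementarity_step {s q ds dq : c → ℝ} {μ σ θ : ℝ}
    (hs : ∀ i, 0 < s i) (hq : ∀ i, 0 < q i)
    (h₂ : ∀ i, q i * ds i + s i * dq i = σ * μ - q i * s i) (hd : 0 ≤ ds ⬝ᵥ dq)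
    (hσ : σ ∈ Set.Ioo (0 : ℝ) 1) (hθ : 0 < θ) (hμ : 0 ≤ μ) (hn : ∀ i, θ * μ ≤ q i * s i)
    (hgap : s ⬝ᵥ q = Fintype.card c * μ) :
    (∀ i, |ds i * dq i| ≤ Fintype.card c * (1 / θ + 1) * μ) ∧
      ds ⬝ᵥ dq ≤ Fintype.card c * (1 / θ + 1) * μ := by
  -- With the scaled directions √(s/q)·dq and √(q/s)·ds, eᵢ is the sum of their squares and dsᵢdqᵢ
  -- is their product. The square of their sum is known from the complementarity equation.
  set e : c → ℝ := fun i => s i * dq i ^ 2 / q i + q i * ds i ^ 2 / s i with he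
  have hpos : ∀ i, 0 < q i * s i := fun i => mul_pos (hq i) (hs i)
  have hid : ∀ i, e i + 2 * (ds i * dq i) = (σ * μ - q i * s i) ^ 2 / (q i * s i) := by
    intro i
    have h1 := (hs i).ne'
    have h2 := (hq i).ne'
    rw [← h₂ i, he]
    field_simp
    ring
  -- The cross term of (σμ - qs)² is nonpositive and is dropped; μ²/(qs) ≤ μ/θ is the neighbourhood
  -- condition.
  have hbd : ∀ i, e i + 2 * (ds i * dq i) ≤ μ / θ + q i * s i := by
    intro i
    rw [hid i, div_le_iff₀ (hpos i)]
    have h1 : μ ^ 2 ≤ μ / θ * (q i * s i) := by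
      have : μ ^ 2 = μ / θ * (θ * μ) := by field_simp
      rw [this]
      exact mul_le_mul_of_nonneg_left (hn i) (by positivity)
    have h2 : σ ^ 2 * μ ^ 2 ≤ μ ^ 2 := by
      have : σ ^ 2 ≤ 1 := by nlinarith [hσ.1, hσ.2]
      nlinarith [sq_nonneg μ]
    have h3 : 0 ≤ σ * μ * (q i * s i) := mul_nonneg (mul_nonneg hσ.1.le hμ) (hpos i).le
    nlinarith
  have hab : ∀ i, 2 * |ds i * dq i| ≤ e i := by
    intro i
    have h1 := (hs i).ne'
    have h2 := (hq i).ne'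
    have e1 : e i = ((s i * dq i) ^ 2 + (q i * ds i) ^ 2) / (q i * s i) := by
      rw [he]
      field_simp
    rw [e1, le_div_iff₀ (hpos i)]
    rw [show 2 * |ds i * dq i| * (q i * s i) = 2 * (|s i * dq i| * |q i * ds i|) by
      rw [abs_mul, abs_mul, abs_mul, abs_of_pos (hs i), abs_of_pos (hq i)]; ring]
    nlinarith [sq_nonneg (|s i * dq i| - |q i * ds i|), sq_abs (s i * dq i), sq_abs (q i * ds i)]
  have he0 : ∀ i, 0 ≤ e i := fun i => by
    have := hab i
    have := abs_nonneg (ds i * dq i)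
    linarith
  -- Only the sum over all indices is useful: there ds·dq ≥ 0 may be discarded, and the resulting
  -- bound on Σ eᵢ controls every single product.
  have hsum : ∑ i, e i + 2 * (ds ⬝ᵥ dq) ≤ Fintype.card c * (1 / θ + 1) * μ := by
    calc ∑ i, e i + 2 * (ds ⬝ᵥ dq) = ∑ i, (e i + 2 * (ds i * dq i)) := by
          rw [dotProduct, Finset.mul_sum, ← Finset.sum_add_distrib]
      _ ≤ ∑ i, (μ / θ + q i * s i) := Finset.sum_le_sum fun i _ => hbd i
      _ = Fintype.card c * (1 / θ + 1) * μ := by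
          rw [Finset.sum_add_distrib, Finset.sum_const, Finset.card_univ, nsmul_eq_mul]
          have : ∑ i, q i * s i = Fintype.card c * μ := by
            rw [← hgap, dotProduct_comm]
            rfl
          rw [this]
          ring
  have hsume : 0 ≤ ∑ i, e i := Finset.sum_nonneg fun i _ => he0 i
  refine ⟨fun i => ?_, by linarith⟩
  have h1 := Finset.single_le_sum (f := e) (fun i _ => he0 i) (Finset.mem_univ i)
  have h2 := hab i
  have h3 := abs_nonneg (ds i * dq i)
  linarith

/-- The first-order term is the sum of the complementarity equations, ℓσμ - ℓμ. -/
theorem dotProduct_step {s q ds dq : c → ℝ} {μ σ t : ℝ}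
    (h₂ : ∀ i, q i * ds i + s i * dq i = σ * μ - q i * s i)
    (hgap : s ⬝ᵥ q = Fintype.card c * μ) :
    (s + t • ds) ⬝ᵥ (q + t • dq) =
      Fintype.card c * μ * (1 - t * (1 - σ)) + t ^ 2 * (ds ⬝ᵥ dq) := by
  have h : (s + t • ds) ⬝ᵥ (q + t • dq) =
      ∑ i, (s i * q i + t * (σ * μ - s i * q i) + t ^ 2 * (ds i * dq i)) := by
    refine Finset.sum_congr rfl fun i _ => ?_
    simp only [Pi.add_apply, Pi.smul_apply, smul_eq_mul]
    linear_combination t * h₂ i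
  have hg : ∑ i, s i * q i = Fintype.card c * μ := hgap
  rw [h, Finset.sum_add_distrib, Finset.sum_add_distrib, ← Finset.mul_sum, ← Finset.mul_sum,
    Finset.sum_sub_distrib, Finset.sum_const, Finset.card_univ, nsmul_eq_mul, hg]
  change _ = _ + t ^ 2 * ∑ i, ds i * dq i
  ring

end Newton

namespace PLQData

variable {ι κ c : Type*} [Fintype ι] [Fintype κ] [Fintype c]

/-- Without constraints the quotient is 0/0 = 0, and both sides vanish. -/
theorem gap_eq_card_mul (p : IPPoint ι κ c) :
    p.1 ⬝ᵥ p.2.1 = Fintype.card c * (gap p / Fintype.card c) := by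
  rcases isEmpty_or_nonempty c with h | h
  · simp [gap, dotProduct]
  · rw [mul_div_cancel₀ _ (Nat.cast_ne_zero.2 Fintype.card_ne_zero)]
    rfl

/-- The wide neighbourhood of the central path. -/
def centralNhd (P : PLQData ι κ c) (θ : ℝ) : Set (IPPoint ι κ c) :=
  {p | p ∈ P.strictlyFeasible ∧ ∀ i, θ * (gap p / Fintype.card c) ≤ p.2.1 i * p.1 i}

theorem gap_nonneg {P : PLQData ι κ c} {p : IPPoint ι κ c} (hp : p ∈ P.strictlyFeasible) :
    0 ≤ gap p :=
  Finset.sum_nonneg fun i _ => (mul_pos (hp.1 i) (hp.2.1 i)).le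

theorem exists_mem_centralNhd {P : PLQData ι κ c} {p : IPPoint ι κ c}
    (hp : p ∈ P.strictlyFeasible) : ∃ θ ∈ Set.Ioo (0 : ℝ) 1, p ∈ P.centralNhd θ := by
  obtain ⟨ε, hε, h⟩ : ∃ ε : ℝ, 0 < ε ∧ ∀ i, ε ≤ p.2.1 i * p.1 i := by
    rcases isEmpty_or_nonempty c with hc | hc
    · exact ⟨1, one_pos, fun i => isEmptyElim i⟩
    · obtain ⟨i₀, hi₀⟩ := Finite.exists_min fun i => p.2.1 i * p.1 i
      exact ⟨_, mul_pos (hp.2.1 i₀) (hp.1 i₀), hi₀⟩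
  set μ : ℝ := gap p / (Fintype.card c : ℝ)
  have hμ : 0 ≤ μ := div_nonneg (gap_nonneg hp) (Nat.cast_nonneg _)
  -- The bound 1/2 forces θ < 1, and μ + 1 replaces μ because μ = 0 if there are no constraints.
  refine ⟨min (1 / 2) (ε / (μ + 1)), ⟨by positivity, by
    exact (min_le_left _ _).trans_lt (by norm_num)⟩, hp, fun i => ?_⟩
  calc min (1 / 2) (ε / (μ + 1)) * μ ≤ ε / (μ + 1) * μ :=
        mul_le_mul_of_nonneg_right (min_le_right _ _) hμ
    _ ≤ ε := by
        rw [div_mul_eq_mul_div, div_le_iff₀ (by positivity)]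
        nlinarith
    _ ≤ _ := h i

/-- A bound for the step length that keeps the iterates in the neighbourhood `centralNhd θ`. -/
def stepBound (ℓ : ℕ) (σ θ : ℝ) : ℝ :=
  min 1 (min (σ * (1 - θ) / ((1 / θ + 1) * (ℓ + 1))) ((1 - σ) / (2 * (1 / θ + 1))))

theorem stepBound_mem {ℓ : ℕ} {σ θ : ℝ} (hσ : σ ∈ Set.Ioo (0 : ℝ) 1)
    (hθ : θ ∈ Set.Ioo (0 : ℝ) 1) :
    stepBound ℓ σ θ ∈ Set.Ioc (0 : ℝ) 1 := by
  have h1 := hσ.1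
  have h2 := sub_pos.2 hσ.2
  have h3 := hθ.1
  have h4 := sub_pos.2 hθ.2
  refine ⟨?_, min_le_left _ _⟩
  unfold stepBound
  positivity

/-- At a feasible point the linear residuals vanish, so the step preserves the linear equations and
ds·dq = du·M du ≥ 0. A product becomes (1-t)qs + tσμ + t² ds dq: the centring term tσμ gives a
margin of order t over θ times the new mean, while the errors are of order t². -/
theorem Regular.ipIteration_mem_centralNhd {P : PLQData ι κ c} (hP : P.Regular) {σ θ t : ℝ}
    (hσ : σ ∈ Set.Ioo (0 : ℝ) 1) (hθ : θ ∈ Set.Ioo (0 : ℝ) 1)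
    (ht : t ∈ Set.Ioc 0 (stepBound (Fintype.card c) σ θ)) {p : IPPoint ι κ c}
    (hp : p ∈ P.centralNhd θ) :
    P.ipIteration σ t p ∈ P.centralNhd θ ∧
      gap (P.ipIteration σ t p) ≤ (1 - t * (1 - σ) / 2) * gap p := by
  obtain ⟨⟨hs, hq, h₄, h₃, h₁⟩, hn⟩ := hp
  change ∀ i, 0 < p.1 i at hs
  change ∀ i, 0 < p.2.1 i at hq
  change 0 = P.Bᵀ *ᵥ p.2.2.1 at h₄
  change 0 = P.b + P.B *ᵥ p.2.2.2 - P.M *ᵥ p.2.2.1 - P.A *ᵥ p.2.1 at h₃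
  change 0 = P.Aᵀ *ᵥ p.2.2.1 + p.1 - P.a at h₁
  set ℓ : ℝ := ((Fintype.card c : ℕ) : ℝ) with hℓ
  set μ : ℝ := gap p / ℓ with hμ
  set Δ := P.newtonDir (σ * μ) p with hΔ
  obtain ⟨d₁, d₂, d₃, d₄⟩ := hP.newtonDir_spec hs hq (σ * μ)
  rw [← hΔ] at d₁ d₂ d₃ d₄
  replace d₁ : Δ.1 + P.Aᵀ *ᵥ Δ.2.2.1 = 0 := by
    rw [d₁, show p.1 + P.Aᵀ *ᵥ p.2.2.1 - P.a = 0 by rw [h₁]; abel, neg_zero]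
  replace d₃ : P.B *ᵥ Δ.2.2.2 - P.M *ᵥ Δ.2.2.1 - P.A *ᵥ Δ.2.1 = 0 := by
    rw [d₃, show P.B *ᵥ p.2.2.2 - P.M *ᵥ p.2.2.1 - P.A *ᵥ p.2.1 + P.b = 0 by rw [h₃]; abel,
      neg_zero]
  replace d₄ : P.Bᵀ *ᵥ Δ.2.2.1 = 0 := by rw [d₄, ← h₄, neg_zero]
  have hℓ0 : 0 ≤ ℓ := Nat.cast_nonneg _
  have hgap : p.1 ⬝ᵥ p.2.1 = ℓ * μ := gap_eq_card_mul p
  have hμ0 : 0 ≤ μ := div_nonneg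
    (Finset.sum_nonneg fun i _ => (mul_pos (hs i) (hq i)).le) hℓ0
  have hd : 0 ≤ Δ.1 ⬝ᵥ Δ.2.1 := by
    rw [dotProduct_eq_of_linear d₁ d₃ d₄]
    exact hP.posSemidef.real_dotProduct_mulVec_nonneg _
  obtain ⟨hb, hb'⟩ := abs_mul_le_of_complementarity_step hs hq d₂ hd hσ hθ.1 hμ0 hn hgap
  have hp' : P.ipIteration σ t p = p + t • Δ := rfl
  have hgap' : gap (p + t • Δ) = ℓ * μ * (1 - t * (1 - σ)) + t ^ 2 * (Δ.1 ⬝ᵥ Δ.2.1) :=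
    dotProduct_step d₂ hgap
  rw [hp']
  rw [← hℓ] at hb hb'
  set k : ℝ := 1 / θ + 1 with hk
  have hθ0 := hθ.1
  have hσ0 := hσ.1
  have hσ1 := hσ.2
  have hk0 : 0 < k := by positivity
  have ht0 := ht.1
  have ht1 : t ≤ 1 := ht.2.trans (min_le_left _ _)
  -- In ℓ + 1, the ℓ pays for the second-order error of a single product and the 1 for that of the
  -- mean of the products. The next bound makes the second-order growth of the gap at most half of
  -- its first-order decrease.
  have ht2 : t * (k * (ℓ + 1)) ≤ σ * (1 - θ) := by
    rw [← le_div_iff₀ (by positivity)]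
    exact ht.2.trans ((min_le_right _ _).trans (min_le_left _ _))
  have ht3 : t * (2 * k) ≤ 1 - σ := by
    rw [← le_div_iff₀ (by positivity)]
    exact ht.2.trans ((min_le_right _ _).trans (min_le_right _ _))
  have hprod : ∀ i, (p.2.1 i + t * Δ.2.1 i) * (p.1 i + t * Δ.1 i) =
      p.2.1 i * p.1 i + t * (σ * μ - p.2.1 i * p.1 i) + t ^ 2 * (Δ.1 i * Δ.2.1 i) := by
    intro i
    linear_combination t * d₂ i
  have hlow : ∀ i, (1 - t) * (θ * μ) + t * σ * μ - t ^ 2 * (ℓ * k * μ) ≤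
      (p.2.1 i + t * Δ.2.1 i) * (p.1 i + t * Δ.1 i) := by
    intro i
    rw [hprod i]
    have e1 := mul_le_mul_of_nonneg_left (hn i) (sub_nonneg.2 ht1)
    have e2 := mul_le_mul_of_nonneg_left (neg_le_of_abs_le (hb i)) (sq_nonneg t)
    linarith
  have hμpos : ∀ _ : c, 0 < μ := fun i => by
    have hℓp : 0 < ℓ := by
      have : Nonempty c := ⟨i⟩
      exact Nat.cast_pos.2 Fintype.card_pos
    refine div_pos ?_ hℓp
    exact Finset.sum_pos (fun i _ => mul_pos (hs i) (hq i)) ⟨i, Finset.mem_univ i⟩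
  have hpospr : ∀ i, 0 < (p.2.1 i + t * Δ.2.1 i) * (p.1 i + t * Δ.1 i) := by
    intro i
    refine lt_of_lt_of_le ?_ (hlow i)
    have hm := hμpos i
    have e1 : t * (t * (k * (ℓ + 1))) * μ ≤ t * (σ * (1 - θ)) * μ := by gcongr
    have e2 : 0 ≤ t ^ 2 * k * μ := by positivity
    have e3 : 0 ≤ (1 - t) * (θ * μ) := mul_nonneg (sub_nonneg.2 ht1) (by positivity)
    have e4 : 0 < t * σ * θ * μ := by positivity
    nlinarith
  -- A positive product still allows both new coordinates to be negative; this positive combination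
  -- of them excludes it.
  have hsumpos : ∀ i, 0 < p.1 i * (p.2.1 i + t * Δ.2.1 i) + p.2.1 i * (p.1 i + t * Δ.1 i) := by
    intro i
    have hm := hμpos i
    have e1 : p.1 i * (p.2.1 i + t * Δ.2.1 i) + p.2.1 i * (p.1 i + t * Δ.1 i) =
        (2 - t) * (p.2.1 i * p.1 i) + t * σ * μ := by
      linear_combination t * d₂ i
    rw [e1]
    have := mul_pos (hq i) (hs i)
    have := mul_pos (show 0 < 2 - t by linarith) this
    positivity
  have hnew : p + t • Δ ∈ P.strictlyFeasible := by
    refine ⟨fun i => ?_, fun i => ?_, ?_, ?_, ?_⟩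
    · change 0 < p.1 i + t * Δ.1 i
      by_contra! hneg
      have h1 : p.2.1 i + t * Δ.2.1 i ≤ 0 := by
        by_contra! h
        nlinarith [hpospr i]
      nlinarith [hsumpos i, hs i, hq i]
    · change 0 < p.2.1 i + t * Δ.2.1 i
      by_contra! hneg
      have h1 : p.1 i + t * Δ.1 i ≤ 0 := by
        by_contra! h
        nlinarith [hpospr i]
      nlinarith [hsumpos i, hs i, hq i]
    · change 0 = P.Bᵀ *ᵥ (p.2.2.1 + t • Δ.2.2.1)
      rw [mulVec_add, mulVec_smul, d₄, ← h₄, smul_zero, add_zero]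
    · change 0 = P.b + P.B *ᵥ (p.2.2.2 + t • Δ.2.2.2) - P.M *ᵥ (p.2.2.1 + t • Δ.2.2.1) -
        P.A *ᵥ (p.2.1 + t • Δ.2.1)
      simp only [mulVec_add, mulVec_smul]
      calc (0 : ι → ℝ) = (P.b + P.B *ᵥ p.2.2.2 - P.M *ᵥ p.2.2.1 - P.A *ᵥ p.2.1) +
            t • (P.B *ᵥ Δ.2.2.2 - P.M *ᵥ Δ.2.2.1 - P.A *ᵥ Δ.2.1) := by
              rw [d₃, ← h₃, smul_zero, add_zero]
        _ = _ := by simp only [smul_sub]; abel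
    · change 0 = P.Aᵀ *ᵥ (p.2.2.1 + t • Δ.2.2.1) + (p.1 + t • Δ.1) - P.a
      simp only [mulVec_add, mulVec_smul]
      calc (0 : c → ℝ) = (P.Aᵀ *ᵥ p.2.2.1 + p.1 - P.a) + t • (Δ.1 + P.Aᵀ *ᵥ Δ.2.2.1) := by
              rw [d₁, ← h₁, smul_zero, add_zero]
        _ = _ := by simp only [smul_add]; abel
  refine ⟨⟨hnew, fun i => ?_⟩, ?_⟩
  · refine le_trans ?_ (hlow i)
    have hm := hμpos i
    have hℓ1 : 1 ≤ ℓ := by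
      have : Nonempty c := ⟨i⟩
      exact Nat.one_le_cast.2 Fintype.card_pos
    -- The bound for the full scalar product carries a factor ℓ, which cancels in the mean.
    have hdl : (Δ.1 ⬝ᵥ Δ.2.1) / ℓ ≤ k * μ := by
      rw [div_le_iff₀ (by linarith)]
      linarith
    have e0 : gap (p + t • Δ) / ℓ =
        μ * (1 - t * (1 - σ)) + t ^ 2 * ((Δ.1 ⬝ᵥ Δ.2.1) / ℓ) := by
      rw [hgap']
      field_simp
    rw [← hℓ, e0]
    have e1 : t * (t * (k * (ℓ + 1))) * μ ≤ t * (σ * (1 - θ)) * μ := by gcongr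
    have e2 : θ * (t ^ 2 * ((Δ.1 ⬝ᵥ Δ.2.1) / ℓ)) ≤ 1 * (t ^ 2 * (k * μ)) := by
      have := hθ.2.le
      gcongr
    nlinarith
  · have hg : gap p = ℓ * μ := hgap
    rw [hgap', hg]
    have e1 : t ^ 2 * (Δ.1 ⬝ᵥ Δ.2.1) ≤ t ^ 2 * (ℓ * k * μ) := by gcongr
    have e2 : t * (t * (2 * k)) * (ℓ * μ) ≤ t * (1 - σ) * (ℓ * μ) := by gcongr
    nlinarith

/-- Convergence of the interior point iteration with short constant steps. -/
theorem Regular.exists_ipIteration_converges {P : PLQData ι κ c} (hP : P.Regular)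
    {p₀ : IPPoint ι κ c} (hp₀ : p₀ ∈ P.strictlyFeasible) {σ : ℝ} (hσ : σ ∈ Set.Ioo (0 : ℝ) 1) :
    ∃ t₀ ∈ Set.Ioc (0 : ℝ) 1, ∀ t ∈ Set.Ioc 0 t₀,
      (∀ j, (P.ipIteration σ t)^[j] p₀ ∈ P.strictlyFeasible) ∧
      Tendsto (fun j => gap ((P.ipIteration σ t)^[j] p₀)) atTop (𝓝 0) ∧
      Bornology.IsBounded (Set.range fun j => (P.ipIteration σ t)^[j] p₀) := by
  obtain ⟨θ, hθ, hmem⟩ := exists_mem_centralNhd hp₀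
  refine ⟨_, stepBound_mem (ℓ := Fintype.card c) hσ hθ, fun t ht => ?_⟩
  have ht1 : t ≤ 1 := ht.2.trans (min_le_left _ _)
  have hσ0 := hσ.1
  have hσ1 := hσ.2
  have ht0 := ht.1
  -- The step bound depends only on ℓ, σ and θ, so the same t and the same contraction factor serve
  -- at every iterate.
  set r := 1 - t * (1 - σ) / 2 with hr
  have hr0 : 0 ≤ r := by nlinarith
  have hr1 : r < 1 := by nlinarith
  have key : ∀ j, (P.ipIteration σ t)^[j] p₀ ∈ P.centralNhd θ ∧
      gap ((P.ipIteration σ t)^[j] p₀) ≤ r ^ j * gap p₀ := by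
    intro j
    induction j with
    | zero => exact ⟨hmem, by simp⟩
    | succ j ih =>
      rw [Function.iterate_succ_apply']
      obtain ⟨h1, h2⟩ := hP.ipIteration_mem_centralNhd hσ hθ ht ih.1
      refine ⟨h1, h2.trans ?_⟩
      calc r * gap ((P.ipIteration σ t)^[j] p₀) ≤ r * (r ^ j * gap p₀) :=
            mul_le_mul_of_nonneg_left ih.2 hr0
        _ = r ^ (j + 1) * gap p₀ := by ring
  refine ⟨fun j => (key j).1.1, ?_, ?_⟩
  · refine squeeze_zero (fun j => gap_nonneg (key j).1.1) (fun j => (key j).2) ?_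
    simpa using (tendsto_pow_atTop_nhds_zero_of_lt_one hr0 hr1).mul_const (gap p₀)
  · refine (hP.isBounded_strictlyFeasible_gap_le hp₀ (gap p₀)).subset ?_
    rintro _ ⟨j, rfl⟩
    refine ⟨(key j).1.1, (key j).2.trans ?_⟩
    exact mul_le_of_le_one_left (gap_nonneg hp₀) (pow_le_one₀ hr0 hr1.le)

/-! ### Limits of the iteration: KKT points and optimal values. -/

theorem continuous_gap : Continuous (gap : IPPoint ι κ c → ℝ) :=
  Continuous.dotProduct continuous_fst continuous_snd.fst

/-- Limits of strictly feasible points with vanishing gap solve the KKT system. -/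
theorem isKKT_of_mapClusterPt {P : PLQData ι κ c} {p : ℕ → IPPoint ι κ c}
    (hp : ∀ j, p j ∈ P.strictlyFeasible) (hgap : Tendsto (fun j => gap (p j)) atTop (𝓝 0))
    {p' : IPPoint ι κ c} (hp' : MapClusterPt p' atTop p) : P.IsKKT p' := by
  have hclosed : IsClosed {p : IPPoint ι κ c | (∀ i, 0 ≤ p.1 i) ∧ (∀ i, 0 ≤ p.2.1 i) ∧
      0 = P.Bᵀ *ᵥ p.2.2.1 ∧
      0 = P.b + P.B *ᵥ p.2.2.2 - P.M *ᵥ p.2.2.1 - P.A *ᵥ p.2.1 ∧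
      0 = P.Aᵀ *ᵥ p.2.2.1 + p.1 - P.a} := by
    have hB : Continuous fun p : IPPoint ι κ c => P.Bᵀ *ᵥ p.2.2.1 :=
      Continuous.matrix_mulVec continuous_const continuous_snd.snd.fst
    have hB' : Continuous fun p : IPPoint ι κ c => P.B *ᵥ p.2.2.2 :=
      Continuous.matrix_mulVec continuous_const continuous_snd.snd.snd
    have hM : Continuous fun p : IPPoint ι κ c => P.M *ᵥ p.2.2.1 :=
      Continuous.matrix_mulVec continuous_const continuous_snd.snd.fst
    have hA : Continuous fun p : IPPoint ι κ c => P.A *ᵥ p.2.1 :=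
      Continuous.matrix_mulVec continuous_const continuous_snd.fst
    have hA' : Continuous fun p : IPPoint ι κ c => P.Aᵀ *ᵥ p.2.2.1 :=
      Continuous.matrix_mulVec continuous_const continuous_snd.snd.fst
    simp only [Set.ofPred_and, Set.ofPred_forall]
    refine IsClosed.inter (isClosed_iInter fun i => isClosed_le continuous_const (by fun_prop))
      (IsClosed.inter (isClosed_iInter fun i => isClosed_le continuous_const (by fun_prop))
      (IsClosed.inter (isClosed_eq continuous_const hB) (IsClosed.inter
        (isClosed_eq continuous_const (by fun_prop)) (isClosed_eq continuous_const (by fun_prop)))))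
  have hmem := hclosed.mem_of_mapClusterPt hp' (Eventually.of_forall fun j =>
    ⟨fun i => ((hp j).1 i).le, fun i => ((hp j).2.1 i).le, (hp j).2.2⟩)
  obtain ⟨hs, hq, h₄, h₃, h₁⟩ := hmem
  have hg : gap p' = 0 := by
    have h1 : MapClusterPt (gap p') atTop (fun j => gap (p j)) :=
      hp'.tendsto_comp (f := gap) (continuous_gap.tendsto p')
    have h2 : ClusterPt (gap p') (𝓝 0) := h1.clusterPt.mono hgap
    exact eq_of_nhds_neBot h2
  refine ⟨h₄, h₃, h₁, fun i => ?_, hq, hs⟩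
  have := (Finset.sum_eq_zero_iff_of_nonneg
    fun i _ => mul_nonneg (hs i) (hq i)).1 hg i (Finset.mem_univ i)
  rw [mul_comm]
  exact this.symm

theorem IsKKT.rho_le {P : PLQData ι κ c} (hM : P.M.PosSemidef) {p : IPPoint ι κ c}
    (h : P.IsKKT p) (y : κ → ℝ) : P.rho p.2.2.2 ≤ P.rho y := by
  obtain ⟨h₄, h₃, h₁, hc, hq, hs⟩ := h
  have h := rho_le_rho_add_gap hM (p := p) hs hq h₄ h₃ h₁ y
  have hg : gap p = 0 := Finset.sum_eq_zero fun i _ => by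
    rw [mul_comm]
    exact (hc i).symm
  simpa [hg] using h

theorem IsKKT.rho_lt_top {P : PLQData ι κ c} (hM : P.M.PosSemidef) {p : IPPoint ι κ c}
    (h : P.IsKKT p) : P.rho p.2.2.2 < ⊤ :=
  (PLQData.rho_le hM h.2.2.2.2.1 h.2.1).trans_lt (EReal.coe_lt_top _)

/-- The values are squeezed between the infimum and the infimum plus the gap, by weak duality. -/
theorem tendsto_rho_of_gap {P : PLQData ι κ c} (hM : P.M.PosSemidef) {p : ℕ → IPPoint ι κ c}
    (hp : ∀ j, p j ∈ P.strictlyFeasible) (hgap : Tendsto (fun j => gap (p j)) atTop (𝓝 0)) :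
    Tendsto (fun j => P.rho (p j).2.2.2) atTop (𝓝 (⨅ y, P.rho y)) := by
  have hupper : ∀ j, P.rho (p j).2.2.2 ≤ (⨅ y, P.rho y) + (gap (p j) : EReal) := by
    intro j
    obtain ⟨hs, hq, h₄, h₃, h₁⟩ := hp j
    have h := rho_le_rho_add_gap hM (p := p j) (fun i => (hs i).le) (fun i => (hq i).le) h₄ h₃ h₁
    rw [← EReal.sub_le_iff_le_add (Or.inl (EReal.coe_ne_bot _)) (Or.inl (EReal.coe_ne_top _))]
    refine le_iInf fun y => ?_
    rw [EReal.sub_le_iff_le_add (Or.inl (EReal.coe_ne_bot _)) (Or.inl (EReal.coe_ne_top _))]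
    exact h y
  refine tendsto_of_tendsto_of_tendsto_of_le_of_le tendsto_const_nhds ?_
    (fun j => iInf_le _ _) hupper
  have h0 : Tendsto (fun j => (gap (p j) : EReal)) atTop (𝓝 ((0 : ℝ) : EReal)) :=
    (continuous_coe_real_ereal.tendsto 0).comp hgap
  -- Addition is continuous here because the second summand is finite; finiteness of the infimum is
  -- not needed.
  have hc : ContinuousAt (fun x : EReal × EReal => x.1 + x.2)
      ((⨅ y, P.rho y), ((0 : ℝ) : EReal)) :=
    EReal.continuousAt_add (Or.inr (EReal.coe_ne_bot _)) (Or.inr (EReal.coe_ne_top _))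
  have := hc.tendsto.comp (tendsto_const_nhds.prodMk_nhds h0)
  simpa [Function.comp_def] using this

end PLQData

/-! ## The combined data of the smoothing problem -/

theorem Matrix.blockDiagonal'_mulVec_apply {o : Type*} [Fintype o] [DecidableEq o]
    {m' n' : o → Type*} [∀ k, Fintype (n' k)] (M : ∀ k, Matrix (m' k) (n' k) ℝ)
    (v : (Σ k, n' k) → ℝ) (k : o) (i : m' k) :
    (blockDiagonal' M *ᵥ v) ⟨k, i⟩ = (M k *ᵥ fun j => v ⟨k, j⟩) i := by
  simp only [mulVec, dotProduct, Fintype.sum_sigma]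
  rw [Finset.sum_eq_single k]
  · simp
  · intro j _ hj
    refine Finset.sum_eq_zero fun b _ => ?_
    rw [blockDiagonal'_apply_ne _ _ _ (Ne.symm hj), zero_mul]
  · simp

theorem Matrix.PosSemidef.blockDiagonal' {o : Type*} [Fintype o] [DecidableEq o]
    {n' : o → Type*} [∀ k, Fintype (n' k)] {M : ∀ k, Matrix (n' k) (n' k) ℝ}
    (hM : ∀ k, (M k).PosSemidef) : (blockDiagonal' M).PosSemidef := by
  refine PosSemidef.of_dotProduct_mulVec_nonneg ?_ fun x => ?_
  · rw [IsHermitian, blockDiagonal'_conjTranspose]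
    congr 1
    funext k
    exact (hM k).isHermitian
  · rw [star_trivial, dotProduct, Fintype.sum_sigma]
    refine Finset.sum_nonneg fun k _ => ?_
    simp only [blockDiagonal'_mulVec_apply]
    exact (hM k).real_dotProduct_mulVec_nonneg fun j => x ⟨k, j⟩

theorem Matrix.PosSemidef.fromBlocks_diagonal {m' n' : Type*} [Fintype m'] [Fintype n']
    {M : Matrix m' m' ℝ} {M' : Matrix n' n' ℝ} (hM : M.PosSemidef) (hM' : M'.PosSemidef) :
    (fromBlocks M 0 0 M').PosSemidef := by
  refine PosSemidef.of_dotProduct_mulVec_nonneg ?_ fun x => ?_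
  · exact IsHermitian.fromBlocks hM.isHermitian (by simp) hM'.isHermitian
  · have h : star x ⬝ᵥ (fromBlocks M 0 0 M' *ᵥ x) =
        (x ∘ Sum.inl) ⬝ᵥ (M *ᵥ (x ∘ Sum.inl)) + (x ∘ Sum.inr) ⬝ᵥ (M' *ᵥ (x ∘ Sum.inr)) := by
      simp [fromBlocks_mulVec, dotProduct]
    rw [h]
    exact add_nonneg (hM.real_dotProduct_mulVec_nonneg _) (hM'.real_dotProduct_mulVec_nonneg _)

open scoped MatrixOrder in
-- The square of det √Q is det Q, a unit.
theorem invSqrt_mulVec_injective {n : ℕ} {Q : Matrix (Fin n) (Fin n) ℝ} (hQ : Q.PosDef) :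
    Function.Injective fun y => invSqrt Q *ᵥ y := by
  have h : CFC.sqrt Q * CFC.sqrt Q = Q := CFC.sqrt_mul_sqrt_self Q hQ.posSemidef.nonneg
  have hd : IsUnit (CFC.sqrt Q).det := by
    have hu := (isUnit_iff_isUnit_det _).1 hQ.isUnit
    rw [← h, det_mul] at hu
    exact isUnit_of_mul_isUnit_left hu
  refine mulVec_injective_of_isUnit ?_
  rw [invSqrt, isUnit_iff_isUnit_det]
  exact isUnit_nonsing_inv_det _ hd

namespace KalmanModel

variable {N n m : ℕ} {pw pv lw lv : Fin N → ℕ} (K : KalmanModel N n m pw pv lw lv)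

/-- The `k`-th block of a stacked vector, and `0` if `k` is not a time point. -/
def stateAt (x : (Stack fun _ : Fin N => n) → ℝ) (k : ℕ) : Fin n → ℝ :=
  if h : k < N then fun i => x ⟨⟨k, h⟩, i⟩ else 0

/-- The matrix `G_k` that maps the state `k - 1` to the state `k`, and `0` if one of the two
is not a time point. -/
def transition (k : ℕ) : Matrix (Fin n) (Fin n) ℝ :=
  if h : k < N then (if k = 0 then 0 else K.G ⟨k, h⟩) else 0

/-- The `k`-th block of `μ`. -/
def initial (k : ℕ) : Fin n → ℝ := if k = 0 then K.x₀ else 0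

theorem stateAt_val (x : (Stack fun _ : Fin N => n) → ℝ) (k : Fin N) :
    stateAt x k = fun i => x ⟨k, i⟩ := by
  simp [stateAt]

theorem transition_zero : K.transition 0 = 0 := by
  simp [transition]

theorem transition_of_le {k : ℕ} (h : N ≤ k) : K.transition k = 0 := by
  simp [transition, h.not_gt]

theorem bigMu_eq (k : Fin N) : (fun i => K.bigMu ⟨k, i⟩) = K.initial k := by
  unfold bigMu initial
  split_ifs <;> rfl

/-- The zero defaults make one formula valid at all times: for k = 0 the truncated k - 1 is 0 again,
but `transition 0` vanishes. -/
theorem bigG_mulVec (x : (Stack fun _ : Fin N => n) → ℝ) (k : Fin N) :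
    (fun i => (K.bigG *ᵥ x) ⟨k, i⟩) =
      stateAt x k - K.transition k *ᵥ stateAt x ((k : ℕ) - 1) := by
  have hsplit : ∀ (j : Fin N) (i : Fin n), ∑ b, K.bigG ⟨k, i⟩ ⟨j, b⟩ * x ⟨j, b⟩ =
      (if k = j then x ⟨j, i⟩ else 0) +
        (if (j : ℕ) + 1 = k then -((K.G k *ᵥ fun b => x ⟨j, b⟩) i) else 0) := by
    intro j i
    by_cases h1 : k = j
    · subst h1
      simp [bigG, one_apply]
    · by_cases h2 : (j : ℕ) + 1 = k
      · simp [bigG, h1, h2, mulVec, dotProduct]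
      · simp [bigG, h1, h2]
  funext i
  simp only [mulVec, dotProduct, Fintype.sum_sigma, hsplit, Finset.sum_add_distrib,
    Finset.sum_ite_eq, Finset.mem_univ, if_true]
  rw [Pi.sub_apply, stateAt_val, sub_eq_add_neg]
  congr 1
  by_cases hk : (k : ℕ) = 0
  · rw [hk, transition_zero]
    simp
  · have hlt : (k : ℕ) - 1 < N := by omega
    rw [Finset.sum_eq_single (⟨(k : ℕ) - 1, hlt⟩ : Fin N)]
    · have h1 : (k : ℕ) - 1 + 1 = k := by omega
      simp [h1, transition, hk, stateAt, hlt, mulVec, dotProduct]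
    · intro j _ hj
      rw [if_neg]
      intro h
      exact hj (Fin.ext (by simp; omega))
    · simp

/-- The transpose couples a time with its successor; at the last time the successor term vanishes by
the defaults. -/
theorem bigG_transpose_mulVec (x : (Stack fun _ : Fin N => n) → ℝ) (k : Fin N) :
    (fun i => (K.bigGᵀ *ᵥ x) ⟨k, i⟩) =
      stateAt x k - (K.transition (k + 1))ᵀ *ᵥ stateAt x (k + 1) := by
  have hsplit : ∀ (j : Fin N) (i : Fin n), ∑ b, K.bigGᵀ ⟨k, i⟩ ⟨j, b⟩ * x ⟨j, b⟩ =
      (if k = j then x ⟨j, i⟩ else 0) +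
        (if (k : ℕ) + 1 = j then -(((K.G j)ᵀ *ᵥ fun b => x ⟨j, b⟩) i) else 0) := by
    intro j i
    by_cases h1 : k = j
    · subst h1
      simp [bigG, one_apply]
    · by_cases h2 : (k : ℕ) + 1 = j
      · simp [bigG, Ne.symm h1, h1, h2, mulVec, dotProduct]
      · simp [bigG, Ne.symm h1, h1, h2]
  funext i
  simp only [mulVec, dotProduct, Fintype.sum_sigma, hsplit, Finset.sum_add_distrib,
    Finset.sum_ite_eq, Finset.mem_univ, if_true]
  rw [Pi.sub_apply, stateAt_val, sub_eq_add_neg]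
  congr 1
  by_cases hk : (k : ℕ) + 1 < N
  · rw [Finset.sum_eq_single (⟨(k : ℕ) + 1, hk⟩ : Fin N)]
    · simp [transition, hk, stateAt, mulVec, dotProduct]
    · intro j _ hj
      rw [if_neg]
      intro h
      exact hj (Fin.ext (by simp; omega))
    · simp
  · rw [transition_of_le _ (not_lt.1 hk)]
    simp only [transpose_zero, zero_mulVec, Pi.zero_apply, neg_zero]
    refine Finset.sum_eq_zero fun j _ => ?_
    rw [if_neg]
    omega

/-! ### Blocks of the combined data -/

theorem combined_M_mulVec_inl (u : Stack pv ⊕ Stack pw → ℝ) (k : Fin N) :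
    (fun i => (K.combined.M *ᵥ u) (Sum.inl ⟨k, i⟩)) =
      (K.v k).M *ᵥ fun j => u (Sum.inl ⟨k, j⟩) := by
  funext i
  simp [combined, PLQData.stack, fromBlocks_mulVec, blockDiagonal'_mulVec_apply]

theorem combined_M_mulVec_inr (u : Stack pv ⊕ Stack pw → ℝ) (k : Fin N) :
    (fun i => (K.combined.M *ᵥ u) (Sum.inr ⟨k, i⟩)) =
      (K.w k).M *ᵥ fun j => u (Sum.inr ⟨k, j⟩) := by
  funext i
  simp [combined, PLQData.stack, fromBlocks_mulVec, blockDiagonal'_mulVec_apply]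

theorem combined_A_mulVec_inl (q : Stack lv ⊕ Stack lw → ℝ) (k : Fin N) :
    (fun i => (K.combined.A *ᵥ q) (Sum.inl ⟨k, i⟩)) =
      (K.v k).A *ᵥ fun j => q (Sum.inl ⟨k, j⟩) := by
  funext i
  simp [combined, PLQData.stack, fromBlocks_mulVec, blockDiagonal'_mulVec_apply]

theorem combined_A_mulVec_inr (q : Stack lv ⊕ Stack lw → ℝ) (k : Fin N) :
    (fun i => (K.combined.A *ᵥ q) (Sum.inr ⟨k, i⟩)) =
      (K.w k).A *ᵥ fun j => q (Sum.inr ⟨k, j⟩) := by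
  funext i
  simp [combined, PLQData.stack, fromBlocks_mulVec, blockDiagonal'_mulVec_apply]

theorem combined_A_transpose_mulVec_inl (u : Stack pv ⊕ Stack pw → ℝ) (k : Fin N) :
    (fun i => (K.combined.Aᵀ *ᵥ u) (Sum.inl ⟨k, i⟩)) =
      (K.v k).Aᵀ *ᵥ fun j => u (Sum.inl ⟨k, j⟩) := by
  funext i
  simp [combined, PLQData.stack, fromBlocks_transpose, fromBlocks_mulVec,
    blockDiagonal'_transpose, blockDiagonal'_mulVec_apply]

theorem combined_A_transpose_mulVec_inr (u : Stack pv ⊕ Stack pw → ℝ) (k : Fin N) :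
    (fun i => (K.combined.Aᵀ *ᵥ u) (Sum.inr ⟨k, i⟩)) =
      (K.w k).Aᵀ *ᵥ fun j => u (Sum.inr ⟨k, j⟩) := by
  funext i
  simp [combined, PLQData.stack, fromBlocks_transpose, fromBlocks_mulVec,
    blockDiagonal'_transpose, blockDiagonal'_mulVec_apply]

theorem combined_B_mulVec_inl (x : (Stack fun _ : Fin N => n) → ℝ) (k : Fin N) :
    (fun i => (K.combined.B *ᵥ x) (Sum.inl ⟨k, i⟩)) =
      (K.v k).B *ᵥ (invSqrt (K.R k) *ᵥ (K.H k *ᵥ stateAt x k)) := by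
  rw [stateAt_val]
  funext i
  simp [combined, PLQData.stack, fromRows_mulVec, ← mulVec_mulVec, bigR, bigH,
    blockDiagonal'_mulVec_apply]

theorem combined_B_mulVec_inr (x : (Stack fun _ : Fin N => n) → ℝ) (k : Fin N) :
    (fun i => (K.combined.B *ᵥ x) (Sum.inr ⟨k, i⟩)) =
      (K.w k).B *ᵥ (invSqrt (K.Q k) *ᵥ
        (stateAt x k - K.transition k *ᵥ stateAt x ((k : ℕ) - 1))) := by
  rw [← bigG_mulVec]
  funext i
  simp [combined, PLQData.stack, fromRows_mulVec, ← mulVec_mulVec, bigQ,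
    blockDiagonal'_mulVec_apply]

theorem combined_b_inl (k : Fin N) :
    (fun i => K.combined.b (Sum.inl ⟨k, i⟩)) =
      (K.v k).b - (K.v k).B *ᵥ (invSqrt (K.R k) *ᵥ K.z k) := by
  funext i
  simp [combined, PLQData.stack, ← mulVec_mulVec, bigR, bigZ, blockDiagonal'_mulVec_apply]

theorem combined_b_inr (k : Fin N) :
    (fun i => K.combined.b (Sum.inr ⟨k, i⟩)) =
      (K.w k).b - (K.w k).B *ᵥ (invSqrt (K.Q k) *ᵥ K.initial k) := by
  rw [← bigMu_eq]
  funext i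
  simp [combined, PLQData.stack, ← mulVec_mulVec, bigQ, blockDiagonal'_mulVec_apply]

/-- The block of `B_wᵀ Q^{-1/2} u` at time `k`, and `0` if `k` is not a time point. -/
def processDual (u : Stack pv ⊕ Stack pw → ℝ) (k : ℕ) : Fin n → ℝ :=
  if h : k < N then (invSqrt (K.Q ⟨k, h⟩))ᵀ *ᵥ ((K.w ⟨k, h⟩).Bᵀ *ᵥ
    fun i => u (Sum.inr ⟨⟨k, h⟩, i⟩)) else 0

/-- This puts the equation for Bᵀu in blocks. The process part is Gᵀ applied to the stacked vectors
`processDual`, whence the difference of times k and k + 1. -/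
theorem combined_B_transpose_mulVec (u : Stack pv ⊕ Stack pw → ℝ) (k : Fin N) :
    (fun i => (K.combined.Bᵀ *ᵥ u) ⟨k, i⟩) =
      (K.H k)ᵀ *ᵥ ((invSqrt (K.R k))ᵀ *ᵥ ((K.v k).Bᵀ *ᵥ fun i => u (Sum.inl ⟨k, i⟩))) +
        (K.processDual u k - (K.transition (k + 1))ᵀ *ᵥ K.processDual u (k + 1)) := by
  set W := (blockDiagonal' fun k => (invSqrt (K.Q k))ᵀ) *ᵥ
    ((blockDiagonal' fun k => ((K.w k).B)ᵀ) *ᵥ (u ∘ Sum.inr)) with hW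
  have hWk : ∀ k : ℕ, stateAt W k = K.processDual u k := by
    intro k
    unfold stateAt processDual
    split_ifs
    · funext i
      simp [hW, blockDiagonal'_mulVec_apply, -mulVec_mulVec]
    · rfl
  have h : K.combined.Bᵀ *ᵥ u = (blockDiagonal' fun k => (K.H k)ᵀ) *ᵥ
      ((blockDiagonal' fun k => (invSqrt (K.R k))ᵀ) *ᵥ
        ((blockDiagonal' fun k => ((K.v k).B)ᵀ) *ᵥ (u ∘ Sum.inl))) + K.bigGᵀ *ᵥ W := by
    rw [hW]
    have e : K.combined.Bᵀ = fromCols ((PLQData.stack K.v).B * K.bigR * K.bigH)ᵀ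
        ((PLQData.stack K.w).B * K.bigQ * K.bigG)ᵀ := transpose_fromRows _ _
    rw [e, fromCols_mulVec]
    simp only [transpose_mul, PLQData.stack, bigR, bigH, bigQ, blockDiagonal'_transpose,
      mulVec_mulVec, Matrix.mul_assoc]
  rw [← hWk, ← hWk, ← bigG_transpose_mulVec, h]
  funext i
  simp [blockDiagonal'_mulVec_apply, -mulVec_mulVec]

/-! ### Regularity of the combined data -/

theorem _root_.PLQData.IsPLQDensity.regular {ι κ c : Type*} [Fintype ι] [Fintype κ] [Fintype c]
    {P : PLQData ι κ c} (h : P.IsPLQDensity) (h' : P.NullSpaceCondition) : P.Regular :=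
  ⟨h.posSemidef, h', h.injective⟩

variable {K}

/-- M and A are block diagonal, so the first two properties hold blockwise. For B the process rows
suffice: Bx = 0 forces xₖ = Gₖxₖ₋₁ with zero start, and induction on time gives x = 0. -/
theorem HasPLQNoise.combined_regular (hK : K.HasPLQNoise) (hN : K.NullSpaceCondition) :
    K.combined.Regular where
  posSemidef := PosSemidef.fromBlocks_diagonal
    (PosSemidef.blockDiagonal' fun k => (hK.measurement k).posSemidef)
    (PosSemidef.blockDiagonal' fun k => (hK.process k).posSemidef)
  null := by
    refine Set.eq_singleton_iff_unique_mem.2 ⟨⟨mulVec_zero _, mulVec_zero _⟩, ?_⟩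
    rintro u ⟨hM, hA⟩
    change K.combined.M *ᵥ u = 0 at hM
    change K.combined.Aᵀ *ᵥ u = 0 at hA
    have h1 : ∀ k, (fun j => u (Sum.inl ⟨k, j⟩)) = 0 := fun k =>
      ((hK.measurement k).regular (hN k).2).eq_zero
        (by rw [← combined_M_mulVec_inl, hM]; rfl)
        (by rw [← combined_A_transpose_mulVec_inl, hA]; rfl)
    have h2 : ∀ k, (fun j => u (Sum.inr ⟨k, j⟩)) = 0 := fun k =>
      ((hK.process k).regular (hN k).1).eq_zero
        (by rw [← combined_M_mulVec_inr, hM]; rfl)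
        (by rw [← combined_A_transpose_mulVec_inr, hA]; rfl)
    funext i
    rcases i with ⟨k, i⟩ | ⟨k, i⟩
    · exact congrFun (h1 k) i
    · exact congrFun (h2 k) i
  injective := by
    have key : ∀ x, K.combined.B *ᵥ x = 0 → x = 0 := by
      intro x hx
      have hstep : ∀ k : Fin N, stateAt x k = K.transition k *ᵥ stateAt x ((k : ℕ) - 1) := by
        intro k
        have h := K.combined_B_mulVec_inr x k
        rw [hx] at h
        have h' : (K.w k).B *ᵥ (invSqrt (K.Q k) *ᵥ
            (stateAt x k - K.transition k *ᵥ stateAt x ((k : ℕ) - 1))) = (K.w k).B *ᵥ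
            (invSqrt (K.Q k) *ᵥ 0) := by
          rw [← h, mulVec_zero, mulVec_zero]
          rfl
        exact sub_eq_zero.1 (invSqrt_mulVec_injective (hK.posDef_Q k)
          ((hK.process k).injective h'))
      have hz : ∀ k : ℕ, stateAt x k = 0 := by
        intro k
        induction k with
        | zero =>
          by_cases h : 0 < N
          · rw [hstep ⟨0, h⟩, transition_zero, zero_mulVec]
          · simp [stateAt, h]
        | succ k ih =>
          by_cases h : k + 1 < N
          · rw [hstep ⟨k + 1, h⟩]
            simp [ih]
          · simp [stateAt, h]
      funext i
      have := hz i.1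
      rw [stateAt_val] at this
      exact congrFun this i.2
    intro x y hxy
    refine sub_eq_zero.1 (key _ ?_)
    rw [mulVec_sub]
    exact sub_eq_zero.2 hxy

/-! ### The objective and the posterior density -/

/-- Both the dual objective and the polyhedron split along the two factors of U, and the supremum of
a sum of functions of separate variables is the sum of the suprema. -/
theorem objective_eq_rho (K : KalmanModel N n m pw pv lw lv)
    (x : (Stack fun _ : Fin N => n) → ℝ) : K.objective x = K.combined.rho x := by
  have hval : ∀ u : Stack pv ⊕ Stack pw → ℝ,
      u ⬝ᵥ (K.combined.b + K.combined.B *ᵥ x) - 1 / 2 * (u ⬝ᵥ (K.combined.M *ᵥ u)) =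
      ((u ∘ Sum.inr) ⬝ᵥ ((PLQData.stack K.w).b +
          (PLQData.stack K.w).B *ᵥ (K.bigQ *ᵥ (K.bigG *ᵥ x - K.bigMu))) -
        1 / 2 * ((u ∘ Sum.inr) ⬝ᵥ ((PLQData.stack K.w).M *ᵥ (u ∘ Sum.inr)))) +
      ((u ∘ Sum.inl) ⬝ᵥ ((PLQData.stack K.v).b +
          (PLQData.stack K.v).B *ᵥ (K.bigR *ᵥ (K.bigH *ᵥ x - K.bigZ))) -
        1 / 2 * ((u ∘ Sum.inl) ⬝ᵥ ((PLQData.stack K.v).M *ᵥ (u ∘ Sum.inl)))) := by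
    intro u
    have e1 : u = Sum.elim (u ∘ Sum.inl) (u ∘ Sum.inr) := (Sum.elim_comp_inl_inr u).symm
    have e2 : K.combined.b + K.combined.B *ᵥ x = Sum.elim
        ((PLQData.stack K.v).b + (PLQData.stack K.v).B *ᵥ (K.bigR *ᵥ (K.bigH *ᵥ x - K.bigZ)))
        ((PLQData.stack K.w).b +
          (PLQData.stack K.w).B *ᵥ (K.bigQ *ᵥ (K.bigG *ᵥ x - K.bigMu))) := by
      funext i
      rcases i with i | i <;>
      · simp only [combined, fromRows_mulVec, Pi.add_apply, Sum.elim_inl, Sum.elim_inr,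
          mulVec_sub, ← mulVec_mulVec, Pi.sub_apply]
        ring
    have e3 : K.combined.M *ᵥ u = Sum.elim ((PLQData.stack K.v).M *ᵥ (u ∘ Sum.inl))
        ((PLQData.stack K.w).M *ᵥ (u ∘ Sum.inr)) := by
      simp [combined, fromBlocks_mulVec]
    rw [e2, e3]
    have e4 : ∀ f g, u ⬝ᵥ Sum.elim f g = (u ∘ Sum.inl) ⬝ᵥ f + (u ∘ Sum.inr) ⬝ᵥ g := fun f g => by
      conv_lhs => rw [e1]
      exact sumElim_dotProduct_sumElim _ _ _ _
    rw [e4, e4]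
    ring
  have hA : ∀ u : Stack pv ⊕ Stack pw → ℝ, K.combined.Aᵀ *ᵥ u =
      Sum.elim ((PLQData.stack K.v).Aᵀ *ᵥ (u ∘ Sum.inl))
        ((PLQData.stack K.w).Aᵀ *ᵥ (u ∘ Sum.inr)) := by
    intro u
    simp [combined, fromBlocks_transpose, fromBlocks_mulVec]
  apply le_antisymm
  -- The suprema may be infinite or not attained, so values strictly below them are compared.
  · refine EReal.add_le_of_forall_lt fun α hα β hβ => ?_
    simp only [PLQData.rho, lt_iSup_iff] at hα hβ
    obtain ⟨uw, hw, hα⟩ := hα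
    obtain ⟨uv, hv, hβ⟩ := hβ
    have hu : Sum.elim uv uw ∈ K.combined.U := by
      change K.combined.Aᵀ *ᵥ _ ≤ _
      rw [hA]
      rintro (i | i)
      · exact hv i
      · exact hw i
    refine le_trans (add_le_add hα.le hβ.le) (le_trans (le_of_eq ?_) (K.combined.le_rho hu x))
    rw [hval, EReal.coe_add]
    rfl
  · refine iSup₂_le fun u hu => ?_
    change K.combined.Aᵀ *ᵥ u ≤ _ at hu
    rw [hA] at hu
    rw [hval, EReal.coe_add]
    exact add_le_add (PLQData.le_rho _ (fun i => hu (Sum.inr i)) _)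
      (PLQData.le_rho _ (fun i => hu (Sum.inl i)) _)

theorem _root_.PLQData.rho_compMatrix {ι κ c : Type*} [Fintype ι] [Fintype κ] [Fintype c]
    (P : PLQData ι κ c) (S : Matrix κ κ ℝ) (y : κ → ℝ) :
    (P.compMatrix S).rho y = P.rho (S *ᵥ y) := by
  simp only [PLQData.rho, PLQData.compMatrix, PLQData.U, mulVec_mulVec]

theorem _root_.PLQData.normalizer_nonneg {ι κ c : Type*} [Fintype ι] [Fintype κ] [Fintype c]
    (P : PLQData ι κ c) : 0 ≤ P.normalizer :=
  integral_nonneg fun _ => (Real.exp_pos _).le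

theorem _root_.PLQData.density_nonneg {ι κ c : Type*} [Fintype ι] [Fintype κ] [Fintype c]
    (P : PLQData ι κ c) (y : κ → ℝ) : 0 ≤ P.density y := by
  unfold PLQData.density
  split_ifs
  · exact le_rfl
  · exact mul_nonneg (inv_nonneg.2 P.normalizer_nonneg) (Real.exp_pos _).le

theorem _root_.PLQData.zero_mem_stack {N n : ℕ} {p l : Fin N → ℕ}
    {P : (k : Fin N) → PLQData (Fin (p k)) (Fin n) (Fin (l k))}
    (h : ∀ k, (0 : Fin (p k) → ℝ) ∈ (P k).U) : (0 : Stack p → ℝ) ∈ (PLQData.stack P).U := by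
  intro i
  have := h i.1 i.2
  simpa [PLQData.stack] using this

/-- Where both penalties are finite, the posterior is a constant times exp(-objective). Only
nonnegativity of the normalizers matters, so their finiteness and positivity need not be discussed.
-/
theorem HasPLQNoise.posterior_le (hK : K.HasPLQNoise) {x y : (Stack fun _ : Fin N => n) → ℝ}
    (hx : K.objective x < ⊤) (hxy : K.objective x ≤ K.objective y) :
    K.posterior y ≤ K.posterior x := by
  have hw : ∀ y, 0 ≤ (PLQData.stack K.w).rho y :=
    PLQData.rho_nonneg (PLQData.zero_mem_stack fun k => (hK.process k).zero_mem)
  have hv : ∀ y, 0 ≤ (PLQData.stack K.v).rho y :=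
    PLQData.rho_nonneg (PLQData.zero_mem_stack fun k => (hK.measurement k).zero_mem)
  by_cases hy : K.posterior y = 0
  · rw [hy]
    exact mul_nonneg (PLQData.density_nonneg _ _) (PLQData.density_nonneg _ _)
  unfold posterior PLQData.density at hy ⊢
  unfold objective at hx hxy
  simp only [PLQData.rho_compMatrix] at hy ⊢
  set a := (PLQData.stack K.w).rho (K.bigQ *ᵥ (K.bigG *ᵥ x - K.bigMu))
  set b := (PLQData.stack K.v).rho (K.bigR *ᵥ (K.bigH *ᵥ x - K.bigZ))
  set a' := (PLQData.stack K.w).rho (K.bigQ *ᵥ (K.bigG *ᵥ y - K.bigMu))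
  set b' := (PLQData.stack K.v).rho (K.bigR *ᵥ (K.bigH *ᵥ y - K.bigZ))
  have ha : 0 ≤ a := hw _
  have hb : 0 ≤ b := hv _
  have ha' : 0 ≤ a' := hw _
  have hb' : 0 ≤ b' := hv _
  have hat : a ≠ ⊤ := fun h => by
    rw [h, EReal.top_add_of_ne_bot (ne_bot_of_le_ne_bot EReal.zero_ne_bot hb)] at hx
    exact lt_irrefl _ hx
  have hbt : b ≠ ⊤ := fun h => by
    rw [h, EReal.add_top_of_ne_bot (ne_bot_of_le_ne_bot EReal.zero_ne_bot ha)] at hx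
    exact lt_irrefl _ hx
  have hat' : a' ≠ ⊤ := fun h => hy (by rw [if_pos h, zero_mul])
  have hbt' : b' ≠ ⊤ := fun h => hy (by rw [if_pos h, mul_zero])
  rw [if_neg hat, if_neg hbt, if_neg hat', if_neg hbt']
  clear_value a b a' b'
  lift a to ℝ using ⟨hat, ne_bot_of_le_ne_bot EReal.zero_ne_bot ha⟩
  lift b to ℝ using ⟨hbt, ne_bot_of_le_ne_bot EReal.zero_ne_bot hb⟩
  lift a' to ℝ using ⟨hat', ne_bot_of_le_ne_bot EReal.zero_ne_bot ha'⟩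
  lift b' to ℝ using ⟨hbt', ne_bot_of_le_ne_bot EReal.zero_ne_bot hb'⟩
  have hle : a + b ≤ a' + b' := by exact_mod_cast hxy
  simp only [EReal.toReal_coe]
  have hexp : Real.exp (-a') * Real.exp (-b') ≤ Real.exp (-a) * Real.exp (-b) := by
    rw [← Real.exp_add, ← Real.exp_add]
    exact Real.exp_le_exp.2 (by linarith)
  have hc := mul_nonneg
    (inv_nonneg.2 ((PLQData.stack K.w).compMatrix K.bigQ).normalizer_nonneg)
    (inv_nonneg.2 ((PLQData.stack K.v).compMatrix K.bigR).normalizer_nonneg)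
  calc _ = _ := mul_mul_mul_comm _ _ _ _
    _ ≤ _ := mul_le_mul_of_nonneg_left hexp hc
    _ = _ := mul_mul_mul_comm _ _ _ _

/-! ### Block tridiagonality -/

/-- The time point of an index of the dual variable, or of a constraint. -/
def timeOf {p p' : Fin N → ℕ} : Stack p ⊕ Stack p' → Fin N := Sum.elim Sigma.fst Sigma.fst

theorem timeOf_eq_of_fromBlocks_ne_zero {p p' l l' : Fin N → ℕ}
    {X : ∀ k, Matrix (Fin (p k)) (Fin (l k)) ℝ} {Y : ∀ k, Matrix (Fin (p' k)) (Fin (l' k)) ℝ}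
    {a : Stack p ⊕ Stack p'} {b : Stack l ⊕ Stack l'}
    (h : fromBlocks (blockDiagonal' X) 0 0 (blockDiagonal' Y) a b ≠ 0) : timeOf a = timeOf b := by
  rcases a with ⟨k, a⟩ | ⟨k, a⟩ <;> rcases b with ⟨k', b⟩ | ⟨k', b⟩
  · by_contra hne
    exact h (blockDiagonal'_apply_ne X a b hne)
  · exact absurd rfl h
  · exact absurd rfl h
  · by_contra hne
    exact h (blockDiagonal'_apply_ne Y a b hne)

theorem combined_redT_eq_zero {p : IPPoint (Stack pv ⊕ Stack pw) (Stack fun _ : Fin N => n)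
    (Stack lv ⊕ Stack lw)} {a b : Stack pv ⊕ Stack pw} (h : timeOf a ≠ timeOf b) :
    K.combined.redT p a b = 0 := by
  have hM : K.combined.M a b = 0 := by
    by_contra hne
    exact h (timeOf_eq_of_fromBlocks_ne_zero (X := fun k => (K.v k).M)
      (Y := fun k => (K.w k).M) hne)
  rw [PLQData.redT, Matrix.add_apply, hM, zero_add, mul_apply]
  refine Finset.sum_eq_zero fun j _ => ?_
  rw [mul_diagonal, transpose_apply]
  by_contra hne
  refine h ((timeOf_eq_of_fromBlocks_ne_zero (X := fun k => (K.v k).A)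
    (Y := fun k => (K.w k).A) (b := j) ?_).trans
    (timeOf_eq_of_fromBlocks_ne_zero (X := fun k => (K.v k).A)
    (Y := fun k => (K.w k).A) (b := j) ?_).symm)
  · exact left_ne_zero_of_mul (left_ne_zero_of_mul hne)
  · exact right_ne_zero_of_mul hne

/-- A block diagonal matrix is block triangular both for the order of the labels and for its dual,
and inversion preserves each of the two. -/
theorem _root_.Matrix.inv_apply_eq_zero_of_blocks {ι α : Type*} [Fintype ι] [DecidableEq ι]
    [LinearOrder α] {T : Matrix ι ι ℝ} (hT : IsUnit T) {τ : ι → α}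
    (h : ∀ a b, τ a ≠ τ b → T a b = 0) {a b : ι} (hab : τ a ≠ τ b) : T⁻¹ a b = 0 := by
  let := invertibleOfIsUnitDet T ((isUnit_iff_isUnit_det _).1 hT)
  rcases lt_or_gt_of_ne hab with h' | h'
  · have h1 : T.BlockTriangular (OrderDual.toDual ∘ τ) := fun i j hij =>
      h i j (ne_of_lt (OrderDual.toDual_lt_toDual.1 hij))
    exact blockTriangular_inv_of_blockTriangular h1 (OrderDual.toDual_lt_toDual.2 h')
  · have h1 : T.BlockTriangular τ := fun i j hij => h i j (ne_of_gt hij)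
    exact blockTriangular_inv_of_blockTriangular h1 h'

/-- A measurement row sees the state of its own time only; a process row also sees the preceding
state. -/
theorem combined_B_ne_zero {a : Stack pv ⊕ Stack pw} {i : Stack fun _ : Fin N => n}
    (h : K.combined.B a i ≠ 0) : timeOf a = i.1 ∨ (timeOf a : ℕ) = i.1 + 1 := by
  rcases a with a | a
  · left
    have e : K.combined.B (Sum.inl a) i = blockDiagonal'
        (fun k => (K.v k).B * invSqrt (K.R k) * K.H k) a i := by
      simp [combined, PLQData.stack, bigR, bigH, blockDiagonal'_mul]
    rw [e] at h
    by_contra hne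
    exact h (blockDiagonal'_apply_ne (fun k => (K.v k).B * invSqrt (K.R k) * K.H k) a.2 i.2 hne)
  · have e : K.combined.B (Sum.inr a) i = (blockDiagonal'
        (fun k => (K.w k).B * invSqrt (K.Q k)) * K.bigG) a i := by
      simp [combined, PLQData.stack, bigQ, blockDiagonal'_mul]
    rw [e, mul_apply] at h
    obtain ⟨j, -, hj⟩ := Finset.exists_ne_zero_of_sum_ne_zero h
    have h1 : a.1 = j.1 := by
      by_contra hne
      exact left_ne_zero_of_mul hj
        (blockDiagonal'_apply_ne (fun k => (K.w k).B * invSqrt (K.Q k)) a.2 j.2 hne)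
    have h2 := right_ne_zero_of_mul hj
    simp only [bigG, of_apply] at h2
    split_ifs at h2 with h3 h4
    · exact Or.inl (h1.trans h3)
    · right
      change (a.1 : ℕ) = _
      rw [h1, h4]
    · exact absurd rfl h2

/-- A nonzero entry needs two rows of B joined by T⁻¹, hence of equal time, and this time exceeds
each of the two state times by 0 or 1. -/
theorem combined_redOmega_isBlockTridiagonal {p : IPPoint (Stack pv ⊕ Stack pw)
    (Stack fun _ : Fin N => n) (Stack lv ⊕ Stack lw)} (hT : IsUnit (K.combined.redT p)) :
    IsBlockTridiagonal (K.combined.redOmega p) := by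
  intro i j hij
  rw [PLQData.redOmega, mul_apply]
  refine Finset.sum_eq_zero fun b _ => ?_
  by_contra hne
  obtain ⟨a, -, ha⟩ := Finset.exists_ne_zero_of_sum_ne_zero
    (show ∑ a, K.combined.Bᵀ i a * (K.combined.redT p)⁻¹ a b ≠ 0 by
      rw [← mul_apply]; exact left_ne_zero_of_mul hne)
  have h1 := combined_B_ne_zero (right_ne_zero_of_mul hne)
  have h2 : timeOf a = i.1 ∨ (timeOf a : ℕ) = i.1 + 1 :=
    combined_B_ne_zero (K := K) (left_ne_zero_of_mul ha)
  have h3 : timeOf a = timeOf b := by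
    by_contra hab
    exact right_ne_zero_of_mul ha (inv_apply_eq_zero_of_blocks hT
      (fun _ _ => combined_redT_eq_zero) hab)
  rw [h3] at h2
  have h1' : (timeOf b : ℕ) = j.1 ∨ (timeOf b : ℕ) = j.1 + 1 := h1.imp_left (congrArg Fin.val)
  have h2' : (timeOf b : ℕ) = i.1 ∨ (timeOf b : ℕ) = i.1 + 1 := h2.imp_left (congrArg Fin.val)
  omega

end KalmanModel

/-! ### Optimality and convergence for the smoothing problem. -/

namespace KalmanModel

variable {N n m : ℕ} {pw pv lw lv : Fin N → ℕ} {K : KalmanModel N n m pw pv lw lv}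

theorem HasPLQNoise.isMinOn_of_isKKT (hK : K.HasPLQNoise) (hN : K.NullSpaceCondition)
    {p : IPPoint (Stack pv ⊕ Stack pw) (Stack fun _ : Fin N => n) (Stack lv ⊕ Stack lw)}
    (hp : K.combined.IsKKT p) :
    K.objective p.2.2.2 < ⊤ ∧ IsMinOn K.objective Set.univ p.2.2.2 ∧
      IsMaxOn K.posterior Set.univ p.2.2.2 := by
  have hM := (hK.combined_regular hN).posSemidef
  have hfin : K.objective p.2.2.2 < ⊤ := by
    rw [objective_eq_rho]
    exact hp.rho_lt_top hM
  have hmin : ∀ y, K.objective p.2.2.2 ≤ K.objective y := fun y => by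
    rw [objective_eq_rho, objective_eq_rho]
    exact hp.rho_le hM y
  exact ⟨hfin, fun y _ => hmin y, fun y _ => hK.posterior_le hfin (hmin y)⟩

theorem HasPLQNoise.interior_point_converges (hK : K.HasPLQNoise) (hN : K.NullSpaceCondition)
    {p₀ : IPPoint (Stack pv ⊕ Stack pw) (Stack fun _ : Fin N => n) (Stack lv ⊕ Stack lw)}
    (hp₀ : p₀ ∈ K.combined.strictlyFeasible) {σ : ℝ} (hσ : σ ∈ Set.Ioo (0 : ℝ) 1) :
    ∃ t₀ ∈ Set.Ioc (0 : ℝ) 1, ∀ t ∈ Set.Ioc 0 t₀,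
      let p : ℕ → IPPoint (Stack pv ⊕ Stack pw) (Stack fun _ : Fin N => n)
        (Stack lv ⊕ Stack lw) := fun j => (K.combined.ipIteration σ t)^[j] p₀
      (∀ j, p j ∈ K.combined.strictlyFeasible) ∧
      Tendsto (fun j => PLQData.gap (p j)) atTop (𝓝 0) ∧
      Tendsto (fun j => K.objective (p j).2.2.2) atTop (𝓝 (⨅ x, K.objective x)) ∧
      Bornology.IsBounded (Set.range p) ∧
      (∃ p', MapClusterPt p' atTop p) ∧
      ∀ p', MapClusterPt p' atTop p →
        K.combined.IsKKT p' ∧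
        K.objective p'.2.2.2 < ⊤ ∧
        IsMinOn K.objective Set.univ p'.2.2.2 ∧
        IsMaxOn K.posterior Set.univ p'.2.2.2 := by
  have hP := hK.combined_regular hN
  obtain ⟨t₀, ht₀, h⟩ := hP.exists_ipIteration_converges hp₀ hσ
  refine ⟨t₀, ht₀, fun t ht => ?_⟩
  obtain ⟨hfeas, hgap, hbdd⟩ := h t ht
  refine ⟨hfeas, hgap, ?_, hbdd, ?_, fun p' hp' => ?_⟩
  · have e : K.objective = K.combined.rho := funext K.objective_eq_rho
    rw [e]
    exact PLQData.tendsto_rho_of_gap hP.posSemidef hfeas hgap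
  · obtain ⟨p', -, hp'⟩ := hbdd.isCompact_closure.exists_mapClusterPt (f := atTop)
      (u := fun j => (K.combined.ipIteration σ t)^[j] p₀)
      (Filter.le_principal_iff.2 (Filter.mem_map.2 (Eventually.of_forall fun j =>
        subset_closure (Set.mem_range_self j))))
    exact ⟨p', hp'⟩
  · have hkkt := PLQData.isKKT_of_mapClusterPt hfeas hgap hp'
    exact ⟨hkkt, hK.isMinOn_of_isKKT hN hkkt⟩

/-- Attainment is a by-product of convergence: the run with σ = 1/2 has a cluster point, and its
state component is a minimizer. -/
theorem HasPLQNoise.exists_isMinOn (hK : K.HasPLQNoise) (hN : K.NullSpaceCondition)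
    (hne : K.combined.strictlyFeasible.Nonempty) :
    ∃ x, K.objective x < ⊤ ∧ IsMinOn K.objective Set.univ x := by
  obtain ⟨p₀, hp₀⟩ := hne
  obtain ⟨t₀, ht₀, h⟩ := hK.interior_point_converges hN hp₀ (σ := 1 / 2) (by norm_num)
  obtain ⟨-, -, -, -, ⟨p', hp'⟩, h'⟩ := h t₀ ⟨ht₀.1, le_rfl⟩
  exact ⟨_, (h' p' hp').2.1, (h' p' hp').2.2.1⟩

end KalmanModel

/-! ## Composition of straight-line programs -/

section Programs

variable {D : Type*} {I J O O₁ O₂ S S' : Set (D → ℝ)} {T T₁ T₂ t t' : ℕ}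

theorem Computes.trans (h : Computes I t S) (h' : Computes S t' S') :
    Computes I (t + t') S' := by
  induction h' with
  | start => exact h
  | const r _ ih => exact ih.const r
  | add hf hg _ ih => exact ih.add hf hg
  | sub hf hg _ ih => exact ih.sub hf hg
  | mul hf hg _ ih => exact ih.mul hf hg
  | div hf hg h0 _ ih => exact ih.div hf hg h0

theorem Computes.subset (h : Computes I t S) : I ⊆ S := by
  induction h with
  | start => exact Set.Subset.rfl
  | const r _ ih => exact ih.trans (Set.subset_insert _ _)
  | add hf hg _ ih => exact ih.trans (Set.subset_insert _ _)
  | sub hf hg _ ih => exact ih.trans (Set.subset_insert _ _)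
  | mul hf hg _ ih => exact ih.trans (Set.subset_insert _ _)
  | div hf hg h0 _ ih => exact ih.trans (Set.subset_insert _ _)

/-- Unused extra values can be carried along; this yields monotonicity in the inputs and hence
composition of programs. -/
theorem Computes.union_left (J : Set (D → ℝ)) (h : Computes I t S) :
    Computes (J ∪ I) t (J ∪ S) := by
  induction h with
  | start => exact .start
  | const r _ ih => rw [Set.union_insert]; exact ih.const r
  | add hf hg _ ih => rw [Set.union_insert]; exact ih.add (Or.inr hf) (Or.inr hg)
  | sub hf hg _ ih => rw [Set.union_insert]; exact ih.sub (Or.inr hf) (Or.inr hg)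
  | mul hf hg _ ih => rw [Set.union_insert]; exact ih.mul (Or.inr hf) (Or.inr hg)
  | div hf hg h0 _ ih => rw [Set.union_insert]; exact ih.div (Or.inr hf) (Or.inr hg) h0

namespace ComputableWithin

theorem of_subset (h : O ⊆ I) : ComputableWithin I O T :=
  ⟨0, Nat.zero_le _, I, .start, h⟩

theorem mono (h : ComputableWithin I O T₁) (hI : I ⊆ J) (hO : O₁ ⊆ O) (hT : T₁ ≤ T₂) :
    ComputableWithin J O₁ T₂ := by
  obtain ⟨t, ht, S, hS, hOS⟩ := h
  have := hS.union_left J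
  rw [Set.union_eq_self_of_subset_right hI] at this
  exact ⟨t, ht.trans hT, _, this, hO.trans (hOS.trans Set.subset_union_right)⟩

/-- Sequential composition. -/
theorem bind (h : ComputableWithin I O₁ T₁)
    (h' : ∀ J, I ⊆ J → O₁ ⊆ J → ComputableWithin J O₂ T₂) :
    ComputableWithin I (O₁ ∪ O₂) (T₁ + T₂) := by
  obtain ⟨t, ht, S, hS, hOS⟩ := h
  obtain ⟨t', ht', S', hS', hOS'⟩ := h' S hS.subset hOS
  exact ⟨t + t', add_le_add ht ht', S', hS.trans hS',
    Set.union_subset (hOS.trans hS'.subset) hOS'⟩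

theorem bind' (h : ComputableWithin I O₁ T₁)
    (h' : ∀ J, I ⊆ J → O₁ ⊆ J → ComputableWithin J O₂ T₂) :
    ComputableWithin I O₂ (T₁ + T₂) :=
  (h.bind h').mono Set.Subset.rfl Set.subset_union_right le_rfl

theorem union (h₁ : ComputableWithin I O₁ T₁) (h₂ : ComputableWithin I O₂ T₂) :
    ComputableWithin I (O₁ ∪ O₂) (T₁ + T₂) :=
  h₁.bind fun _ hJ _ => h₂.mono hJ Set.Subset.rfl le_rfl

theorem biUnion {ι : Type*} {O : ι → Set (D → ℝ)} {T : ι → ℕ} (s : Finset ι)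
    (h : ∀ i ∈ s, ComputableWithin I (O i) (T i)) :
    ComputableWithin I (⋃ i ∈ s, O i) (∑ i ∈ s, T i) := by
  classical
  induction s using Finset.induction_on with
  | empty => exact of_subset (by simp)
  | insert a s ha ih =>
    rw [Finset.sum_insert ha, Finset.set_biUnion_insert]
    exact (h a (Finset.mem_insert_self a s)).union
      (ih fun i hi => h i (Finset.mem_insert_of_mem hi))

theorem iUnion {ι : Type*} [Fintype ι] {O : ι → Set (D → ℝ)} {T : ι → ℕ}
    (h : ∀ i, ComputableWithin I (O i) (T i)) :
    ComputableWithin I (⋃ i, O i) (∑ i, T i) := by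
  simpa using biUnion Finset.univ fun i _ => h i

theorem range {ι : Type*} [Fintype ι] {F : ι → D → ℝ} {T : ι → ℕ}
    (h : ∀ i, ComputableWithin I {F i} (T i)) :
    ComputableWithin I (Set.range F) (∑ i, T i) := by
  rw [← Set.iUnion_singleton_eq_range]
  exact iUnion h

theorem range_const {ι : Type*} [Fintype ι] {F : ι → D → ℝ}
    (h : ∀ i, ComputableWithin I {F i} T) :
    ComputableWithin I (Set.range F) (Fintype.card ι * T) := by
  simpa using range h

section Single

variable {f g : D → ℝ}

theorem const (r : ℚ) : ComputableWithin I {fun _ => (r : ℝ)} 1 :=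
  ⟨1, le_rfl, _, Computes.start.const r, by simp⟩

theorem add (hf : f ∈ I) (hg : g ∈ I) : ComputableWithin I {fun d => f d + g d} 1 :=
  ⟨1, le_rfl, _, Computes.start.add hf hg, by simp⟩

theorem sub (hf : f ∈ I) (hg : g ∈ I) : ComputableWithin I {fun d => f d - g d} 1 :=
  ⟨1, le_rfl, _, Computes.start.sub hf hg, by simp⟩

theorem mul (hf : f ∈ I) (hg : g ∈ I) : ComputableWithin I {fun d => f d * g d} 1 :=
  ⟨1, le_rfl, _, Computes.start.mul hf hg, by simp⟩

theorem div (hf : f ∈ I) (hg : g ∈ I) (h0 : ∀ d, g d ≠ 0) :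
    ComputableWithin I {fun d => f d / g d} 1 :=
  ⟨1, le_rfl, _, Computes.start.div hf hg h0, by simp⟩

/-- Each summand costs one addition besides its own computation; the final 1 pays for the constant 0
that starts the sum. -/
theorem sum {ι : Type*} {F : ι → D → ℝ} (s : Finset ι)
    (h : ∀ i ∈ s, ComputableWithin I {F i} T) :
    ComputableWithin I {fun d => ∑ i ∈ s, F i d} (s.card * (T + 1) + 1) := by
  classical
  induction s using Finset.induction_on with
  | empty => simpa using const (I := I) 0
  | insert a s ha ih =>
    have h1 := h a (Finset.mem_insert_self a s)
    have h2 := ih fun i hi => h i (Finset.mem_insert_of_mem hi)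
    have h3 := (h1.union h2).bind' fun J hJ hO =>
      add (I := J) (f := F a) (g := fun d => ∑ i ∈ s, F i d) (hO (by simp)) (hO (by simp))
    refine h3.mono Set.Subset.rfl ?_ ?_
    · simp [Finset.sum_insert ha]
    · rw [Finset.card_insert_of_notMem ha]
      linarith

theorem sum_mul {ι : Type*} {F G : ι → D → ℝ} (s : Finset ι) (hF : ∀ i ∈ s, F i ∈ I)
    (hG : ∀ i ∈ s, G i ∈ I) :
    ComputableWithin I {fun d => ∑ i ∈ s, F i d * G i d} (s.card * 2 + 1) :=
  sum s fun i hi => mul (hF i hi) (hG i hi)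

end Single

end ComputableWithin

/-! ### Inversion of positive definite matrices by bordering -/

section Inverse

theorem Matrix.PosDef.isUnit_det {ι : Type*} [Fintype ι] [DecidableEq ι] {X : Matrix ι ι ℝ}
    (h : X.PosDef) : IsUnit X.det :=
  (isUnit_iff_isUnit_det _).1 h.isUnit

theorem Matrix.PosDef.transpose_eq {ι : Type*} {X : Matrix ι ι ℝ} (h : X.PosDef) : Xᵀ = X :=
  by simpa [IsHermitian, conjTranspose_eq_transpose_of_trivial] using h.isHermitian

theorem Matrix.PosDef.real_dotProduct_mulVec_pos {ι : Type*} [Fintype ι] {X : Matrix ι ι ℝ}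
    (h : X.PosDef) {v : ι → ℝ} (hv : v ≠ 0) : 0 < v ⬝ᵥ (X *ᵥ v) := by
  simpa using h.dotProduct_mulVec_pos hv

variable {a : ℕ} (X : Matrix (Fin (a + 1)) (Fin (a + 1)) ℝ)

/-- The leading principal submatrix. -/
def Matrix.leading : Matrix (Fin a) (Fin a) ℝ := X.submatrix Fin.castSucc Fin.castSucc

/-- The vector `M⁻¹ b` for the leading principal submatrix `M` and the last column `b`. -/
def Matrix.borderSol : Fin a → ℝ := X.leading⁻¹ *ᵥ fun i => X i.castSucc (Fin.last a)

/-- The last pivot. -/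
def Matrix.lastPivot : ℝ :=
  X (Fin.last a) (Fin.last a) - ∑ i : Fin a, X i.castSucc (Fin.last a) * X.borderSol i

variable {X}

theorem Matrix.PosDef.leading (hX : X.PosDef) : X.leading.PosDef :=
  hX.submatrix (Fin.castSucc_injective a)

theorem Matrix.PosDef.leading_mulVec_borderSol (hX : X.PosDef) :
    X.leading *ᵥ X.borderSol = fun i => X i.castSucc (Fin.last a) := by
  rw [borderSol, mulVec_mulVec, mul_nonsing_inv _ hX.leading.isUnit_det, one_mulVec]

theorem Matrix.PosDef.last_row (hX : X.PosDef) (i : Fin a) :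
    X (Fin.last a) i.castSucc = X i.castSucc (Fin.last a) :=
  congrFun (congrFun hX.transpose_eq i.castSucc) (Fin.last a)

/-- The pivot is the value of the quadratic form at (-M⁻¹b, 1), where M is the leading submatrix and
b the rest of the last column. -/
theorem Matrix.PosDef.lastPivot_pos (hX : X.PosDef) : 0 < X.lastPivot := by
  set x : Fin (a + 1) → ℝ := Fin.snoc (fun i => -X.borderSol i) 1 with hx
  have hx0 : x ≠ 0 := fun h => by
    have := congrFun h (Fin.last a)
    simp [hx] at this
  have h := hX.real_dotProduct_mulVec_pos hx0
  have h1 : ∀ i : Fin a, (X *ᵥ x) i.castSucc = 0 := by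
    intro i
    have := congrFun hX.leading_mulVec_borderSol i
    simp only [mulVec, dotProduct, Matrix.leading, submatrix_apply] at this
    simp only [mulVec, dotProduct, Fin.sum_univ_castSucc, hx, Fin.snoc_castSucc, Fin.snoc_last,
      mul_neg, Finset.sum_neg_distrib, this]
    ring
  have h2 : (X *ᵥ x) (Fin.last a) = X.lastPivot := by
    simp only [mulVec, dotProduct, Fin.sum_univ_castSucc, hx, Fin.snoc_castSucc, Fin.snoc_last,
      mul_neg, Finset.sum_neg_distrib, hX.last_row, lastPivot]
    ring
  rw [dotProduct, Fin.sum_univ_castSucc] at h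
  have h3 : x (Fin.last a) = 1 := by simp [hx]
  simpa only [h1, h2, h3, mul_zero, Finset.sum_const_zero, zero_add, one_mul] using h

/-- The inverse of a positive definite matrix, in terms of the inverse of the leading principal
submatrix. -/
theorem Matrix.PosDef.inv_bordering (hX : X.PosDef) :
    (∀ i j : Fin a, X⁻¹ i.castSucc j.castSucc =
      X.leading⁻¹ i j + X.borderSol i * (X.borderSol j / X.lastPivot)) ∧
    (∀ i : Fin a, X⁻¹ i.castSucc (Fin.last a) = 0 - X.borderSol i / X.lastPivot) ∧
    (∀ j : Fin a, X⁻¹ (Fin.last a) j.castSucc = 0 - X.borderSol j / X.lastPivot) ∧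
    X⁻¹ (Fin.last a) (Fin.last a) = 1 / X.lastPivot := by
  set v := X.borderSol with hv
  set σ := X.lastPivot with hσ
  have hσ0 : σ ≠ 0 := hX.lastPivot_pos.ne'
  -- The entries, including `0 - v i / σ` and `v i * (v j / σ)`, have the form in which the
  -- straight-line program evaluates them. It is enough that Y is a right inverse.
  let Y : Matrix (Fin (a + 1)) (Fin (a + 1)) ℝ := of fun i j =>
    Fin.lastCases (Fin.lastCases (1 / σ) (fun j => 0 - v j / σ) j)
      (fun i => Fin.lastCases (0 - v i / σ) (fun j => X.leading⁻¹ i j + v i * (v j / σ)) j) i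
  have e1 : ∀ i : Fin a, ∑ k, X i.castSucc k.castSucc * v k = X i.castSucc (Fin.last a) :=
    fun i => congrFun hX.leading_mulVec_borderSol i
  have e2 : ∀ i j : Fin a, ∑ k : Fin a, X i.castSucc k.castSucc * X.leading⁻¹ k j =
      (1 : Matrix (Fin a) (Fin a) ℝ) i j := fun i j => by
    rw [← mul_nonsing_inv _ hX.leading.isUnit_det, mul_apply]
    rfl
  have e3 : ∀ j : Fin a, ∑ k : Fin a, X k.castSucc (Fin.last a) * X.leading⁻¹ k j = v j := by
    intro j
    rw [hv, borderSol, mulVec, dotProduct]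
    refine Finset.sum_congr rfl fun k _ => ?_
    rw [mul_comm, show X.leading⁻¹ k j = X.leading⁻¹ j k from
      congrFun (congrFun hX.leading.inv.transpose_eq j) k]
  have e4 : ∑ k : Fin a, X k.castSucc (Fin.last a) * v k =
      X (Fin.last a) (Fin.last a) - σ := by
    rw [hσ, lastPivot]
    ring
  have e5 : ∀ i : Fin a, ∑ k : Fin a, X i.castSucc k.castSucc * (v k / σ) =
      X i.castSucc (Fin.last a) / σ := fun i => by
    rw [← e1 i, Finset.sum_div]
    exact Finset.sum_congr rfl fun k _ => by ring
  have e6 : ∑ k : Fin a, X k.castSucc (Fin.last a) * (v k / σ) =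
      (X (Fin.last a) (Fin.last a) - σ) / σ := by
    rw [← e4, Finset.sum_div]
    exact Finset.sum_congr rfl fun k _ => by ring
  have hXY : X * Y = 1 := by
    ext i j
    rw [mul_apply, Fin.sum_univ_castSucc]
    induction i using Fin.lastCases with
    | last =>
      induction j using Fin.lastCases with
      | last =>
        simp only [Y, of_apply, Fin.lastCases_last, Fin.lastCases_castSucc, hX.last_row, zero_sub,
          mul_neg, Finset.sum_neg_distrib, e6, one_apply_eq]
        field_simp
        ring
      | cast j =>
        simp only [Y, of_apply, Fin.lastCases_last, Fin.lastCases_castSucc, hX.last_row, zero_sub,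
          mul_neg, mul_add, Finset.sum_add_distrib, e3, ← mul_assoc,
          ← Finset.sum_mul, e4]
        rw [one_apply_ne (Fin.castSucc_ne_last j).symm]
        field_simp
        ring
    | cast i =>
      induction j using Fin.lastCases with
      | last =>
        simp only [Y, of_apply, Fin.lastCases_last, Fin.lastCases_castSucc, zero_sub,
          mul_neg, Finset.sum_neg_distrib, e5]
        rw [one_apply_ne (Fin.castSucc_ne_last i)]
        ring
      | cast j =>
        simp only [Y, of_apply, Fin.lastCases_last, Fin.lastCases_castSucc, zero_sub,
          mul_neg, mul_add, Finset.sum_add_distrib, e2, ← mul_assoc,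
          ← Finset.sum_mul, e1]
        rw [one_apply, one_apply]
        simp
  have hY : X⁻¹ = Y := inv_eq_right_inv hXY
  rw [hY]
  refine ⟨fun i j => ?_, fun i => ?_, fun j => ?_, ?_⟩ <;> simp [Y]

end Inverse

/-- Bordering extends the inverse of the leading submatrix with quadratically many operations, so
induction on the size gives a cubic total. All divisions are by `lastPivot`, which is positive at
every instance. -/
theorem ComputableWithin.inv {a : ℕ} {X : D → Matrix (Fin a) (Fin a) ℝ}
    (hX : ∀ d, (X d).PosDef) (hI : entries X ⊆ I) :
    ComputableWithin I (entries fun d => (X d)⁻¹) (15 * a ^ 3) := by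
  induction a generalizing I with
  | zero =>
    refine of_subset ?_
    rintro _ ⟨⟨i, j⟩, rfl⟩
    exact i.elim0
  | succ a ih =>
    have hXI : ∀ i j, (fun d => X d i j) ∈ I := fun i j => hI ⟨(i, j), rfl⟩
    have h1 : ComputableWithin I (entries fun d => (X d).leading⁻¹) (15 * a ^ 3) := by
      refine ih (fun d => (hX d).leading) ?_
      rintro _ ⟨⟨i, j⟩, rfl⟩
      exact hXI _ _
    have key : ComputableWithin I (entries fun d => (X d)⁻¹)
        (15 * a ^ 3 + (a * (a * 2 + 1) + ((a * 2 + 1) + (1 + (a + (2 + (a * 2 + (1 +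
          a * a * 2)))))))) := by
      refine h1.bind' fun J₁ hJ₁ h₁ => ?_
      have hM : ∀ i j, (fun d => (X d).leading⁻¹ i j) ∈ J₁ := fun i j => h₁ ⟨(i, j), rfl⟩
      have h2 : ComputableWithin J₁ (coords fun d => (X d).borderSol) (a * (a * 2 + 1)) := by
        have := range_const (I := J₁) (F := fun i d => (X d).borderSol i) (T := a * 2 + 1)
          fun i => (sum_mul Finset.univ (F := fun k d => (X d).leading⁻¹ i k)
            (G := fun k d => X d k.castSucc (Fin.last a)) (fun k _ => hM i k)
            (fun k _ => hJ₁ (hXI _ _))).mono Set.Subset.rfl Set.Subset.rfl (by simp)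
        rw [Fintype.card_fin] at this
        exact this
      refine h2.bind' fun J₂ hJ₂ h₂ => ?_
      have hv : ∀ i, (fun d => (X d).borderSol i) ∈ J₂ := fun i => h₂ ⟨i, rfl⟩
      have h3 := sum_mul (I := J₂) Finset.univ (F := fun k d => X d k.castSucc (Fin.last a))
        (G := fun k d => (X d).borderSol k) (fun k _ => hJ₂ (hJ₁ (hXI _ _))) (fun k _ => hv k)
      refine (h3.mono Set.Subset.rfl Set.Subset.rfl (T₂ := a * 2 + 1) (by simp)).bind'
        fun J₃ hJ₃ h₃ => ?_
      have h4 : ComputableWithin J₃ {fun d => (X d).lastPivot} 1 :=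
        sub (hJ₃ (hJ₂ (hJ₁ (hXI _ _)))) (h₃ rfl)
      refine h4.bind' fun J₄ hJ₄ h₄ => ?_
      have h5 : ComputableWithin J₄ (Set.range fun i d => (X d).borderSol i / (X d).lastPivot)
          a := by
        have := range_const (I := J₄) fun i => div (hJ₄ (hJ₃ (hv i)))
          (h₄ rfl) fun d => (hX d).lastPivot_pos.ne'
        simpa using this
      refine h5.bind' fun J₅ hJ₅ h₅ => ?_
      refine ((const 0).union (const 1)).bind' fun J₆ hJ₆ h₆ => ?_
      have hz : (fun _ : D => (0 : ℝ)) ∈ J₆ := h₆ (by simp)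
      have ho : (fun _ : D => (1 : ℝ)) ∈ J₆ := h₆ (by simp)
      have hw : ∀ i, (fun d => (X d).borderSol i / (X d).lastPivot) ∈ J₅ := fun i => h₅ ⟨i, rfl⟩
      have h7 : ComputableWithin J₆
          (Set.range fun i d => 0 - (X d).borderSol i / (X d).lastPivot) (a * 2) := by
        have := range_const (I := J₆) fun i => sub hz (hJ₆ (hw i))
        exact this.mono Set.Subset.rfl Set.Subset.rfl (by simp; omega)
      refine h7.bind' fun J₇ hJ₇ h₇ => ?_
      have h8 : ComputableWithin J₇ {fun d => 1 / (X d).lastPivot} 1 :=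
        div (hJ₇ ho) (hJ₇ (hJ₆ (hJ₅ (h₄ rfl)))) fun d => (hX d).lastPivot_pos.ne'
      refine h8.bind' fun J₈ hJ₈ h₈ => ?_
      have h9 : ComputableWithin J₈ (Set.range fun (ij : Fin a × Fin a) d =>
          (X d).leading⁻¹ ij.1 ij.2 +
            (X d).borderSol ij.1 * ((X d).borderSol ij.2 / (X d).lastPivot)) (a * a * 2) := by
        have := range_const (I := J₈) (T := 2) (F := fun (ij : Fin a × Fin a) d =>
          (X d).leading⁻¹ ij.1 ij.2 +
            (X d).borderSol ij.1 * ((X d).borderSol ij.2 / (X d).lastPivot)) fun ij =>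
          (mul (hJ₈ (hJ₇ (hJ₆ (hJ₅ (hJ₄ (hJ₃ (hv ij.1)))))))
            (hJ₈ (hJ₇ (hJ₆ (hw ij.2))))).bind' fun K hK hm =>
            add (hK (hJ₈ (hJ₇ (hJ₆ (hJ₅ (hJ₄ (hJ₃ (hJ₂ (hM ij.1 ij.2))))))))) (hm rfl)
        simpa using this
      -- The entries of the inverse stem from four stages of the program, so the values available
      -- before the last stage are kept as well.
      have h10 := h9.bind fun K hK _ => of_subset (T := 0) hK
      refine h10.mono Set.Subset.rfl ?_ le_rfl
      rintro _ ⟨⟨i, j⟩, rfl⟩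
      have hinv := fun d => (hX d).inv_bordering
      induction i using Fin.lastCases with
      | last =>
        induction j using Fin.lastCases with
        | last =>
          refine Or.inr (h₈ ?_)
          exact funext fun d => (hinv d).2.2.2
        | cast j =>
          refine Or.inr (hJ₈ (h₇ ⟨j, ?_⟩))
          exact funext fun d => ((hinv d).2.2.1 j).symm
      | cast i =>
        induction j using Fin.lastCases with
        | last =>
          refine Or.inr (hJ₈ (h₇ ⟨i, ?_⟩))
          exact funext fun d => ((hinv d).2.1 i).symm
        | cast j =>
          refine Or.inl ⟨(i, j), ?_⟩
          exact funext fun d => ((hinv d).1 i j).symm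
    -- The bordering step costs 4a² + 6a + 5, which is at most 15((a+1)³ - a³).
    refine key.mono Set.Subset.rfl Set.Subset.rfl ?_
    nlinarith

end Programs

/-! ### Costs as multiples of a unit -/

/-- `O` can be computed from `I` with at most `k * υ` operations. -/
def Cost {D : Type*} (υ : ℕ) (I O : Set (D → ℝ)) (k : ℕ) : Prop := ComputableWithin I O (k * υ)

namespace Cost

variable {D : Type*} {I J O O₁ O₂ : Set (D → ℝ)} {υ e k k' a b c : ℕ}

theorem of_subset (h : O ⊆ I) : Cost υ I O 0 := ComputableWithin.of_subset h

theorem mono_left (h : Cost υ I O k) (hI : I ⊆ J) : Cost υ J O k :=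
  ComputableWithin.mono h hI Set.Subset.rfl le_rfl

theorem subset (h : Cost υ I O k) (hO : O₁ ⊆ O) : Cost υ I O₁ k :=
  ComputableWithin.mono h Set.Subset.rfl hO le_rfl

theorem weaken (h : Cost υ I O k) (hk : k ≤ k') : Cost υ I O k' :=
  ComputableWithin.mono h Set.Subset.rfl Set.Subset.rfl (Nat.mul_le_mul_right _ hk)

theorem bind (h : Cost υ I O₁ k) (h' : ∀ J, I ⊆ J → O₁ ⊆ J → Cost υ J O₂ k') :
    Cost υ I (O₁ ∪ O₂) (k + k') := by
  have := ComputableWithin.bind h h'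
  rwa [← add_mul] at this

theorem bind' (h : Cost υ I O₁ k) (h' : ∀ J, I ⊆ J → O₁ ⊆ J → Cost υ J O₂ k') :
    Cost υ I O₂ (k + k') :=
  (h.bind h').subset Set.subset_union_right

theorem union (h₁ : Cost υ I O₁ k) (h₂ : Cost υ I O₂ k') : Cost υ I (O₁ ∪ O₂) (k + k') :=
  h₁.bind fun _ hJ _ => h₂.mono_left hJ

theorem iUnion_fin {N : ℕ} {O : Fin N → Set (D → ℝ)} (h : ∀ i, Cost υ I (O i) k) :
    Cost υ I (⋃ i, O i) (N * k) := by
  have := ComputableWithin.iUnion h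
  simpa [Cost, mul_assoc] using this

/-- One operation per entry, and at most υ entries, amount to a single unit. -/
theorem pointwise {ι : Type*} [Fintype ι] (hι : Fintype.card ι ≤ υ) {F G H : ι → D → ℝ}
    (hF : Cost υ I (Set.range F) k) (hG : Cost υ I (Set.range G) k')
    (h : ∀ (J : Set (D → ℝ)) i, F i ∈ J → G i ∈ J → ComputableWithin J {H i} 1) :
    Cost υ I (Set.range H) (k + k' + 1) := by
  refine (hF.union hG).bind' fun J _ hJ => ?_
  have := ComputableWithin.range_const (I := J) (F := H) fun i =>
    h J i (hJ (Or.inl ⟨i, rfl⟩)) (hJ (Or.inr ⟨i, rfl⟩))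
  exact this.mono Set.Subset.rfl Set.Subset.rfl (by simpa using hι)

theorem range_const {ι : Type*} [Fintype ι] (hι : Fintype.card ι ≤ υ) {r : ι → ℚ} :
    Cost υ I (Set.range fun i (_ : D) => (r i : ℝ)) 1 :=
  (ComputableWithin.range_const fun i => ComputableWithin.const (r i)).mono Set.Subset.rfl
    Set.Subset.rfl (by simpa using hι)

section Vectors

variable {f g : D → Fin a → ℝ}

theorem vec_zero (ha : a ≤ υ := by assumption) : Cost υ I (coords fun _ => (0 : Fin a → ℝ)) 1 := by
  have := range_const (I := I) (υ := υ) (ι := Fin a) (by simpa using ha) (r := fun _ => 0)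
  simpa [coords] using this

theorem vec_add (hf : Cost υ I (coords f) k) (hg : Cost υ I (coords g) k')
    (ha : a ≤ υ := by assumption) : Cost υ I (coords fun d => f d + g d) (k + k' + 1) :=
  pointwise (by simpa using ha) hf hg fun _ _ h h' => ComputableWithin.add h h'

theorem vec_sub (hf : Cost υ I (coords f) k) (hg : Cost υ I (coords g) k')
    (ha : a ≤ υ := by assumption) : Cost υ I (coords fun d => f d - g d) (k + k' + 1) :=
  pointwise (by simpa using ha) hf hg fun _ _ h h' => ComputableWithin.sub h h'

theorem vec_mul (hf : Cost υ I (coords f) k) (hg : Cost υ I (coords g) k')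
    (ha : a ≤ υ := by assumption) : Cost υ I (coords fun d => f d * g d) (k + k' + 1) :=
  pointwise (by simpa using ha) hf hg fun _ _ h h' => ComputableWithin.mul h h'

theorem vec_div (h0 : ∀ d i, g d i ≠ 0) (hf : Cost υ I (coords f) k)
    (hg : Cost υ I (coords g) k') (ha : a ≤ υ := by assumption) :
    Cost υ I (coords fun d => f d / g d) (k + k' + 1) :=
  pointwise (by simpa using ha) hf hg fun _ i h h' => ComputableWithin.div h h' fun d => h0 d i

theorem vec_neg (hf : Cost υ I (coords f) k) (ha : a ≤ υ := by assumption) :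
    Cost υ I (coords fun d => -f d) (k + 2) := by
  have := (vec_zero (I := I) ha).vec_sub hf
  simp only [zero_sub] at this
  exact this.weaken (by omega)

theorem vec_smul {t : D → ℝ} (ht : t ∈ I) (hf : Cost υ I (coords f) k)
    (ha : a ≤ υ := by assumption) : Cost υ I (coords fun d => t d • f d) (k + 1) := by
  refine hf.bind' fun J hIJ hJ => ?_
  have := ComputableWithin.range_const (I := J) fun i =>
    ComputableWithin.mul (hIJ ht) (hJ (Set.mem_range_self i))
  exact this.mono Set.Subset.rfl Set.Subset.rfl (by simpa using ha)

theorem vec_const {t : D → ℝ} (ht : t ∈ I) : Cost υ I (coords fun d (_ : Fin a) => t d) 0 :=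
  of_subset (by rintro _ ⟨i, rfl⟩; exact ht)

end Vectors

section Matrices

variable {f : D → Matrix (Fin a) (Fin b) ℝ} {g : D → Matrix (Fin b) (Fin c) ℝ}

theorem mul_le_of_cube_le (he : e ^ 3 ≤ υ) (ha : a ≤ e) (hb : b ≤ e) : a * b ≤ υ := by
  refine le_trans ?_ he
  rcases Nat.eq_zero_or_pos e with rfl | h
  · simp [Nat.le_zero.1 ha]
  · calc a * b ≤ e * e := Nat.mul_le_mul ha hb
      _ ≤ e * e * e := Nat.le_mul_of_pos_right _ h
      _ = e ^ 3 := by ring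

theorem mul_mul_le_of_cube_le (he : e ^ 3 ≤ υ) (ha : a ≤ e) (hb : b ≤ e) (hc : c ≤ e) :
    a * b * c ≤ υ := by
  refine le_trans ?_ he
  calc a * b * c ≤ e * e * e := Nat.mul_le_mul (Nat.mul_le_mul ha hb) hc
    _ = e ^ 3 := by ring

theorem le_of_cube_le (he : e ^ 3 ≤ υ) (ha : a ≤ e) : a ≤ υ :=
  (ha.trans (Nat.le_self_pow (by norm_num) e)).trans he

theorem mat_transpose (hf : Cost υ I (entries f) k) : Cost υ I (entries fun d => (f d)ᵀ) k :=
  hf.subset (by rintro _ ⟨⟨i, j⟩, rfl⟩; exact ⟨(j, i), rfl⟩)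

theorem mat_mul (he : e ^ 3 ≤ υ) (hf : Cost υ I (entries f) k) (hg : Cost υ I (entries g) k')
    (ha : a ≤ e := by assumption) (hb : b ≤ e := by assumption) (hc : c ≤ e := by assumption) :
    Cost υ I (entries fun d => f d * g d) (k + k' + 3) := by
  refine (hf.union hg).bind' fun J _ hJ => ?_
  have := ComputableWithin.range_const (I := J) (F := fun (ij : Fin a × Fin c) d =>
    ∑ j, f d ij.1 j * g d j ij.2) fun ij => ComputableWithin.sum_mul Finset.univ
      (fun j _ => hJ (Or.inl ⟨(ij.1, j), rfl⟩)) (fun j _ => hJ (Or.inr ⟨(j, ij.2), rfl⟩))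
  refine this.mono Set.Subset.rfl ?_ ?_
  · rintro _ ⟨ij, rfl⟩
    exact ⟨ij, rfl⟩
  -- The ac inner products of length b cost 2abc + ac operations, and both abc and ac are at most υ.
  · have h1 := mul_mul_le_of_cube_le he ha hc hb
    have h2 := mul_le_of_cube_le he ha hc
    simp only [Fintype.card_prod, Fintype.card_fin, Finset.card_univ]
    nlinarith

theorem mat_mulVec (he : e ^ 3 ≤ υ) {v : D → Fin b → ℝ} (hf : Cost υ I (entries f) k)
    (hg : Cost υ I (coords v) k') (ha : a ≤ e := by assumption) (hb : b ≤ e := by assumption) :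
    Cost υ I (coords fun d => f d *ᵥ v d) (k + k' + 3) := by
  refine (hf.union hg).bind' fun J _ hJ => ?_
  have := ComputableWithin.range_const (I := J) (F := fun (i : Fin a) d =>
    ∑ j, f d i j * v d j) fun i => ComputableWithin.sum_mul Finset.univ
      (fun j _ => hJ (Or.inl ⟨(i, j), rfl⟩)) (fun j _ => hJ (Or.inr ⟨j, rfl⟩))
  refine this.mono Set.Subset.rfl Set.Subset.rfl ?_
  have h1 := mul_le_of_cube_le he ha hb
  have h2 := le_of_cube_le he ha
  simp only [Fintype.card_fin, Finset.card_univ]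
  nlinarith

theorem mat_add (he : e ^ 3 ≤ υ) {g : D → Matrix (Fin a) (Fin b) ℝ}
    (hf : Cost υ I (entries f) k) (hg : Cost υ I (entries g) k')
    (ha : a ≤ e := by assumption) (hb : b ≤ e := by assumption) :
    Cost υ I (entries fun d => f d + g d) (k + k' + 1) :=
  pointwise (by simpa using mul_le_of_cube_le he ha hb) hf hg
    fun _ _ h h' => ComputableWithin.add h h'

theorem mat_sub (he : e ^ 3 ≤ υ) {g : D → Matrix (Fin a) (Fin b) ℝ}
    (hf : Cost υ I (entries f) k) (hg : Cost υ I (entries g) k')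
    (ha : a ≤ e := by assumption) (hb : b ≤ e := by assumption) :
    Cost υ I (entries fun d => f d - g d) (k + k' + 1) :=
  pointwise (by simpa using mul_le_of_cube_le he ha hb) hf hg
    fun _ _ h h' => ComputableWithin.sub h h'

theorem mat_zero (he : e ^ 3 ≤ υ) (ha : a ≤ e := by assumption) (hb : b ≤ e := by assumption) :
    Cost υ I (entries fun _ => (0 : Matrix (Fin a) (Fin b) ℝ)) 1 := by
  have := range_const (I := I) (υ := υ) (ι := Fin a × Fin b)
    (by simpa using mul_le_of_cube_le he ha hb) (r := fun _ => 0)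
  simpa [entries] using this

theorem mat_one (he : e ^ 3 ≤ υ) (ha : a ≤ e := by assumption) :
    Cost υ I (entries fun _ => (1 : Matrix (Fin a) (Fin a) ℝ)) 1 := by
  have := range_const (I := I) (υ := υ) (ι := Fin a × Fin a)
    (by simpa using mul_le_of_cube_le he ha ha) (r := fun ij => if ij.1 = ij.2 then 1 else 0)
  simpa [entries, one_apply, apply_ite] using this

theorem mat_inv (he : e ^ 3 ≤ υ) {f : D → Matrix (Fin a) (Fin a) ℝ} (hf0 : ∀ d, (f d).PosDef)
    (hf : Cost υ I (entries f) k) (ha : a ≤ e := by assumption) :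
    Cost υ I (entries fun d => (f d)⁻¹) (k + 15) :=
  hf.bind' fun _ _ hJ => (ComputableWithin.inv hf0 hJ).mono Set.Subset.rfl Set.Subset.rfl
    (Nat.mul_le_mul_left _ ((Nat.pow_le_pow_left ha 3).trans he))

end Matrices

/-! ### Sparse matrices -/

section Sparse

variable {A : D → Matrix (Fin a) (Fin c) ℝ} {S : Fin c → Finset (Fin a)}

theorem sum_card_filter (S : Fin c → Finset (Fin a)) :
    ∑ i, (Finset.univ.filter fun j => i ∈ S j).card = ∑ j, (S j).card := by
  simp only [Finset.card_filter]
  rw [Finset.sum_comm]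
  simp

/-- Double counting: column j contributes to the entries of A D Aᵀ with both indices in its pattern,
which are |Sⱼ|² in number. -/
theorem sum_card_filter_pair (S : Fin c → Finset (Fin a)) :
    ∑ i : Fin a × Fin a, (Finset.univ.filter fun j => i.1 ∈ S j ∧ i.2 ∈ S j).card =
      ∑ j, (S j).card ^ 2 := by
  simp only [Finset.card_filter]
  rw [Finset.sum_comm]
  refine Finset.sum_congr rfl fun j _ => ?_
  rw [← Finset.card_filter, sq, ← Finset.card_product]
  congr 1
  ext i
  simp

theorem sum_card_le (S : Fin c → Finset (Fin a)) : ∑ j, (S j).card ≤ ∑ j, (S j).card ^ 2 :=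
  Finset.sum_le_sum fun j _ => Nat.le_self_pow (by norm_num) _

/-- The sums run only over the prescribed positions, which costs 2Σ|Sⱼ| + a operations. -/
theorem sparse_mulVec (hA : ∀ d i j, A d i j ≠ 0 → i ∈ S j) {q : D → Fin c → ℝ}
    (hf : Cost υ I (entries A) k) (hq : Cost υ I (coords q) k')
    (hS : ∑ j, (S j).card ^ 2 ≤ υ := by assumption) (ha : a ≤ υ := by assumption) :
    Cost υ I (coords fun d => A d *ᵥ q d) (k + k' + 3) := by
  refine (hf.union hq).bind' fun J _ hJ => ?_
  have := ComputableWithin.range (I := J) (F := fun (i : Fin a) d =>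
    ∑ j ∈ Finset.univ.filter (fun j => i ∈ S j), A d i j * q d j) fun i =>
      ComputableWithin.sum_mul _ (fun j _ => hJ (Or.inl ⟨(i, j), rfl⟩))
        (fun j _ => hJ (Or.inr ⟨j, rfl⟩))
  refine this.mono Set.Subset.rfl ?_ ?_
  · rintro _ ⟨i, rfl⟩
    refine ⟨i, funext fun d => Finset.sum_subset (Finset.subset_univ _) fun j _ hj => ?_⟩
    have : A d i j = 0 := by
      by_contra h
      exact hj (by simpa using hA d i j h)
    rw [this, zero_mul]
  · rw [Finset.sum_add_distrib, ← Finset.sum_mul, sum_card_filter]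
    have := sum_card_le S
    simp only [Finset.sum_const, Finset.card_univ, Fintype.card_fin, smul_eq_mul, mul_one]
    omega

theorem sparse_transpose_mulVec (hA : ∀ d i j, A d i j ≠ 0 → i ∈ S j) {w : D → Fin a → ℝ}
    (hf : Cost υ I (entries A) k) (hw : Cost υ I (coords w) k')
    (hS : ∑ j, (S j).card ^ 2 ≤ υ := by assumption) (hc : c ≤ υ := by assumption) :
    Cost υ I (coords fun d => (A d)ᵀ *ᵥ w d) (k + k' + 3) := by
  refine (hf.union hw).bind' fun J _ hJ => ?_
  have := ComputableWithin.range (I := J) (F := fun (j : Fin c) d =>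
    ∑ i ∈ S j, A d i j * w d i) fun j =>
      ComputableWithin.sum_mul _ (fun i _ => hJ (Or.inl ⟨(i, j), rfl⟩))
        (fun i _ => hJ (Or.inr ⟨i, rfl⟩))
  refine this.mono Set.Subset.rfl ?_ ?_
  · rintro _ ⟨j, rfl⟩
    refine ⟨j, funext fun d => Finset.sum_subset (Finset.subset_univ _) fun i _ hi => ?_⟩
    have : A d i j = 0 := by
      by_contra h
      exact hi (hA d i j h)
    rw [this, zero_mul]
  · rw [Finset.sum_add_distrib, ← Finset.sum_mul]
    have := sum_card_le S
    simp only [Finset.sum_const, Finset.card_univ, Fintype.card_fin, smul_eq_mul, mul_one]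
    omega

/-- The sums over the pairs of pattern positions cost 3Σ|Sⱼ|² + a² operations. This is the source of
the factor κ² in the final bound. -/
theorem sparse_gram (he : e ^ 3 ≤ υ) (hA : ∀ d i j, A d i j ≠ 0 → i ∈ S j) {w : D → Fin c → ℝ}
    (hf : Cost υ I (entries A) k) (hw : Cost υ I (coords w) k')
    (hS : ∑ j, (S j).card ^ 2 ≤ υ := by assumption) (ha : a ≤ e := by assumption) :
    Cost υ I (entries fun d => A d * diagonal (w d) * (A d)ᵀ) (k + k' + 4) := by
  refine (hf.union hw).bind' fun J _ hJ => ?_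
  have := ComputableWithin.range (I := J) (F := fun (i : Fin a × Fin a) d =>
    ∑ j ∈ Finset.univ.filter (fun j => i.1 ∈ S j ∧ i.2 ∈ S j), A d i.1 j * w d j * A d i.2 j)
    fun i => ComputableWithin.sum (T := 2) _ fun j _ =>
      (ComputableWithin.mul (hJ (Or.inl ⟨(i.1, j), rfl⟩)) (hJ (Or.inr ⟨j, rfl⟩))).bind'
        fun K hK hm => ComputableWithin.mul (hm rfl) (hK (hJ (Or.inl ⟨(i.2, j), rfl⟩)))
  refine this.mono Set.Subset.rfl ?_ ?_
  · rintro _ ⟨i, rfl⟩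
    refine ⟨i, funext fun d => ?_⟩
    change _ = (A d * diagonal (w d) * (A d)ᵀ) i.1 i.2
    rw [mul_apply]
    simp only [mul_diagonal, transpose_apply]
    refine Finset.sum_subset (Finset.subset_univ _) fun j _ hj => ?_
    by_contra h
    refine hj (Finset.mem_filter.2 ⟨Finset.mem_univ _, hA d _ _ ?_, hA d _ _ ?_⟩)
    · exact left_ne_zero_of_mul (left_ne_zero_of_mul h)
    · exact right_ne_zero_of_mul h
  · rw [Finset.sum_add_distrib, ← Finset.sum_mul, sum_card_filter_pair]
    have := mul_le_of_cube_le he ha ha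
    simp only [Finset.sum_const, Finset.card_univ, Fintype.card_prod, Fintype.card_fin,
      smul_eq_mul, mul_one]
    omega

end Sparse

end Cost

/-! ## Forward elimination for the block tridiagonal system -/

section Smoother

variable {n : ℕ}

theorem Matrix.PosSemidef.transpose_mul_mul {ι κ : Type*} [Fintype ι] [Fintype κ]
    {X : Matrix ι ι ℝ} (hX : X.PosSemidef) (Y : Matrix ι κ ℝ) : (Yᵀ * X * Y).PosSemidef := by
  simpa [conjTranspose_eq_transpose_of_trivial] using hX.conjTranspose_mul_mul_same Y

theorem Matrix.PosDef.transpose_mul_mul {ι κ : Type*} [Fintype ι] [Fintype κ]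
    {X : Matrix ι ι ℝ} (hX : X.PosDef) {Y : Matrix ι κ ℝ}
    (hY : Function.Injective fun y => Y *ᵥ y) : (Yᵀ * X * Y).PosDef := by
  simpa [conjTranspose_eq_transpose_of_trivial] using hX.conjTranspose_mul_mul_same hY

/-- The covariance update of the information filter preserves positive definiteness. -/
theorem Matrix.PosDef.schur_update {F E : Matrix (Fin n) (Fin n) ℝ} (hF : F.PosDef)
    (hE : E.PosDef) (G : Matrix (Fin n) (Fin n) ℝ) :
    (E - E * G * (F + Gᵀ * E * G)⁻¹ * (Gᵀ * E)).PosDef := by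
  have hS : (F + Gᵀ * E * G).PosDef := hF.add_posSemidef (hE.posSemidef.transpose_mul_mul G)
  set S := F + Gᵀ * E * G with hSdef
  set L := S⁻¹ * (Gᵀ * E) with hL
  have hSL : S * L = Gᵀ * E := by
    rw [hL, ← Matrix.mul_assoc, mul_nonsing_inv _ hS.isUnit_det, Matrix.one_mul]
  clear_value L S
  have hLt : Lᵀ * S = E * G := by
    have := congrArg Matrix.transpose hSL
    simpa [transpose_mul, hS.transpose_eq, hE.transpose_eq] using this
  -- The Joseph form of the update, with L = S⁻¹GᵀE, displays it as a sum of two positive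
  -- semidefinite matrices.
  have e : E - E * G * S⁻¹ * (Gᵀ * E) = Lᵀ * F * L + (1 - G * L)ᵀ * E * (1 - G * L) := by
    have h1 : E * G * S⁻¹ * (Gᵀ * E) = E * G * L := by rw [hL]; simp only [Matrix.mul_assoc]
    have h2 : F = S - Gᵀ * E * G := by rw [hSdef]; abel
    have h3 : Lᵀ * S * L = E * G * L := by rw [hLt]
    have h4 : Lᵀ * Gᵀ * E = E * G * L := by
      rw [Matrix.mul_assoc, ← hSL, ← Matrix.mul_assoc, h3]
    rw [h1, h2, transpose_sub, transpose_one, transpose_mul]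
    simp only [Matrix.mul_sub, Matrix.sub_mul, Matrix.one_mul, Matrix.mul_one, h3]
    rw [h4]
    simp only [← Matrix.mul_assoc, h4]
    abel
  rw [e]
  refine PosDef.of_dotProduct_mulVec_pos ?_ fun x hx => ?_
  · exact ((hF.posSemidef.transpose_mul_mul L).add
      (hE.posSemidef.transpose_mul_mul (1 - G * L))).isHermitian
  · have h : star x ⬝ᵥ ((Lᵀ * F * L + (1 - G * L)ᵀ * E * (1 - G * L)) *ᵥ x) =
        (L *ᵥ x) ⬝ᵥ (F *ᵥ (L *ᵥ x)) +
          ((1 - G * L) *ᵥ x) ⬝ᵥ (E *ᵥ ((1 - G * L) *ᵥ x)) := by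
      rw [star_trivial, add_mulVec, dotProduct_add]
      simp only [Matrix.mul_assoc, ← mulVec_mulVec]
      rw [dotProduct_mulVec_eq_transpose_mulVec_dotProduct Lᵀ,
        dotProduct_mulVec_eq_transpose_mulVec_dotProduct (1 - G * L)ᵀ, transpose_transpose,
        transpose_transpose]
    rw [h]
    -- If Lx ≠ 0 the first term is positive; otherwise (1 - GL)x = x and the second one is.
    by_cases hx' : L *ᵥ x = 0
    · have : (1 - G * L) *ᵥ x = x := by
        rw [sub_mulVec, ← mulVec_mulVec, hx', mulVec_zero, one_mulVec, sub_zero]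
      rw [hx', this, zero_dotProduct, zero_add]
      exact hE.real_dotProduct_mulVec_pos hx
    · exact add_pos_of_pos_of_nonneg (hF.real_dotProduct_mulVec_pos hx')
        (hE.posSemidef.real_dotProduct_mulVec_nonneg _)

variable (C E G : ℕ → Matrix (Fin n) (Fin n) ℝ) (r : ℕ → Fin n → ℝ)

/-- The information matrices of the forward recursion. -/
def filterInfo : ℕ → Matrix (Fin n) (Fin n) ℝ
  | 0 => C 0 + E 0
  | k + 1 => C (k + 1) + (E (k + 1) - E (k + 1) * G (k + 1) *
      (filterInfo k + (G (k + 1))ᵀ * E (k + 1) * G (k + 1))⁻¹ * ((G (k + 1))ᵀ * E (k + 1)))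

/-- The pivots of the block elimination. -/
def filterPivot (k : ℕ) : Matrix (Fin n) (Fin n) ℝ :=
  filterInfo C E G k + (G (k + 1))ᵀ * E (k + 1) * G (k + 1)

/-- The right-hand sides of the forward recursion. -/
def filterVec : ℕ → Fin n → ℝ
  | 0 => r 0
  | k + 1 => r (k + 1) +
      E (k + 1) *ᵥ (G (k + 1) *ᵥ ((filterPivot C E G k)⁻¹ *ᵥ filterVec k))

variable {C E G r}

theorem filterInfo_posDef (hC : ∀ k, (C k).PosSemidef) (hE : ∀ k, (E k).PosDef) (k : ℕ) :
    (filterInfo C E G k).PosDef := by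
  induction k with
  | zero => exact PosDef.posSemidef_add (hC 0) (hE 0)
  | succ k ih => exact PosDef.posSemidef_add (hC _) (ih.schur_update (hE _) _)

theorem filterPivot_posDef (hC : ∀ k, (C k).PosSemidef) (hE : ∀ k, (E k).PosDef) (k : ℕ) :
    (filterPivot C E G k).PosDef :=
  (filterInfo_posDef hC hE k).add_posSemidef ((hE _).posSemidef.transpose_mul_mul _)

/-- The back substitution formula for the solutions of the block tridiagonal system. -/
theorem eq_filterPivot_inv_mulVec (hC : ∀ k, (C k).PosSemidef) (hE : ∀ k, (E k).PosDef)
    (hG : G 0 = 0) {x : ℕ → Fin n → ℝ} {N : ℕ}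
    (hx : ∀ k < N, C k *ᵥ x k + (E k *ᵥ (x k - G k *ᵥ x (k - 1)) -
      (G (k + 1))ᵀ *ᵥ (E (k + 1) *ᵥ (x (k + 1) - G (k + 1) *ᵥ x k))) = r k) {k : ℕ}
    (hk : k < N) :
    x k = (filterPivot C E G k)⁻¹ *ᵥ
      (filterVec C E G r k + (G (k + 1))ᵀ *ᵥ (E (k + 1) *ᵥ x (k + 1))) := by
  -- The induction carries the eliminated row for `x k`. Its solved form is substituted into row k +
  -- 1, which removes `x k` there and produces the next pivot and right-hand side.
  have hsolve : ∀ k, filterPivot C E G k *ᵥ x k =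
      filterVec C E G r k + (G (k + 1))ᵀ *ᵥ (E (k + 1) *ᵥ x (k + 1)) →
      x k = (filterPivot C E G k)⁻¹ *ᵥ
        (filterVec C E G r k + (G (k + 1))ᵀ *ᵥ (E (k + 1) *ᵥ x (k + 1))) := by
    intro k h
    rw [← h, mulVec_mulVec, nonsing_inv_mul _ (filterPivot_posDef hC hE k).isUnit_det, one_mulVec]
  refine hsolve k ?_
  induction k with
  | zero =>
    have h := hx 0 hk
    -- At k = 0 the truncated index k - 1 refers to `x 0` itself; the hypothesis `G 0 = 0` removes
    -- this term.
    simp only [hG, zero_mulVec, sub_zero, mulVec_sub] at h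
    simp only [filterPivot, filterInfo, filterVec, add_mulVec, ← mulVec_mulVec]
    linear_combination (exp := 1) h
  | succ k ih =>
    have h := hx (k + 1) hk
    have ih' := hsolve k (ih (by omega))
    have e : filterInfo C E G (k + 1) = C (k + 1) + (E (k + 1) - E (k + 1) * G (k + 1) *
      (filterPivot C E G k)⁻¹ * ((G (k + 1))ᵀ * E (k + 1))) := rfl
    have e' : filterVec C E G r (k + 1) = r (k + 1) +
      E (k + 1) *ᵥ (G (k + 1) *ᵥ ((filterPivot C E G k)⁻¹ *ᵥ filterVec C E G r k)) := rfl
    rw [Nat.add_sub_cancel, ih'] at h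
    rw [filterPivot, e, e']
    simp only [mulVec_sub, mulVec_add] at h
    simp only [Matrix.mul_assoc, add_mulVec, sub_mulVec, ← mulVec_mulVec]
    linear_combination (exp := 1) h

end Smoother

/-- The cost of the solution of the block tridiagonal system. -/
theorem Cost.smoother {D : Type*} {I : Set (D → ℝ)} {υ e n N k : ℕ} (he : e ^ 3 ≤ υ) (hn : n ≤ e)
    {C E G : ℕ → D → Matrix (Fin n) (Fin n) ℝ} {r x : ℕ → D → Fin n → ℝ}
    (hC : ∀ j d, (C j d).PosSemidef) (hE : ∀ j d, (E j d).PosDef) (hG : ∀ d, G 0 d = 0)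
    (hxN : ∀ d, x N d = 0)
    (hx : ∀ d, ∀ j < N, C j d *ᵥ x j d + (E j d *ᵥ (x j d - G j d *ᵥ x (j - 1) d) -
      (G (j + 1) d)ᵀ *ᵥ (E (j + 1) d *ᵥ (x (j + 1) d - G (j + 1) d *ᵥ x j d))) = r j d)
    (hCk : ∀ j, Cost υ I (entries (C j)) k) (hEk : ∀ j, Cost υ I (entries (E j)) k)
    (hGk : ∀ j, Cost υ I (entries (G j)) k) (hrk : ∀ j, Cost υ I (coords (r j)) k) :
    Cost υ I (⋃ j : Fin N, coords (x j)) (N * (32 * k + 128)) := by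
  have hnu : n ≤ υ := le_of_cube_le he hn
  let F : ℕ → D → Matrix (Fin n) (Fin n) ℝ := fun j d =>
    filterInfo (fun j => C j d) (fun j => E j d) (fun j => G j d) j
  let V : ℕ → D → Matrix (Fin n) (Fin n) ℝ := fun j d =>
    filterPivot (fun j => C j d) (fun j => E j d) (fun j => G j d) j
  let y : ℕ → D → Fin n → ℝ := fun j d =>
    filterVec (fun j => C j d) (fun j => E j d) (fun j => G j d) (fun j => r j d) j
  have hV : ∀ j d, (V j d).PosDef := fun j d =>
    filterPivot_posDef (fun j => hC j d) (fun j => hE j d) j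
  have hGE : ∀ j, Cost υ I (entries fun d => (G j d)ᵀ * E j d) (k + k + 3) := fun j =>
    mat_mul he (mat_transpose (hGk j)) (hEk j)
  have hpivot : ∀ j J, I ⊆ J → entries (F j) ⊆ J →
      Cost υ J (entries fun d => (V j d)⁻¹) (3 * k + 22) := by
    intro j J hJ hF
    have h1 := mat_mul he (hGE (j + 1)) (hGk (j + 1))
    exact (mat_inv he (hV j) (mat_add he (of_subset hF) (h1.mono_left hJ))).weaken (by omega)
  -- The information matrices and vectors of all times are kept for the back substitution; the
  -- inverse pivots are recomputed from them.
  have hforward : ∀ i : ℕ, i ≤ N →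
      Cost υ I (⋃ j : Fin i, (entries (F j) ∪ coords (y j))) (i * (16 * k + 70)) := by
    intro i
    induction i with
    | zero => intro _; exact (of_subset (by simp)).weaken (Nat.zero_le _)
    | succ i ih =>
      intro hi
      have hstep : ∀ J, I ⊆ J → (⋃ j : Fin i, (entries (F j) ∪ coords (y j))) ⊆ J →
          Cost υ J (entries (F i) ∪ coords (y i)) (16 * k + 70) := by
        intro J hJ hprev
        cases i with
        | zero =>
          have h1 : Cost υ I (entries (F 0)) (k + k + 1) := mat_add he (hCk 0) (hEk 0)
          have h2 : Cost υ I (coords (y 0)) k := hrk 0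
          exact ((h1.union h2).mono_left hJ).weaken (by omega)
        | succ i =>
          have hp : entries (F i) ∪ coords (y i) ⊆ J :=
            (Set.subset_iUnion (fun j : Fin (i + 1) => entries (F j) ∪ coords (y j))
              (Fin.last i)).trans hprev
          have hVi := hpivot i J hJ (Set.subset_union_left.trans hp)
          have hy := of_subset (υ := υ) (Set.subset_union_right.trans hp)
          have h1 := mat_mul he (hEk (i + 1)) (hGk (i + 1))
          have h2 := mat_mul he (mat_mul he (h1.mono_left hJ) hVi) ((hGE (i + 1)).mono_left hJ)
          have h3 := mat_add he ((hCk (i + 1)).mono_left hJ)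
            (mat_sub he ((hEk (i + 1)).mono_left hJ) h2)
          have h4 := vec_add ((hrk (i + 1)).mono_left hJ) (mat_mulVec he
            ((hEk (i + 1)).mono_left hJ) (mat_mulVec he ((hGk (i + 1)).mono_left hJ)
              (mat_mulVec he hVi hy)))
          exact (h3.union h4).weaken (by omega)
      refine (((ih (by omega)).bind hstep).subset ?_).weaken (by ring_nf; omega)
      refine Set.iUnion_subset fun j => ?_
      rcases Fin.eq_castSucc_or_eq_last j with ⟨j', rfl⟩ | rfl
      · exact (Set.subset_iUnion (fun j : Fin i => entries (F j) ∪ coords (y j)) j').trans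
          Set.subset_union_left
      · exact Set.subset_union_right
  -- The states are found backwards from time N - 1; the start uses the known value `x N = 0`.
  have hback : ∀ J, I ⊆ J → (⋃ j : Fin N, (entries (F j) ∪ coords (y j))) ⊆ J →
      ∀ i : ℕ, i ≤ N → Cost υ J (⋃ j : Fin i, coords (x (N - 1 - j))) (i * (16 * k + 58)) := by
    intro J hJ hfw i
    induction i with
    | zero => intro _; exact (of_subset (by simp)).weaken (Nat.zero_le _)
    | succ i ih =>
      intro hi
      have hlt : N - 1 - i < N := by omega
      have hp : entries (F (N - 1 - i)) ∪ coords (y (N - 1 - i)) ⊆ J :=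
        (Set.subset_iUnion (fun j : Fin N => entries (F j) ∪ coords (y j))
          ⟨N - 1 - i, hlt⟩).trans hfw
      have hstep : ∀ L, J ⊆ L → (⋃ j : Fin i, coords (x (N - 1 - j))) ⊆ L →
          Cost υ L (coords (x (N - 1 - i))) (16 * k + 58) := by
        intro L hL hprev
        have hIL := hJ.trans hL
        have hnext : Cost υ L (coords (x (N - 1 - i + 1))) 1 := by
          cases i with
          | zero =>
            have e : x (N - 1 - 0 + 1) = fun _ => (0 : Fin n → ℝ) := by
              have : N - 1 - 0 + 1 = N := by omega
              rw [this]
              exact funext hxN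
            rw [e]
            exact vec_zero
          | succ i =>
            have e : N - 1 - (i + 1) + 1 = N - 1 - i := by omega
            rw [e]
            exact (of_subset ((Set.subset_iUnion (fun j : Fin (i + 1) => coords (x (N - 1 - j)))
              (Fin.last i)).trans hprev)).weaken (Nat.zero_le _)
        have hVi := hpivot (N - 1 - i) L hIL ((Set.subset_union_left.trans hp).trans hL)
        have hy := of_subset (υ := υ) ((Set.subset_union_right.trans hp).trans hL)
        have h1 := mat_mulVec he hVi (vec_add hy (mat_mulVec he
          (mat_transpose ((hGk (N - 1 - i + 1)).mono_left hIL))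
          (mat_mulVec he ((hEk (N - 1 - i + 1)).mono_left hIL) hnext)))
        have e : x (N - 1 - i) = fun d => (V (N - 1 - i) d)⁻¹ *ᵥ (y (N - 1 - i) d +
            (G (N - 1 - i + 1) d)ᵀ *ᵥ (E (N - 1 - i + 1) d *ᵥ x (N - 1 - i + 1) d)) :=
          funext fun d => eq_filterPivot_inv_mulVec (x := fun j => x j d) (r := fun j => r j d)
            (fun j => hC j d) (fun j => hE j d) (hG d) (hx d) hlt
        rw [e]
        exact h1.weaken (by omega)
      refine (((ih (by omega)).bind hstep).subset ?_).weaken (by ring_nf; omega)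
      refine Set.iUnion_subset fun j => ?_
      rcases Fin.eq_castSucc_or_eq_last j with ⟨j', rfl⟩ | rfl
      · exact (Set.subset_iUnion (fun j : Fin i => coords (x (N - 1 - j))) j').trans
          Set.subset_union_left
      · exact Set.subset_union_right
  refine (((hforward N le_rfl).bind' fun J hJ hO => hback J hJ hO N le_rfl).subset ?_).weaken
    (by ring_nf; omega)
  refine Set.iUnion_subset fun j => ?_
  have e : N - 1 - (N - 1 - (j : ℕ)) = j := by omega
  have := Set.subset_iUnion (fun i : Fin N => coords (x (N - 1 - i))) ⟨N - 1 - j, by omega⟩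
  simpa only [e] using this

/-! ## Elimination inside one block -/

namespace PLQData

section Block

variable {ι κ c : Type*} [Fintype ι] [Fintype κ] [Fintype c] [DecidableEq c]
  (P : PLQData ι κ c) (s q : c → ℝ) (u β : ι → ℝ) (γ : ℝ)

/-- The first component of `-F_γ` in a block. -/
def blockR₁ : c → ℝ := -(s + P.Aᵀ *ᵥ u - P.a)

/-- The matrix `T` of a block. -/
def blockT : Matrix ι ι ℝ := P.M + P.A * diagonal (q / s) * P.Aᵀ

/-- The vector `r₃ + A D(s)⁻¹ (r₂ - D(q) r₁)` of a block, where `β` stands for `b + B y`. -/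
def blockLoad : ι → ℝ :=
  P.A *ᵥ (((fun _ => γ) - q * s - q * P.blockR₁ s u) / s) - (β - P.M *ᵥ u - P.A *ᵥ q)

variable {P s q u β γ}

theorem redT_eq_blockT [DecidableEq ι] (y : κ → ℝ) : P.redT (s, q, u, y) = P.blockT s q := by
  have : (fun i => (s i)⁻¹ * q i) = q / s := by
    funext i
    rw [Pi.div_apply, div_eq_inv_mul]
  simp only [redT, blockT, this]

theorem Regular.blockT_posDef (hP : P.Regular) (hs : ∀ i, 0 < s i) (hq : ∀ i, 0 < q i) :
    (P.blockT s q).PosDef := by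
  classical
  have h := hP.redT_posDef (p := (s, q, 0, 0)) hs hq
  rwa [redT_eq_blockT] at h

/-- Here β' stands for the block of B dy. Once the state direction is known, these formulas give the
other components of the direction in the order du, ds, dq. -/
theorem Regular.block_solution [DecidableEq ι] (hP : P.Regular) (hs : ∀ i, 0 < s i)
    (hq : ∀ i, 0 < q i) {ds dq : c → ℝ} {du β' : ι → ℝ}
    (h₁ : ds + P.Aᵀ *ᵥ du = P.blockR₁ s u)
    (h₂ : ∀ i, q i * ds i + s i * dq i = γ - q i * s i)
    (h₃ : β' - P.M *ᵥ du - P.A *ᵥ dq = -(β - P.M *ᵥ u - P.A *ᵥ q)) :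
    du = (P.blockT s q)⁻¹ *ᵥ (β' - P.blockLoad s q u β γ) ∧
      ds = P.blockR₁ s u - P.Aᵀ *ᵥ du ∧ dq = ((fun _ => γ) - q * s - q * ds) / s := by
  have h := redT_mulVec_of_kkt (P := P) (p := (s, q, u, 0)) (fun i => (hs i).ne') h₁ h₂ h₃
  rw [redT_eq_blockT] at h
  have e : -(β - P.M *ᵥ u - P.A *ᵥ q) + P.A *ᵥ
      (fun i => (s i)⁻¹ * (γ - q i * s i - q i * P.blockR₁ s u i)) =
      P.blockLoad s q u β γ := by
    have : (fun i => (s i)⁻¹ * (γ - q i * s i - q i * P.blockR₁ s u i)) =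
        ((fun _ => γ) - q * s - q * P.blockR₁ s u) / s := by
      funext i
      simp only [Pi.div_apply, Pi.sub_apply, Pi.mul_apply]
      rw [div_eq_inv_mul]
    rw [this, blockLoad]
    abel
  refine ⟨?_, eq_sub_of_add_eq h₁, ?_⟩
  · rw [← e, ← h, mulVec_mulVec, nonsing_inv_mul _ (hP.blockT_posDef hs hq).isUnit_det,
      one_mulVec]
  · funext i
    simp only [Pi.div_apply, Pi.sub_apply, Pi.mul_apply]
    rw [eq_div_iff (hs i).ne']
    linear_combination h₂ i

end Block

end PLQData

/-! ### The cost of the elimination in one block. -/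

namespace Cost

section Block

variable {D : Type*} {I : Set (D → ℝ)} {υ e k a b c : ℕ}
  {P : D → PLQData (Fin a) (Fin b) (Fin c)} {S : Fin c → Finset (Fin a)}
  {s q : D → Fin c → ℝ} {u β : D → Fin a → ℝ} {γ : D → ℝ}

theorem plq_M (h : PLQData.entries P ⊆ I) : Cost υ I (_root_.entries fun d => (P d).M) 0 :=
  of_subset fun _ hf => h (Or.inl (Or.inl (Or.inl (Or.inl hf))))

theorem plq_b (h : PLQData.entries P ⊆ I) : Cost υ I (coords fun d => (P d).b) 0 :=
  of_subset fun _ hf => h (Or.inl (Or.inl (Or.inl (Or.inr hf))))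

theorem plq_B (h : PLQData.entries P ⊆ I) : Cost υ I (_root_.entries fun d => (P d).B) 0 :=
  of_subset fun _ hf => h (Or.inl (Or.inl (Or.inr hf)))

theorem plq_A (h : PLQData.entries P ⊆ I) : Cost υ I (_root_.entries fun d => (P d).A) 0 :=
  of_subset fun _ hf => h (Or.inl (Or.inr hf))

theorem plq_a (h : PLQData.entries P ⊆ I) : Cost υ I (coords fun d => (P d).a) 0 :=
  of_subset fun _ hf => h (Or.inr hf)

theorem blockR₁ (hP : PLQData.entries P ⊆ I) (hA : ∀ d i j, (P d).A i j ≠ 0 → i ∈ S j)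
    (hs : coords s ⊆ I) (hu : coords u ⊆ I)
    (hS : ∑ j, (S j).card ^ 2 ≤ υ := by assumption) (hc : c ≤ υ := by assumption) :
    Cost υ I (coords fun d => (P d).blockR₁ (s d) (u d)) 7 :=
  vec_neg (vec_sub (vec_add (of_subset hs) (sparse_transpose_mulVec hA (plq_A hP) (of_subset hu)))
    (plq_a hP))

theorem blockT (he : e ^ 3 ≤ υ) (hP : PLQData.entries P ⊆ I)
    (hA : ∀ d i j, (P d).A i j ≠ 0 → i ∈ S j) (hs : coords s ⊆ I) (hq : coords q ⊆ I)
    (hs0 : ∀ d i, 0 < s d i)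
    (hS : ∑ j, (S j).card ^ 2 ≤ υ := by assumption) (hc : c ≤ υ := by assumption)
    (ha : a ≤ e := by assumption) :
    Cost υ I (_root_.entries fun d => (P d).blockT (s d) (q d)) 6 :=
  mat_add he (plq_M hP) (sparse_gram he hA (plq_A hP)
    (vec_div (fun d i => (hs0 d i).ne') (of_subset hq) (of_subset hs)))

theorem blockT_inv (he : e ^ 3 ≤ υ) (hP : PLQData.entries P ⊆ I) (hreg : ∀ d, (P d).Regular)
    (hA : ∀ d i j, (P d).A i j ≠ 0 → i ∈ S j) (hs : coords s ⊆ I) (hq : coords q ⊆ I)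
    (hs0 : ∀ d i, 0 < s d i) (hq0 : ∀ d i, 0 < q d i)
    (hS : ∑ j, (S j).card ^ 2 ≤ υ := by assumption) (hc : c ≤ υ := by assumption)
    (ha : a ≤ e := by assumption) :
    Cost υ I (_root_.entries fun d => ((P d).blockT (s d) (q d))⁻¹) 21 :=
  mat_inv he (fun d => (hreg d).blockT_posDef (hs0 d) (hq0 d)) (blockT he hP hA hs hq hs0)

theorem blockLoad (he : e ^ 3 ≤ υ) (hP : PLQData.entries P ⊆ I)
    (hA : ∀ d i j, (P d).A i j ≠ 0 → i ∈ S j) (hs : coords s ⊆ I) (hq : coords q ⊆ I)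
    (hu : coords u ⊆ I) (hγ : γ ∈ I) (hs0 : ∀ d i, 0 < s d i) (hβ : Cost υ I (coords β) k)
    (hS : ∑ j, (S j).card ^ 2 ≤ υ := by assumption) (hc : c ≤ υ := by assumption)
    (ha : a ≤ e := by assumption) :
    Cost υ I (coords fun d => (P d).blockLoad (s d) (q d) (u d) (β d) (γ d)) (k + 24) := by
  have haυ : a ≤ υ := le_of_cube_le he ha
  have h1 := sparse_mulVec hA (plq_A hP) (vec_div (fun d i => (hs0 d i).ne')
    (vec_sub (vec_sub (vec_const hγ) (vec_mul (of_subset hq) (of_subset hs)))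
      (vec_mul (of_subset hq) (blockR₁ hP hA hs hu))) (of_subset hs))
  have h2 := vec_sub (vec_sub hβ (mat_mulVec he (plq_M hP) (of_subset hu)))
    (sparse_mulVec hA (plq_A hP) (of_subset hq))
  exact (vec_sub h1 h2).weaken (by omega)

end Block

end Cost

/-! ## The Newton step of the smoothing problem -/

namespace NewtonInstance

variable {N n m : ℕ} {pw pv lw lv : Fin N → ℕ}
  {Sw : (k : Fin N) → Fin (lw k) → Finset (Fin (pw k))}
  {Sv : (k : Fin N) → Fin (lv k) → Finset (Fin (pv k))}

section Blocks

variable (d : NewtonInstance N n m pw pv lw lv Sw Sv) (k : Fin N)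

/-- The Newton direction. -/
def dir : IPPoint (Stack pv ⊕ Stack pw) (Stack fun _ : Fin N => n) (Stack lv ⊕ Stack lw) :=
  d.K.combined.newtonDir d.γ d.p

/-- The vector `b + B x` in the measurement block `k`. -/
def betaV : Fin (pv k) → ℝ :=
  (d.K.v k).b - (d.K.v k).B *ᵥ (invSqrt (d.K.R k) *ᵥ d.K.z k) +
    (d.K.v k).B *ᵥ (invSqrt (d.K.R k) *ᵥ (d.K.H k *ᵥ KalmanModel.stateAt d.p.2.2.2 k))

/-- The vector `b + B x` in the process block `k`. -/
def betaW : Fin (pw k) → ℝ :=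
  (d.K.w k).b - (d.K.w k).B *ᵥ (invSqrt (d.K.Q k) *ᵥ d.K.initial k) +
    (d.K.w k).B *ᵥ (invSqrt (d.K.Q k) *ᵥ (KalmanModel.stateAt d.p.2.2.2 k -
      d.K.transition k *ᵥ KalmanModel.stateAt d.p.2.2.2 ((k : ℕ) - 1)))

/-- The matrix `T` of the measurement block `k`. -/
def tMatV : Matrix (Fin (pv k)) (Fin (pv k)) ℝ :=
  (d.K.v k).blockT (fun j => d.p.1 (Sum.inl ⟨k, j⟩)) (fun j => d.p.2.1 (Sum.inl ⟨k, j⟩))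

/-- The matrix `T` of the process block `k`. -/
def tMatW : Matrix (Fin (pw k)) (Fin (pw k)) ℝ :=
  (d.K.w k).blockT (fun j => d.p.1 (Sum.inr ⟨k, j⟩)) (fun j => d.p.2.1 (Sum.inr ⟨k, j⟩))

/-- The load of the measurement block `k`. -/
def loadV : Fin (pv k) → ℝ :=
  (d.K.v k).blockLoad (fun j => d.p.1 (Sum.inl ⟨k, j⟩)) (fun j => d.p.2.1 (Sum.inl ⟨k, j⟩))
    (fun j => d.p.2.2.1 (Sum.inl ⟨k, j⟩)) (d.betaV k) d.γ

/-- The load of the process block `k`. -/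
def loadW : Fin (pw k) → ℝ :=
  (d.K.w k).blockLoad (fun j => d.p.1 (Sum.inr ⟨k, j⟩)) (fun j => d.p.2.1 (Sum.inr ⟨k, j⟩))
    (fun j => d.p.2.2.1 (Sum.inr ⟨k, j⟩)) (d.betaW k) d.γ

theorem regularV : (d.K.v k).Regular := (d.plq.measurement k).regular (d.null k).2

theorem regularW : (d.K.w k).Regular := (d.plq.process k).regular (d.null k).1

theorem tMatV_posDef : (d.tMatV k).PosDef :=
  (d.regularV k).blockT_posDef (fun _ => d.s_pos _) fun _ => d.q_pos _

theorem tMatW_posDef : (d.tMatW k).PosDef :=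
  (d.regularW k).blockT_posDef (fun _ => d.s_pos _) fun _ => d.q_pos _

/-- M and A do not mix blocks, so the first three Newton equations restrict to the block, where
`Regular.block_solution` applies. -/
theorem dir_blockV :
    (fun i => d.dir.2.2.1 (Sum.inl ⟨k, i⟩)) = (d.tMatV k)⁻¹ *ᵥ ((d.K.v k).B *ᵥ
      (invSqrt (d.K.R k) *ᵥ (d.K.H k *ᵥ KalmanModel.stateAt d.dir.2.2.2 k)) - d.loadV k) ∧
    (fun j => d.dir.1 (Sum.inl ⟨k, j⟩)) =
      (d.K.v k).blockR₁ (fun j => d.p.1 (Sum.inl ⟨k, j⟩))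
        (fun j => d.p.2.2.1 (Sum.inl ⟨k, j⟩)) -
      (d.K.v k).Aᵀ *ᵥ (fun i => d.dir.2.2.1 (Sum.inl ⟨k, i⟩)) ∧
    (fun j => d.dir.2.1 (Sum.inl ⟨k, j⟩)) =
      ((fun _ => d.γ) - (fun j => d.p.2.1 (Sum.inl ⟨k, j⟩)) * (fun j => d.p.1 (Sum.inl ⟨k, j⟩)) -
        (fun j => d.p.2.1 (Sum.inl ⟨k, j⟩)) * (fun j => d.dir.1 (Sum.inl ⟨k, j⟩))) /
          (fun j => d.p.1 (Sum.inl ⟨k, j⟩)) := by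
  obtain ⟨h₁, h₂, h₃, -⟩ := (d.plq.combined_regular d.null).newtonDir_spec d.s_pos d.q_pos d.γ
  refine (d.regularV k).block_solution (fun _ => d.s_pos _) (fun _ => d.q_pos _) ?_
    (fun j => h₂ _) ?_
  · have h := congrArg (fun f => fun j => f (Sum.inl ⟨k, j⟩)) h₁
    rw [← KalmanModel.combined_A_transpose_mulVec_inl, PLQData.blockR₁,
      ← KalmanModel.combined_A_transpose_mulVec_inl]
    exact h
  · have h := congrArg (fun f => fun j => f (Sum.inl ⟨k, j⟩)) h₃
    rw [betaV, ← KalmanModel.combined_b_inl, ← KalmanModel.combined_B_mulVec_inl,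
      ← KalmanModel.combined_B_mulVec_inl, ← KalmanModel.combined_M_mulVec_inl,
      ← KalmanModel.combined_M_mulVec_inl, ← KalmanModel.combined_A_mulVec_inl,
      ← KalmanModel.combined_A_mulVec_inl]
    refine h.trans ?_
    funext j
    simp only [Pi.neg_apply, Pi.sub_apply, Pi.add_apply]
    ring

theorem dir_blockW :
    (fun i => d.dir.2.2.1 (Sum.inr ⟨k, i⟩)) = (d.tMatW k)⁻¹ *ᵥ ((d.K.w k).B *ᵥ
      (invSqrt (d.K.Q k) *ᵥ (KalmanModel.stateAt d.dir.2.2.2 k -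
        d.K.transition k *ᵥ KalmanModel.stateAt d.dir.2.2.2 ((k : ℕ) - 1))) - d.loadW k) ∧
    (fun j => d.dir.1 (Sum.inr ⟨k, j⟩)) =
      (d.K.w k).blockR₁ (fun j => d.p.1 (Sum.inr ⟨k, j⟩))
        (fun j => d.p.2.2.1 (Sum.inr ⟨k, j⟩)) -
      (d.K.w k).Aᵀ *ᵥ (fun i => d.dir.2.2.1 (Sum.inr ⟨k, i⟩)) ∧
    (fun j => d.dir.2.1 (Sum.inr ⟨k, j⟩)) =
      ((fun _ => d.γ) - (fun j => d.p.2.1 (Sum.inr ⟨k, j⟩)) * (fun j => d.p.1 (Sum.inr ⟨k, j⟩)) -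
        (fun j => d.p.2.1 (Sum.inr ⟨k, j⟩)) * (fun j => d.dir.1 (Sum.inr ⟨k, j⟩))) /
          (fun j => d.p.1 (Sum.inr ⟨k, j⟩)) := by
  obtain ⟨h₁, h₂, h₃, -⟩ := (d.plq.combined_regular d.null).newtonDir_spec d.s_pos d.q_pos d.γ
  refine (d.regularW k).block_solution (fun _ => d.s_pos _) (fun _ => d.q_pos _) ?_
    (fun j => h₂ _) ?_
  · have h := congrArg (fun f => fun j => f (Sum.inr ⟨k, j⟩)) h₁
    rw [← KalmanModel.combined_A_transpose_mulVec_inr, PLQData.blockR₁,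
      ← KalmanModel.combined_A_transpose_mulVec_inr]
    exact h
  · have h := congrArg (fun f => fun j => f (Sum.inr ⟨k, j⟩)) h₃
    rw [betaW, ← KalmanModel.combined_b_inr, ← KalmanModel.combined_B_mulVec_inr,
      ← KalmanModel.combined_B_mulVec_inr, ← KalmanModel.combined_M_mulVec_inr,
      ← KalmanModel.combined_M_mulVec_inr, ← KalmanModel.combined_A_mulVec_inr,
      ← KalmanModel.combined_A_mulVec_inr]
    refine h.trans ?_
    funext j
    simp only [Pi.neg_apply, Pi.sub_apply, Pi.add_apply]
    ring

end Blocks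

/-! ### The reduced system in blocks -/

section ReducedSystem

/-- The matrix `B_v R^{-1/2} H` of time `k`. -/
def measMat (k : Fin N) (d : NewtonInstance N n m pw pv lw lv Sw Sv) :
    Matrix (Fin (pv k)) (Fin n) ℝ :=
  (d.K.v k).B * (invSqrt (d.K.R k) * d.K.H k)

/-- The matrix `B_w Q^{-1/2}` of time `k`. -/
def procMat (k : Fin N) (d : NewtonInstance N n m pw pv lw lv Sw Sv) :
    Matrix (Fin (pw k)) (Fin n) ℝ :=
  (d.K.w k).B * invSqrt (d.K.Q k)

/-- The contribution of the measurement `k` to `Ω`. -/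
def measInfo (k : ℕ) (d : NewtonInstance N n m pw pv lw lv Sw Sv) : Matrix (Fin n) (Fin n) ℝ :=
  if h : k < N then (measMat ⟨k, h⟩ d)ᵀ * (d.tMatV ⟨k, h⟩)⁻¹ * measMat ⟨k, h⟩ d else 0

/-- The information matrix of the transition to the state `k`. -/
def procInfo (k : ℕ) (d : NewtonInstance N n m pw pv lw lv Sw Sv) : Matrix (Fin n) (Fin n) ℝ :=
  if h : k < N then (procMat ⟨k, h⟩ d)ᵀ * (d.tMatW ⟨k, h⟩)⁻¹ * procMat ⟨k, h⟩ d else 1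

/-- The contribution of the load of the process block `k` to the right-hand side. -/
def procLoad (k : ℕ) (d : NewtonInstance N n m pw pv lw lv Sw Sv) : Fin n → ℝ :=
  if h : k < N then (procMat ⟨k, h⟩ d)ᵀ *ᵥ ((d.tMatW ⟨k, h⟩)⁻¹ *ᵥ d.loadW ⟨k, h⟩) else 0

/-- The contribution of the measurement `k` to the right-hand side. -/
def measLoad (k : ℕ) (d : NewtonInstance N n m pw pv lw lv Sw Sv) : Fin n → ℝ :=
  if h : k < N then (measMat ⟨k, h⟩ d)ᵀ *ᵥ ((d.tMatV ⟨k, h⟩)⁻¹ *ᵥ d.loadV ⟨k, h⟩ -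
    fun i => d.p.2.2.1 (Sum.inl ⟨⟨k, h⟩, i⟩)) else 0

/-- The right-hand side of the reduced system. -/
def redVec (k : ℕ) (d : NewtonInstance N n m pw pv lw lv Sw Sv) : Fin n → ℝ :=
  measLoad k d + (procLoad k d - d.K.processDual d.p.2.2.1 k -
    (d.K.transition (k + 1))ᵀ *ᵥ (procLoad (k + 1) d - d.K.processDual d.p.2.2.1 (k + 1)))

theorem measInfo_posSemidef (k : ℕ) (d : NewtonInstance N n m pw pv lw lv Sw Sv) :
    (measInfo k d).PosSemidef := by
  unfold measInfo
  split_ifs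
  · exact (d.tMatV_posDef _).inv.posSemidef.transpose_mul_mul _
  · exact PosSemidef.zero

theorem procInfo_posDef (k : ℕ) (d : NewtonInstance N n m pw pv lw lv Sw Sv) :
    (procInfo k d).PosDef := by
  unfold procInfo
  split_ifs with h
  · refine (d.tMatW_posDef _).inv.transpose_mul_mul ?_
    intro x y hxy
    simp only [procMat, ← mulVec_mulVec] at hxy
    exact invSqrt_mulVec_injective (d.plq.posDef_Q _) ((d.plq.process _).injective hxy)
  -- Beyond the last time the default is the identity, not 0, because the filter recursion asks for
  -- positive definiteness at all indices. It has no influence, since the transition matrix vanishes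
  -- there.
  · exact PosDef.one

theorem processDual_dir (k : ℕ) (d : NewtonInstance N n m pw pv lw lv Sw Sv) :
    d.K.processDual d.dir.2.2.1 k = procInfo k d *ᵥ (KalmanModel.stateAt d.dir.2.2.2 k -
      d.K.transition k *ᵥ KalmanModel.stateAt d.dir.2.2.2 (k - 1)) - procLoad k d := by
  by_cases h : k < N
  · simp only [KalmanModel.processDual, procInfo, procLoad, dif_pos h,
      (d.dir_blockW ⟨k, h⟩).1, procMat, transpose_mul, ← mulVec_mulVec, mulVec_sub]
  · rw [KalmanModel.transition_of_le _ (not_lt.1 h)]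
    simp [KalmanModel.processDual, procLoad, KalmanModel.stateAt, h]

/-- This is the fourth Newton equation at time k after elimination of du, in the shape that
`Cost.smoother` solves. -/
theorem reduced_equation (d : NewtonInstance N n m pw pv lw lv Sw Sv) (k : ℕ) (hk : k < N) :
    measInfo k d *ᵥ KalmanModel.stateAt d.dir.2.2.2 k +
      (procInfo k d *ᵥ (KalmanModel.stateAt d.dir.2.2.2 k -
        d.K.transition k *ᵥ KalmanModel.stateAt d.dir.2.2.2 (k - 1)) -
      (d.K.transition (k + 1))ᵀ *ᵥ (procInfo (k + 1) d *ᵥ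
        (KalmanModel.stateAt d.dir.2.2.2 (k + 1) -
          d.K.transition (k + 1) *ᵥ KalmanModel.stateAt d.dir.2.2.2 k))) = redVec k d := by
  obtain ⟨-, -, -, h₄⟩ := (d.plq.combined_regular d.null).newtonDir_spec d.s_pos d.q_pos d.γ
  have h := congrArg (fun f => fun i => f (⟨⟨k, hk⟩, i⟩ : Stack fun _ : Fin N => n)) h₄
  have h' : (fun i => (d.K.combined.Bᵀ *ᵥ d.dir.2.2.1) ⟨⟨k, hk⟩, i⟩) =
      -(fun i => (d.K.combined.Bᵀ *ᵥ d.p.2.2.1) ⟨⟨k, hk⟩, i⟩) := h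
  rw [KalmanModel.combined_B_transpose_mulVec, KalmanModel.combined_B_transpose_mulVec,
    (d.dir_blockV ⟨k, hk⟩).1] at h'
  simp only [processDual_dir, Nat.add_sub_cancel] at h'
  simp only [redVec, measLoad, measInfo, dif_pos hk, measMat, transpose_mul, Matrix.mul_assoc,
    ← mulVec_mulVec, mulVec_sub] at h' ⊢
  linear_combination (exp := 1) h'

end ReducedSystem

end NewtonInstance

namespace NewtonInstance

variable {N n m : ℕ} {pw pv lw lv : Fin N → ℕ}
  {Sw : (k : Fin N) → Fin (lw k) → Finset (Fin (pw k))}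
  {Sv : (k : Fin N) → Fin (lv k) → Finset (Fin (pv k))}

/-! ### The cost of the Newton step -/

/-- Dense matrix operations of size `e`, and sparse operations with the matrices `A_k`, cost
at most a constant times `υ`. -/
structure SizeBound (n m : ℕ) (Sw : (k : Fin N) → Fin (lw k) → Finset (Fin (pw k)))
    (Sv : (k : Fin N) → Fin (lv k) → Finset (Fin (pv k))) (e υ : ℕ) : Prop where
  cube : e ^ 3 ≤ υ
  n_le : n ≤ e
  m_le : m ≤ e
  pw_le : ∀ k, pw k ≤ e
  pv_le : ∀ k, pv k ≤ e
  lw_le : ∀ k, lw k ≤ υ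
  lv_le : ∀ k, lv k ≤ υ
  sw_le : ∀ k, ∑ j, (Sw k j).card ^ 2 ≤ υ
  sv_le : ∀ k, ∑ j, (Sv k j).card ^ 2 ≤ υ

section Inputs

variable {I : Set (NewtonInstance N n m pw pv lw lv Sw Sv → ℝ)}

theorem x₀_subset (hI : inputs ⊆ I) : coords (fun d => d.K.x₀) ⊆ I := fun _ hf =>
  hI (Or.inl (Or.inl (Or.inl (Or.inl (Or.inl (Or.inl (Or.inl (Or.inl (Or.inl hf)))))))))

theorem z_subset (hI : inputs ⊆ I) (k : Fin N) : coords (fun d => d.K.z k) ⊆ I := fun _ hf =>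
  hI (Or.inl (Or.inl (Or.inl (Or.inl (Or.inl (Or.inl (Or.inl (Or.inl (Or.inr
    (Set.mem_iUnion.2 ⟨k, hf⟩))))))))))

theorem G_subset (hI : inputs ⊆ I) (k : Fin N) :
    entries (fun d => d.K.G k) ⊆ I := fun _ hf =>
  hI (Or.inl (Or.inl (Or.inl (Or.inl (Or.inl (Or.inl (Or.inl (Or.inr
    (Set.mem_iUnion.2 ⟨k, hf⟩)))))))))

theorem H_subset (hI : inputs ⊆ I) (k : Fin N) :
    entries (fun d => d.K.H k) ⊆ I := fun _ hf =>
  hI (Or.inl (Or.inl (Or.inl (Or.inl (Or.inl (Or.inl (Or.inr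
    (Set.mem_iUnion.2 ⟨k, hf⟩))))))))

theorem Q_subset (hI : inputs ⊆ I) (k : Fin N) :
    entries (fun d => invSqrt (d.K.Q k)) ⊆ I := fun _ hf =>
  hI (Or.inl (Or.inl (Or.inl (Or.inl (Or.inl (Or.inr (Set.mem_iUnion.2 ⟨k, hf⟩)))))))

theorem R_subset (hI : inputs ⊆ I) (k : Fin N) :
    entries (fun d => invSqrt (d.K.R k)) ⊆ I := fun _ hf =>
  hI (Or.inl (Or.inl (Or.inl (Or.inl (Or.inr (Set.mem_iUnion.2 ⟨k, hf⟩))))))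

theorem w_subset (hI : inputs ⊆ I) (k : Fin N) :
    PLQData.entries (fun d => d.K.w k) ⊆ I := fun _ hf =>
  hI (Or.inl (Or.inl (Or.inl (Or.inr (Set.mem_iUnion.2 ⟨k, hf⟩)))))

theorem v_subset (hI : inputs ⊆ I) (k : Fin N) :
    PLQData.entries (fun d => d.K.v k) ⊆ I := fun _ hf =>
  hI (Or.inl (Or.inl (Or.inr (Set.mem_iUnion.2 ⟨k, hf⟩))))

theorem point_subset (hI : inputs ⊆ I) : pointCoords (fun d => d.p) ⊆ I := fun _ hf =>
  hI (Or.inl (Or.inr hf))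

theorem γ_mem (hI : inputs ⊆ I) : (fun d => d.γ) ∈ I := hI (Or.inr (Or.inl rfl))

theorem t_mem (hI : inputs ⊆ I) : (fun d => d.t) ∈ I := hI (Or.inr (Or.inr rfl))

theorem s_subset (hI : inputs ⊆ I) {a : ℕ} (f : Fin a → Stack lv ⊕ Stack lw) :
    coords (fun d j => d.p.1 (f j)) ⊆ I := by
  rintro _ ⟨j, rfl⟩
  exact point_subset hI (Or.inl (Or.inl (Or.inl ⟨f j, rfl⟩)))

theorem q_subset (hI : inputs ⊆ I) {a : ℕ} (f : Fin a → Stack lv ⊕ Stack lw) :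
    coords (fun d j => d.p.2.1 (f j)) ⊆ I := by
  rintro _ ⟨j, rfl⟩
  exact point_subset hI (Or.inl (Or.inl (Or.inr ⟨f j, rfl⟩)))

theorem u_subset (hI : inputs ⊆ I) {a : ℕ} (f : Fin a → Stack pv ⊕ Stack pw) :
    coords (fun d j => d.p.2.2.1 (f j)) ⊆ I := by
  rintro _ ⟨j, rfl⟩
  exact point_subset hI (Or.inl (Or.inr ⟨f j, rfl⟩))

theorem y_subset (hI : inputs ⊆ I) {a : ℕ} (f : Fin a → Stack fun _ : Fin N => n) :
    coords (fun d j => d.p.2.2.2 (f j)) ⊆ I := by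
  rintro _ ⟨j, rfl⟩
  exact point_subset hI (Or.inr ⟨f j, rfl⟩)

end Inputs

section Costs

variable {I : Set (NewtonInstance N n m pw pv lw lv Sw Sv → ℝ)} {e υ : ℕ}

open Cost

theorem cost_transition (hI : inputs ⊆ I) (hz : SizeBound n m Sw Sv e υ) (k : ℕ) :
    Cost υ I (entries fun d => d.K.transition k) 1 := by
  have hn := hz.n_le
  unfold KalmanModel.transition
  by_cases h : k < N
  · by_cases h0 : k = 0
    · simp only [dif_pos h, if_pos h0]
      exact mat_zero hz.cube
    · simp only [dif_pos h, if_neg h0]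
      exact (of_subset (G_subset hI _)).weaken (Nat.zero_le _)
  · simp only [dif_neg h]
    exact mat_zero hz.cube

theorem cost_initial (hI : inputs ⊆ I) (hz : SizeBound n m Sw Sv e υ) (k : ℕ) :
    Cost υ I (coords fun d => d.K.initial k) 1 := by
  have hn := le_of_cube_le hz.cube hz.n_le
  unfold KalmanModel.initial
  by_cases h0 : k = 0
  · simp only [if_pos h0]
    exact (of_subset (x₀_subset hI)).weaken (Nat.zero_le _)
  · simp only [if_neg h0]
    exact vec_zero

theorem cost_stateAt (hz : SizeBound n m Sw Sv e υ)
    {f : NewtonInstance N n m pw pv lw lv Sw Sv → (Stack fun _ : Fin N => n) → ℝ} (k : ℕ)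
    (hf : ∀ h : k < N, coords (fun d i => f d ⟨⟨k, h⟩, i⟩) ⊆ I) :
    Cost υ I (coords fun d => KalmanModel.stateAt (f d) k) 1 := by
  have hn := le_of_cube_le hz.cube hz.n_le
  unfold KalmanModel.stateAt
  by_cases h : k < N
  · simp only [dif_pos h]
    exact (of_subset (hf h)).weaken (Nat.zero_le _)
  · simp only [dif_neg h]
    exact vec_zero

/-- The cost of `B_v R^{-1/2} H x_k`. -/
theorem cost_measResidual (hI : inputs ⊆ I) (hz : SizeBound n m Sw Sv e υ)
    {f : NewtonInstance N n m pw pv lw lv Sw Sv → (Stack fun _ : Fin N => n) → ℝ}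
    (hf : ∀ k : Fin N, coords (fun d i => f d ⟨k, i⟩) ⊆ I) (k : Fin N) :
    Cost υ I (coords fun d => (d.K.v k).B *ᵥ (invSqrt (d.K.R k) *ᵥ
      (d.K.H k *ᵥ KalmanModel.stateAt (f d) k))) 10 := by
  have hn := hz.n_le
  have hm := hz.m_le
  have hp := hz.pv_le k
  have he := hz.cube
  exact mat_mulVec he (plq_B (v_subset hI k)) (mat_mulVec he (of_subset (R_subset hI k))
    (mat_mulVec he (of_subset (H_subset hI k)) (cost_stateAt hz k fun h => hf _)))

/-- The cost of `B_w Q^{-1/2} (x_k - G_k x_{k-1})`. -/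
theorem cost_procResidual (hI : inputs ⊆ I) (hz : SizeBound n m Sw Sv e υ)
    {f : NewtonInstance N n m pw pv lw lv Sw Sv → (Stack fun _ : Fin N => n) → ℝ}
    (hf : ∀ k : Fin N, coords (fun d i => f d ⟨k, i⟩) ⊆ I) (k : Fin N) :
    Cost υ I (coords fun d => (d.K.w k).B *ᵥ (invSqrt (d.K.Q k) *ᵥ
      (KalmanModel.stateAt (f d) k -
        d.K.transition k *ᵥ KalmanModel.stateAt (f d) ((k : ℕ) - 1)))) 13 := by
  have hn := hz.n_le
  have hp := hz.pw_le k
  have he := hz.cube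
  have hnυ := le_of_cube_le he hn
  exact mat_mulVec he (plq_B (w_subset hI k)) (mat_mulVec he (of_subset (Q_subset hI k))
    (vec_sub (cost_stateAt hz k fun h => hf _) (mat_mulVec he (cost_transition hI hz k)
      (cost_stateAt hz _ fun h => hf _))))

theorem cost_loadV (hI : inputs ⊆ I) (hz : SizeBound n m Sw Sv e υ) (k : Fin N) :
    Cost υ I (coords fun d => d.loadV k) 42 := by
  have hm := hz.m_le
  have hp := hz.pv_le k
  have he := hz.cube
  have hpυ := le_of_cube_le he hp
  have hl := hz.lv_le k
  have hS := hz.sv_le k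
  have hβ : Cost υ I (coords fun d => d.betaV k) 18 :=
    vec_add (vec_sub (plq_b (v_subset hI k)) (mat_mulVec he (plq_B (v_subset hI k))
      (mat_mulVec he (of_subset (R_subset hI k)) (of_subset (z_subset hI k)))))
      (cost_measResidual hI hz (fun k => y_subset hI fun i => ⟨k, i⟩) k)
  exact blockLoad he (v_subset hI k) (fun d => d.pattern_v k) (s_subset hI _) (q_subset hI _)
    (u_subset hI _) (γ_mem hI) (fun d _ => d.s_pos _) hβ

theorem cost_loadW (hI : inputs ⊆ I) (hz : SizeBound n m Sw Sv e υ) (k : Fin N) :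
    Cost υ I (coords fun d => d.loadW k) 46 := by
  have hn := hz.n_le
  have hp := hz.pw_le k
  have he := hz.cube
  have hpυ := le_of_cube_le he hp
  have hl := hz.lw_le k
  have hS := hz.sw_le k
  have hβ : Cost υ I (coords fun d => d.betaW k) 22 :=
    vec_add (vec_sub (plq_b (w_subset hI k)) (mat_mulVec he (plq_B (w_subset hI k))
      (mat_mulVec he (of_subset (Q_subset hI k)) (cost_initial hI hz k))))
      (cost_procResidual hI hz (fun k => y_subset hI fun i => ⟨k, i⟩) k)
  exact blockLoad he (w_subset hI k) (fun d => d.pattern_w k) (s_subset hI _) (q_subset hI _)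
    (u_subset hI _) (γ_mem hI) (fun d _ => d.s_pos _) hβ

theorem cost_tMatV_inv (hI : inputs ⊆ I) (hz : SizeBound n m Sw Sv e υ) (k : Fin N) :
    Cost υ I (entries fun d => (d.tMatV k)⁻¹) 21 := by
  have hp := hz.pv_le k
  have hl := hz.lv_le k
  have hS := hz.sv_le k
  exact blockT_inv hz.cube (v_subset hI k) (fun d => d.regularV k) (fun d => d.pattern_v k)
    (s_subset hI _) (q_subset hI _) (fun d _ => d.s_pos _) (fun d _ => d.q_pos _)

theorem cost_tMatW_inv (hI : inputs ⊆ I) (hz : SizeBound n m Sw Sv e υ) (k : Fin N) :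
    Cost υ I (entries fun d => (d.tMatW k)⁻¹) 21 := by
  have hp := hz.pw_le k
  have hl := hz.lw_le k
  have hS := hz.sw_le k
  exact blockT_inv hz.cube (w_subset hI k) (fun d => d.regularW k) (fun d => d.pattern_w k)
    (s_subset hI _) (q_subset hI _) (fun d _ => d.s_pos _) (fun d _ => d.q_pos _)

theorem cost_measMat (hI : inputs ⊆ I) (hz : SizeBound n m Sw Sv e υ) (k : Fin N) :
    Cost υ I (entries (measMat k)) 6 := by
  have hn := hz.n_le
  have hm := hz.m_le
  have hp := hz.pv_le k
  exact mat_mul hz.cube (plq_B (v_subset hI k))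
    (mat_mul hz.cube (of_subset (R_subset hI k)) (of_subset (H_subset hI k)))

theorem cost_procMat (hI : inputs ⊆ I) (hz : SizeBound n m Sw Sv e υ) (k : Fin N) :
    Cost υ I (entries (procMat k)) 3 := by
  have hn := hz.n_le
  have hp := hz.pw_le k
  exact mat_mul hz.cube (plq_B (w_subset hI k)) (of_subset (Q_subset hI k))

theorem cost_measInfo (hI : inputs ⊆ I) (hz : SizeBound n m Sw Sv e υ) (k : ℕ) :
    Cost υ I (entries (measInfo k)) 39 := by
  have hn := hz.n_le
  by_cases h : k < N
  · have hp := hz.pv_le ⟨k, h⟩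
    have e : measInfo (Sw := Sw) (Sv := Sv) (n := n) (m := m) k = fun d =>
        (measMat ⟨k, h⟩ d)ᵀ * (d.tMatV ⟨k, h⟩)⁻¹ * measMat ⟨k, h⟩ d :=
      funext fun d => dif_pos h
    rw [e]
    exact mat_mul hz.cube (mat_mul hz.cube (mat_transpose (cost_measMat hI hz _))
      (cost_tMatV_inv hI hz _)) (cost_measMat hI hz _)
  · have e : measInfo (Sw := Sw) (Sv := Sv) (n := n) (m := m) k = fun d => 0 :=
      funext fun d => dif_neg h
    rw [e]
    exact (mat_zero hz.cube).weaken (by norm_num)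

theorem cost_procInfo (hI : inputs ⊆ I) (hz : SizeBound n m Sw Sv e υ) (k : ℕ) :
    Cost υ I (entries (procInfo k)) 33 := by
  have hn := hz.n_le
  by_cases h : k < N
  · have hp := hz.pw_le ⟨k, h⟩
    have e : procInfo (Sw := Sw) (Sv := Sv) (n := n) (m := m) k = fun d =>
        (procMat ⟨k, h⟩ d)ᵀ * (d.tMatW ⟨k, h⟩)⁻¹ * procMat ⟨k, h⟩ d :=
      funext fun d => dif_pos h
    rw [e]
    exact mat_mul hz.cube (mat_mul hz.cube (mat_transpose (cost_procMat hI hz _))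
      (cost_tMatW_inv hI hz _)) (cost_procMat hI hz _)
  · have e : procInfo (Sw := Sw) (Sv := Sv) (n := n) (m := m) k = fun d => 1 :=
      funext fun d => dif_neg h
    rw [e]
    exact (mat_one hz.cube).weaken (by norm_num)

theorem cost_procLoad (hI : inputs ⊆ I) (hz : SizeBound n m Sw Sv e υ) (k : ℕ) :
    Cost υ I (coords (procLoad k)) 76 := by
  have hn := hz.n_le
  have hnυ := le_of_cube_le hz.cube hz.n_le
  by_cases h : k < N
  · have hp := hz.pw_le ⟨k, h⟩
    have e : procLoad (Sw := Sw) (Sv := Sv) (n := n) (m := m) k = fun d =>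
        (procMat ⟨k, h⟩ d)ᵀ *ᵥ ((d.tMatW ⟨k, h⟩)⁻¹ *ᵥ d.loadW ⟨k, h⟩) :=
      funext fun d => dif_pos h
    rw [e]
    exact mat_mulVec hz.cube (mat_transpose (cost_procMat hI hz _))
      (mat_mulVec hz.cube (cost_tMatW_inv hI hz _) (cost_loadW hI hz _))
  · have e : procLoad (Sw := Sw) (Sv := Sv) (n := n) (m := m) k = fun d => 0 :=
      funext fun d => dif_neg h
    rw [e]
    exact (Cost.vec_zero hnυ).weaken (by norm_num)

theorem cost_measLoad (hI : inputs ⊆ I) (hz : SizeBound n m Sw Sv e υ) (k : ℕ) :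
    Cost υ I (coords (measLoad k)) 76 := by
  have hn := hz.n_le
  have hnυ := le_of_cube_le hz.cube hz.n_le
  by_cases h : k < N
  · have hp := hz.pv_le ⟨k, h⟩
    have hpυ := le_of_cube_le hz.cube hp
    have e : measLoad (Sw := Sw) (Sv := Sv) (n := n) (m := m) k = fun d =>
        (measMat ⟨k, h⟩ d)ᵀ *ᵥ ((d.tMatV ⟨k, h⟩)⁻¹ *ᵥ d.loadV ⟨k, h⟩ -
          fun i => d.p.2.2.1 (Sum.inl ⟨⟨k, h⟩, i⟩)) :=
      funext fun d => dif_pos h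
    rw [e]
    exact mat_mulVec hz.cube (mat_transpose (cost_measMat hI hz _))
      (vec_sub (mat_mulVec hz.cube (cost_tMatV_inv hI hz _) (cost_loadV hI hz _))
        (of_subset (u_subset hI fun i => Sum.inl ⟨⟨k, h⟩, i⟩)))
  · have e : measLoad (Sw := Sw) (Sv := Sv) (n := n) (m := m) k = fun d => 0 :=
      funext fun d => dif_neg h
    rw [e]
    exact (Cost.vec_zero hnυ).weaken (by norm_num)

theorem cost_processDual (hI : inputs ⊆ I) (hz : SizeBound n m Sw Sv e υ) (k : ℕ) :
    Cost υ I (coords fun d => d.K.processDual d.p.2.2.1 k) 6 := by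
  have hn := hz.n_le
  have hnυ := le_of_cube_le hz.cube hz.n_le
  unfold KalmanModel.processDual
  by_cases h : k < N
  · have hp := hz.pw_le ⟨k, h⟩
    simp only [dif_pos h]
    exact mat_mulVec hz.cube (mat_transpose (of_subset (Q_subset hI _)))
      (mat_mulVec hz.cube (mat_transpose (plq_B (w_subset hI _)))
        (of_subset (u_subset hI fun i => Sum.inr ⟨⟨k, h⟩, i⟩)))
  · simp only [dif_neg h]
    exact (Cost.vec_zero hnυ).weaken (by norm_num)

theorem cost_redVec (hI : inputs ⊆ I) (hz : SizeBound n m Sw Sv e υ) (k : ℕ) :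
    Cost υ I (coords (redVec k)) 248 := by
  have hn := hz.n_le
  have hnυ := le_of_cube_le hz.cube hz.n_le
  have h : ∀ k, Cost υ I (coords fun d => procLoad k d - d.K.processDual d.p.2.2.1 k) 83 :=
    fun k => vec_sub (cost_procLoad hI hz k) (cost_processDual hI hz k)
  exact (vec_add (cost_measLoad hI hz k) (vec_sub (h k) (mat_mulVec hz.cube
    (mat_transpose (cost_transition hI hz (k + 1))) (h (k + 1))))).weaken (by norm_num)

/-- The cost of the state components of the Newton direction. -/
theorem cost_dir_state (hI : inputs ⊆ I) (hz : SizeBound n m Sw Sv e υ) :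
    Cost υ I (⋃ k : Fin N, coords fun d i => d.dir.2.2.2 ⟨k, i⟩) (N * 8064) := by
  -- The right-hand side, with 248 units, is the most expensive coefficient, and 8064 = 32 · 248 +
  -- 128.
  have h := Cost.smoother (I := I) (N := N) (k := 248) hz.cube hz.n_le
    (C := measInfo (Sw := Sw) (Sv := Sv)) (E := procInfo)
    (G := fun k d => d.K.transition k) (r := redVec)
    (x := fun k d => KalmanModel.stateAt d.dir.2.2.2 k) measInfo_posSemidef procInfo_posDef
    (fun d => d.K.transition_zero) (fun d => by simp [KalmanModel.stateAt])
    (fun d k hk => d.reduced_equation k hk)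
    (fun k => (cost_measInfo hI hz k).weaken (by norm_num))
    (fun k => (cost_procInfo hI hz k).weaken (by norm_num))
    (fun k => (cost_transition hI hz k).weaken (by norm_num))
    (fun k => cost_redVec hI hz k)
  simpa only [KalmanModel.stateAt_val] using h

/-- The coordinates of a point in the blocks of time `k`. -/
def timeCoords {D : Type*}
    (f : D → IPPoint (Stack pv ⊕ Stack pw) (Stack fun _ : Fin N => n) (Stack lv ⊕ Stack lw))
    (k : Fin N) : Set (D → ℝ) :=
  coords (fun d j => (f d).1 (Sum.inl ⟨k, j⟩)) ∪ coords (fun d j => (f d).1 (Sum.inr ⟨k, j⟩)) ∪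
  coords (fun d j => (f d).2.1 (Sum.inl ⟨k, j⟩)) ∪
    coords (fun d j => (f d).2.1 (Sum.inr ⟨k, j⟩)) ∪
  coords (fun d j => (f d).2.2.1 (Sum.inl ⟨k, j⟩)) ∪
    coords (fun d j => (f d).2.2.1 (Sum.inr ⟨k, j⟩)) ∪ coords (fun d i => (f d).2.2.2 ⟨k, i⟩)

theorem pointCoords_subset {D : Type*}
    (f : D → IPPoint (Stack pv ⊕ Stack pw) (Stack fun _ : Fin N => n) (Stack lv ⊕ Stack lw)) :
    pointCoords f ⊆ ⋃ k, timeCoords f k := by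
  rintro g (((⟨⟨k, j⟩ | ⟨k, j⟩, rfl⟩ | ⟨⟨k, j⟩ | ⟨k, j⟩, rfl⟩) |
    ⟨⟨k, j⟩ | ⟨k, j⟩, rfl⟩) | ⟨⟨k, j⟩, rfl⟩) <;> refine Set.mem_iUnion.2 ⟨k, ?_⟩
  · exact Or.inl (Or.inl (Or.inl (Or.inl (Or.inl (Or.inl ⟨j, rfl⟩)))))
  · exact Or.inl (Or.inl (Or.inl (Or.inl (Or.inl (Or.inr ⟨j, rfl⟩)))))
  · exact Or.inl (Or.inl (Or.inl (Or.inl (Or.inr ⟨j, rfl⟩))))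
  · exact Or.inl (Or.inl (Or.inl (Or.inr ⟨j, rfl⟩)))
  · exact Or.inl (Or.inl (Or.inr ⟨j, rfl⟩))
  · exact Or.inl (Or.inr ⟨j, rfl⟩)
  · exact Or.inr ⟨j, rfl⟩

/-- The cost of the blocks of the Newton direction at time `k`, when its state components are
available. -/
theorem cost_dir_time (hI : inputs ⊆ I) (hz : SizeBound n m Sw Sv e υ)
    (hx : ∀ k, coords (fun d i => d.dir.2.2.2 ⟨k, i⟩) ⊆ I) (k : Fin N) :
    Cost υ I (timeCoords (fun d => d.dir) k) 800 := by
  have he := hz.cube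
  have hpv := hz.pv_le k
  have hpvυ := le_of_cube_le he hpv
  have hpw := hz.pw_le k
  have hpwυ := le_of_cube_le he hpw
  have hlv := hz.lv_le k
  have hlw := hz.lw_le k
  have hSv := hz.sv_le k
  have hSw := hz.sw_le k
  have huv : Cost υ I (coords fun d i => d.dir.2.2.1 (Sum.inl ⟨k, i⟩)) 77 := by
    rw [funext fun d : NewtonInstance N n m pw pv lw lv Sw Sv => (d.dir_blockV k).1]
    exact mat_mulVec he (cost_tMatV_inv hI hz k)
      (vec_sub (cost_measResidual hI hz hx k) (cost_loadV hI hz k))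
  have huw : Cost υ I (coords fun d i => d.dir.2.2.1 (Sum.inr ⟨k, i⟩)) 84 := by
    rw [funext fun d : NewtonInstance N n m pw pv lw lv Sw Sv => (d.dir_blockW k).1]
    exact mat_mulVec he (cost_tMatW_inv hI hz k)
      (vec_sub (cost_procResidual hI hz hx k) (cost_loadW hI hz k))
  have hsv : Cost υ I (coords fun d j => d.dir.1 (Sum.inl ⟨k, j⟩)) 88 := by
    rw [funext fun d : NewtonInstance N n m pw pv lw lv Sw Sv => (d.dir_blockV k).2.1]
    exact vec_sub (blockR₁ (v_subset hI k) (fun d => d.pattern_v k) (s_subset hI _)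
      (u_subset hI _)) (sparse_transpose_mulVec (fun d => d.pattern_v k)
        (plq_A (v_subset hI k)) huv)
  have hsw : Cost υ I (coords fun d j => d.dir.1 (Sum.inr ⟨k, j⟩)) 95 := by
    rw [funext fun d : NewtonInstance N n m pw pv lw lv Sw Sv => (d.dir_blockW k).2.1]
    exact vec_sub (blockR₁ (w_subset hI k) (fun d => d.pattern_w k) (s_subset hI _)
      (u_subset hI _)) (sparse_transpose_mulVec (fun d => d.pattern_w k)
        (plq_A (w_subset hI k)) huw)
  have hqv : Cost υ I (coords fun d j => d.dir.2.1 (Sum.inl ⟨k, j⟩)) 93 := by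
    rw [funext fun d : NewtonInstance N n m pw pv lw lv Sw Sv => (d.dir_blockV k).2.2]
    exact vec_div (fun d _ => (d.s_pos _).ne') (vec_sub (vec_sub (vec_const (γ_mem hI))
      (vec_mul (of_subset (q_subset hI _)) (of_subset (s_subset hI _))))
      (vec_mul (of_subset (q_subset hI _)) hsv)) (of_subset (s_subset hI _))
  have hqw : Cost υ I (coords fun d j => d.dir.2.1 (Sum.inr ⟨k, j⟩)) 100 := by
    rw [funext fun d : NewtonInstance N n m pw pv lw lv Sw Sv => (d.dir_blockW k).2.2]
    exact vec_div (fun d _ => (d.s_pos _).ne') (vec_sub (vec_sub (vec_const (γ_mem hI))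
      (vec_mul (of_subset (q_subset hI _)) (of_subset (s_subset hI _))))
      (vec_mul (of_subset (q_subset hI _)) hsw)) (of_subset (s_subset hI _))
  exact ((((((hsv.union hsw).union hqv).union hqw).union huv).union huw).union
    (of_subset (hx k))).weaken (by norm_num)

/-- The cost of the blocks of the next point at time `k`, when the direction is available. -/
theorem cost_next_time (hI : inputs ⊆ I) (hz : SizeBound n m Sw Sv e υ) {k : Fin N}
    (hd : timeCoords (fun d => d.dir) k ⊆ I) :
    Cost υ I (timeCoords (fun d => d.p + d.t • d.dir) k) 14 := by
  have he := hz.cube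
  have hn := le_of_cube_le he hz.n_le
  have hpv := le_of_cube_le he (hz.pv_le k)
  have hpw := le_of_cube_le he (hz.pw_le k)
  have hlv := hz.lv_le k
  have hlw := hz.lw_le k
  simp only [timeCoords, Set.union_subset_iff] at hd
  obtain ⟨⟨⟨⟨⟨⟨h1, h2⟩, h3⟩, h4⟩, h5⟩, h6⟩, h7⟩ := hd
  have ht := t_mem hI
  have g1 := vec_add (of_subset (υ := υ) (s_subset hI fun j => Sum.inl ⟨k, j⟩))
    (vec_smul ht (of_subset h1))
  have g2 := vec_add (of_subset (υ := υ) (s_subset hI fun j => Sum.inr ⟨k, j⟩))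
    (vec_smul ht (of_subset h2))
  have g3 := vec_add (of_subset (υ := υ) (q_subset hI fun j => Sum.inl ⟨k, j⟩))
    (vec_smul ht (of_subset h3))
  have g4 := vec_add (of_subset (υ := υ) (q_subset hI fun j => Sum.inr ⟨k, j⟩))
    (vec_smul ht (of_subset h4))
  have g5 := vec_add (of_subset (υ := υ) (u_subset hI fun j => Sum.inl ⟨k, j⟩))
    (vec_smul ht (of_subset h5))
  have g6 := vec_add (of_subset (υ := υ) (u_subset hI fun j => Sum.inr ⟨k, j⟩))
    (vec_smul ht (of_subset h6))
  have g7 := vec_add (of_subset (υ := υ) (y_subset hI fun i => ⟨k, i⟩))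
    (vec_smul ht (of_subset h7))
  exact ((((((g1.union g2).union g3).union g4).union g5).union g6).union g7).weaken (by norm_num)

/-- The cost of the Newton direction and the next point. -/
theorem cost_outputs (hI : inputs ⊆ I) (hz : SizeBound n m Sw Sv e υ) :
    Cost υ I outputs (N * 8878) := by
  -- Per time point: 8064 for the states, 800 for the remaining components of the direction, 14 for
  -- the next point.
  have h1 := (cost_dir_state hI hz).bind' fun J hJ hx => Cost.iUnion_fin (N := N) fun k =>
    cost_dir_time (hI.trans hJ) hz (fun k => (Set.iUnion_subset_iff.1 hx k)) k
  have h2 := h1.bind fun J hJ hd => Cost.iUnion_fin (N := N) fun k =>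
    cost_next_time (hI.trans hJ) hz (Set.iUnion_subset_iff.1 hd k)
  refine (h2.subset ?_).weaken (by omega)
  exact Set.union_subset_union (pointCoords_subset _) (pointCoords_subset _)

end Costs

/-! ### The operation count in terms of the model dimensions. -/

theorem sizeBound {l δ κ : ℕ} (hδ : 1 ≤ δ) (hκ : 1 ≤ κ) (hpw : ∀ k, pw k ≤ δ * n)
    (hpv : ∀ k, pv k ≤ δ * m) (hlw : ∀ k, lw k ≤ l) (hlv : ∀ k, lv k ≤ l)
    (hSw : ∀ k j, (Sw k j).card ≤ κ) (hSv : ∀ k j, (Sv k j).card ≤ κ) :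
    SizeBound n m Sw Sv (δ * (n + m)) ((δ * (n + m)) ^ 3 + κ ^ 2 * l) := by
  have hl : l ≤ κ ^ 2 * l := Nat.le_mul_of_pos_left _ (by positivity)
  have hsum : ∀ {a c : ℕ} (S : Fin c → Finset (Fin a)), c ≤ l → (∀ j, (S j).card ≤ κ) →
      ∑ j, (S j).card ^ 2 ≤ (δ * (n + m)) ^ 3 + κ ^ 2 * l := by
    intro a c S hc hS
    calc ∑ j, (S j).card ^ 2 ≤ ∑ _j : Fin c, κ ^ 2 :=
          Finset.sum_le_sum fun j _ => Nat.pow_le_pow_left (hS j) 2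
      _ = c * κ ^ 2 := by simp
      _ ≤ l * κ ^ 2 := Nat.mul_le_mul_right _ hc
      _ = κ ^ 2 * l := mul_comm _ _
      _ ≤ _ := Nat.le_add_left _ _
  refine ⟨Nat.le_add_right _ _, by nlinarith, by nlinarith, fun k => (hpw k).trans ?_,
    fun k => (hpv k).trans ?_, fun k => ?_, fun k => ?_, fun k => hsum _ (hlw k) (hSw k),
    fun k => hsum _ (hlv k) (hSv k)⟩
  · exact Nat.mul_le_mul_left _ (Nat.le_add_right _ _)
  · exact Nat.mul_le_mul_left _ (Nat.le_add_left _ _)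
  · exact (hlw k).trans (hl.trans (Nat.le_add_left _ _))
  · exact (hlv k).trans (hl.trans (Nat.le_add_left _ _))

/-- The difference of the two sides is 3(n + m)(n - m)². -/
theorem add_cube_le (n m : ℕ) : (n + m) ^ 3 ≤ 4 * (n ^ 3 + m ^ 3) := by
  zify
  nlinarith [mul_nonneg (add_nonneg (Nat.cast_nonneg (α := ℤ) n) (Nat.cast_nonneg m))
    (sq_nonneg ((n : ℤ) - m))]

theorem outputs_computableWithin {l δ κ : ℕ} (hδ : 1 ≤ δ) (hκ : 1 ≤ κ)
    (hpw : ∀ k, pw k ≤ δ * n) (hpv : ∀ k, pv k ≤ δ * m) (hlw : ∀ k, lw k ≤ l)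
    (hlv : ∀ k, lv k ≤ l) (hSw : ∀ k j, (Sw k j).card ≤ κ) (hSv : ∀ k j, (Sv k j).card ≤ κ) :
    ComputableWithin (inputs (n := n) (m := m) (Sw := Sw) (Sv := Sv)) outputs
      (35512 * (N * (δ ^ 3 * (n ^ 3 + m ^ 3) + κ ^ 2 * l))) := by
  have h := cost_outputs (n := n) (m := m) (Sw := Sw) (Sv := Sv) Set.Subset.rfl
    (sizeBound hδ hκ hpw hpv hlw hlv hSw hSv)
  refine ComputableWithin.mono h Set.Subset.rfl Set.Subset.rfl ?_
  -- The factor 4 from `add_cube_le` turns 8878 into 35512.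
  have h1 : (δ * (n + m)) ^ 3 + κ ^ 2 * l ≤ 4 * (δ ^ 3 * (n ^ 3 + m ^ 3) + κ ^ 2 * l) := by
    have := Nat.mul_le_mul_left (δ ^ 3) (add_cube_le n m)
    rw [mul_pow]
    linarith [Nat.zero_le (κ ^ 2 * l)]
  calc N * 8878 * ((δ * (n + m)) ^ 3 + κ ^ 2 * l)
      ≤ N * 8878 * (4 * (δ ^ 3 * (n ^ 3 + m ^ 3) + κ ^ 2 * l)) := Nat.mul_le_mul_left _ h1
    _ = _ := by ring

end NewtonInstance

end

/-! ### The theorem. -/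

theorem mainTheorem2 :
    -- solvability by an interior point method
    (∀ (N n m : ℕ) (pw pv lw lv : Fin N → ℕ) (K : KalmanModel N n m pw pv lw lv),
      K.HasPLQNoise → K.NullSpaceCondition → K.combined.strictlyFeasible.Nonempty →
      -- the problem has a solution
      (∃ x, K.objective x < ⊤ ∧ IsMinOn K.objective Set.univ x) ∧
      -- every interior point iteration is well defined: the Newton system is nonsingular, and it
      -- reduces to a symmetric positive definite block tridiagonal system for the states
      (∀ p ∈ K.combined.strictlyFeasible, ∀ γ : ℝ,
        (K.combined.kktDeriv γ p).IsInvertible ∧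
        IsUnit (K.combined.redT p) ∧
        (K.combined.redOmega p).PosDef ∧
        IsBlockTridiagonal (K.combined.redOmega p) ∧
        K.combined.redOmega p *ᵥ (K.combined.newtonDir γ p).2.2.2 = K.combined.redRhs γ p) ∧
      -- the iterations converge to solutions from every strictly feasible starting point
      (∀ p₀ ∈ K.combined.strictlyFeasible, ∀ σ ∈ Set.Ioo (0 : ℝ) 1,
        ∃ t₀ ∈ Set.Ioc (0 : ℝ) 1, ∀ t ∈ Set.Ioc 0 t₀,
          let p : ℕ → IPPoint (Stack pv ⊕ Stack pw) (Stack fun _ : Fin N => n)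
            (Stack lv ⊕ Stack lw) := fun j => (K.combined.ipIteration σ t)^[j] p₀
          (∀ j, p j ∈ K.combined.strictlyFeasible) ∧
          Tendsto (fun j => PLQData.gap (p j)) atTop (𝓝 0) ∧
          Tendsto (fun j => K.objective (p j).2.2.2) atTop (𝓝 (⨅ x, K.objective x)) ∧
          Bornology.IsBounded (Set.range p) ∧
          (∃ p', MapClusterPt p' atTop p) ∧
          ∀ p', MapClusterPt p' atTop p →
            K.combined.IsKKT p' ∧
            K.objective p'.2.2.2 < ⊤ ∧
            IsMinOn K.objective Set.univ p'.2.2.2 ∧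
            IsMaxOn K.posterior Set.univ p'.2.2.2)) ∧
    -- the cost of a Newton step
    (∃ C : ℕ, ∀ (N n m l δ κ : ℕ) (pw pv lw lv : Fin N → ℕ)
      (Sw : (k : Fin N) → Fin (lw k) → Finset (Fin (pw k)))
      (Sv : (k : Fin N) → Fin (lv k) → Finset (Fin (pv k))),
      1 ≤ δ → 1 ≤ κ →
      (∀ k, pw k ≤ δ * n) → (∀ k, pv k ≤ δ * m) →
      (∀ k, lw k ≤ l) → (∀ k, lv k ≤ l) →
      (∀ k j, (Sw k j).card ≤ κ) → (∀ k j, (Sv k j).card ≤ κ) →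
      ComputableWithin
        (NewtonInstance.inputs (N := N) (n := n) (m := m) (Sw := Sw) (Sv := Sv))
        NewtonInstance.outputs
        (C * (N * (δ ^ 3 * (n ^ 3 + m ^ 3) + κ ^ 2 * l)))) := by
  refine ⟨fun N n m pw pv lw lv K hK hN hne => ⟨hK.exists_isMinOn hN hne, fun p hp γ => ?_,
    fun p₀ hp₀ σ hσ => hK.interior_point_converges hN hp₀ hσ⟩, 35512, ?_⟩
  · have hP := hK.combined_regular hN
    have hs : ∀ i, 0 < p.1 i := hp.1
    have hq : ∀ i, 0 < p.2.1 i := hp.2.1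
    have hT := (hP.redT_posDef hs hq).isUnit
    exact ⟨hP.kktDeriv_isInvertible hs hq γ, hT, hP.redOmega_posDef hs hq,
      KalmanModel.combined_redOmega_isBlockTridiagonal hT, hP.redOmega_mulVec_newtonDir hs hq γ⟩
  · intro N n m l δ κ pw pv lw lv Sw Sv hδ hκ hpw hpv hlw hlv hSw hSv
    exact NewtonInstance.outputs_computableWithin hδ hκ hpw hpv hlw hlv hSw hSv
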